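/- Let $\Omega\subset\mathbb R^3$ be a bounded open set, $T>0$, $Q_T=\Omega\times(0,T)$, let $\lambda\in C_0^\infty(Q_T)$ be nonnegative (extended by zero to $\mathbb R^4$), and let $E,c_S,c_f\ge 0$. Then there is a constant $C$, depending only on $\Omega,T,\lambda,E,c_S,c_f$, with the following property. Let $\varepsilon>0$, $m>1$ and let $\varrho\ge 0$ (scalar), $\mathbf u,\mathbf f$ (vectors in $\mathbb R^3$) and $\mathbb S$ ($3\times3$ matrices) be measurable on $Q_T$. Put $P_\varepsilon=1+\varepsilon\varrho^m$. Assume $$\|\varrho^{3/2}P_\varepsilon\|_{L^\infty(0,T;L^1(\Omega))}+\|\varrho|\mathbf u|^2\|_{L^\infty(0,T;L^1(\Omega))}+\|\mathbf u\|_{L^2(0,T;W^{1,2}(\Omega))}\le E,$$ $$\|\mathbb S\|_{L^2(Q_T)}\le c_S,\qquad \|\mathbf f\|_{L^\infty(Q_T)}\le c_f,$$ and that for all vector fields $\boldsymbol\xi\in C_0^\infty(Q_T)$ and functions $\psi\in C_0^\infty(Q_T)$ $$\int_{Q_T}\varrho\mathbf u\cdot\partial_t\boldsymbol\xi\,dxdt+\int_{Q_T}\big(\varrho\mathbf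 u\otimes\mathbf u+\varrho^{3/2}P_\varepsilon\mathbb I-\mathbb S\big):\nabla\boldsymbol\xi\,dxdt+\int_{Q_T}\varrho\mathbf f\cdot\boldsymbol\xi\,dxdt=0,$$ $$\int_{Q_T}\big(\varrho\,\partial_t\psi+\varrho\mathbf u\cdot\nabla\psi\big)\,dxdt=0.$$ Set $\rho=\lambda^4\varrho$ and $\mathbf v=\lambda\mathbf u$, extended by zero to $\mathbb R^4$. For $\eta\ne0$ let $\Pi^\parallel(\eta)a=\frac{\eta\cdot a}{|\eta|^2}\eta$ and $\Pi^\bot(\eta)a=a-\Pi^\parallel(\eta)a$, and define $$E^\parallel(x,y,t)=\tfrac12\big|\Pi^\parallel(x-y)(\mathbf v(x,t)-\mathbf v(y,t))\big|^2+\rho(x,t)^{1/2}P_\varepsilon(x,t),$$ $$E^\bot(x,y,t)=\tfrac12\big|\Pi^\bot(x-y)(\mathbf v(x,t)-\mathbf v(y,t))\big|^2+2\rho(x,t)^{1/2}P_\varepsilon(x,t),$$ $$\Gamma(r)=\frac1r\int_{\mathbb R^4}\rho(x,t)\Big(\int_{B(x,r)}\rho(y,t)E^\parallel(x,y,t)\,dy\Big)dxdt,$$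 $$W(r)=\int_0^r\Big\{\int_{\mathbb R^4}\rho(x,t)\Big(\int_{B(x,s)}\rho(y,t)E^\bot(x,y,t)\,dy\Big)dxdt\Big\}\frac{ds}{s^2}.$$ Then $W(r)$ and $\Gamma(r)$ are finite for every $r\in(0,e^{-1}]$, and the functions $W$, $\Gamma$ and $\Phi=\Gamma-W$ satisfy $$W(r)+\Gamma(r)\le C,\qquad |\Phi(r)|\le C\sqrt r\qquad\text{for all } r\in(0,e^{-1}].$$ -/

import Mathlib

open MeasureTheory Set
open scoped NNReal ENNReal ContDiff

noncomputable section

namespace CriticalNS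

/-- Physical space `ℝ³` with its Euclidean structure. -/
abbrev Space : Type := EuclideanSpace ℝ (Fin 3)

/-- Space-time `ℝ³ × ℝ`; a point is `z = (x, t)`, the measure is Lebesgue measure. -/
abbrev SpaceTime : Type := Space × ℝ

/-- The cylinder `Q_T = Ω × (0, T)`. -/
def cylinder (Ω : Set Space) (T : ℝ) : Set SpaceTime := Ω ×ˢ Ioo 0 T

/-- `C_0^∞(U)`: smooth functions with compact support contained in `U`. -/
def IsTest {X Y : Type*} [NormedAddCommGroup X] [NormedSpace ℝ X]
    [NormedAddCommGroup Y] [NormedSpace ℝ Y] (U : Set X) (ξ : X → Y) : Prop :=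
  ContDiff ℝ ∞ ξ ∧ HasCompactSupport ξ ∧ tsupport ξ ⊆ U

/-- The time derivative `∂_t ξ`. -/
def timeDeriv {Y : Type*} [NormedAddCommGroup Y] [NormedSpace ℝ Y]
    (ξ : SpaceTime → Y) (z : SpaceTime) : Y :=
  fderiv ℝ ξ z (0, 1)

/-- The spatial derivative `∂_j ξ`. -/
def spaceDeriv {Y : Type*} [NormedAddCommGroup Y] [NormedSpace ℝ Y]
    (j : Fin 3) (ξ : SpaceTime → Y) (z : SpaceTime) : Y :=
  fderiv ℝ ξ z (EuclideanSpace.single j 1, 0)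

/-- The factor `P_ε = 1 + ε ϱ^m` of the artificial pressure `p = ϱ^{3/2} P_ε`. -/
def pressureFactor (ε m : ℝ) (ϱ : SpaceTime → ℝ) (z : SpaceTime) : ℝ :=
  1 + ε * ϱ z ^ m

/-- The artificial pressure `p = ϱ^{3/2} P_ε`. -/
def pressure (ε m : ℝ) (ϱ : SpaceTime → ℝ) (z : SpaceTime) : ℝ :=
  ϱ z ^ (3 / 2 : ℝ) * pressureFactor ε m ϱ z

/-- `(ϱ, u)` is a weak solution in `Q_T` of
`∂_t(ϱu) + div(ϱ u ⊗ u) + ∇p = div S + ϱ f`, `∂_t ϱ + div(ϱ u) = 0`, `ϱ ≥ 0`.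
The fields are given by Borel representatives on space-time; only their values in `Q_T` matter. -/
structure IsWeakSolution (Ω : Set Space) (T ε m : ℝ) (ϱ : SpaceTime → ℝ)
    (u f : SpaceTime → Space) (S : SpaceTime → Matrix (Fin 3) (Fin 3) ℝ) : Prop where
  measurable_density : Measurable ϱ
  measurable_velocity : Measurable u
  measurable_force : Measurable f
  measurable_stress : ∀ i j, Measurable fun z => S z i j
  density_nonneg : ∀ z ∈ cylinder Ω T, 0 ≤ ϱ z
  momentum : ∀ ξ : SpaceTime → Space, IsTest (cylinder Ω T) ξ →
    (∫ z in cylinder Ω T, ϱ z * inner ℝ (u z) (timeDeriv ξ z))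
      + (∫ z in cylinder Ω T, ∑ i, ∑ j,
          (ϱ z * u z i * u z j + (if i = j then pressure ε m ϱ z else 0) - S z i j)
            * spaceDeriv j ξ z i)
      + (∫ z in cylinder Ω T, ϱ z * inner ℝ (f z) (ξ z)) = 0
  mass : ∀ ψ : SpaceTime → ℝ, IsTest (cylinder Ω T) ψ →
    ∫ z in cylinder Ω T,
      (ϱ z * timeDeriv ψ z + ∑ j, ϱ z * u z j * spaceDeriv j ψ z) = 0

/-- For almost every `t ∈ (0, T)`, `D(·, t)` is the weak gradient in `Ω` of `u(·, t)`,
`D i j = ∂_j u_i`. -/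
def IsSpatialWeakGradient (Ω : Set Space) (T : ℝ) (u : SpaceTime → Space)
    (D : SpaceTime → Matrix (Fin 3) (Fin 3) ℝ) : Prop :=
  (∀ i j, Measurable fun z => D z i j) ∧
  ∀ᵐ t ∂(volume.restrict (Ioo 0 T)), ∀ φ : Space → ℝ, IsTest Ω φ → ∀ i j : Fin 3,
    ∫ x in Ω, u (x, t) i * fderiv ℝ φ x (EuclideanSpace.single j 1)
      = -∫ x in Ω, D (x, t) i j * φ x

/-- The norm of `g` in `L^∞(0, T; L^1(Ω))`. -/
def normLinftyL1 (Ω : Set Space) (T : ℝ) (g : SpaceTime → ℝ) : ℝ≥0∞ :=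
  essSup (fun t => ∫⁻ x in Ω, ‖g (x, t)‖ₑ) (volume.restrict (Ioo 0 T))

/-- The norm in `L²(0, T; W^{1,2}(Ω))` of a vector field `u` whose weak gradient is `D`. -/
def normL2W12 (Ω : Set Space) (T : ℝ) (u : SpaceTime → Space)
    (D : SpaceTime → Matrix (Fin 3) (Fin 3) ℝ) : ℝ≥0∞ :=
  (∫⁻ t in Ioo 0 T, ∫⁻ x in Ω,
    ENNReal.ofReal (‖u (x, t)‖ ^ 2 + ∑ i, ∑ j, D (x, t) i j ^ 2)) ^ (1 / 2 : ℝ)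

/-- The norm of a matrix field in `L²(Q)`. -/
def normL2 (Q : Set SpaceTime) (S : SpaceTime → Matrix (Fin 3) (Fin 3) ℝ) : ℝ≥0∞ :=
  (∫⁻ z in Q, ENNReal.ofReal (∑ i, ∑ j, S z i j ^ 2)) ^ (1 / 2 : ℝ)

/-- The energy estimate with constant `E`: `D` is the weak gradient of `u`, and
`‖ϱ^{3/2} P_ε‖_{L^∞(L^1)} + ‖ϱ|u|²‖_{L^∞(L^1)} + ‖u‖_{L²(W^{1,2})} ≤ E`. -/
def EnergyEstimate (Ω : Set Space) (T ε m : ℝ) (ϱ : SpaceTime → ℝ) (u : SpaceTime → Space)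
    (D : SpaceTime → Matrix (Fin 3) (Fin 3) ℝ) (E : ℝ≥0) : Prop :=
  IsSpatialWeakGradient Ω T u D ∧
  normLinftyL1 Ω T (pressure ε m ϱ) + normLinftyL1 Ω T (fun z => ϱ z * ‖u z‖ ^ 2)
    + normL2W12 Ω T u D ≤ E

/-- The localized density `ρ = l⁴ ϱ`; it vanishes outside the support of the cut-off `l`. -/
def locDensity (l ϱ : SpaceTime → ℝ) (z : SpaceTime) : ℝ := l z ^ 4 * ϱ z

/-- The localized velocity `v = l u`; it vanishes outside the support of the cut-off `l`. -/
def locVelocity (l : SpaceTime → ℝ) (u : SpaceTime → Space) (z : SpaceTime) : Space :=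
  l z • u z

/-- The orthogonal projection of `a` onto the line spanned by `η` (used for `η ≠ 0`). -/
def projPar (η a : Space) : Space := (inner ℝ η a / ‖η‖ ^ 2) • η

/-- The orthogonal projection of `a` onto the plane orthogonal to `η` (used for `η ≠ 0`). -/
def projPerp (η a : Space) : Space := a - projPar η a

/-- The longitudinal energy `E^∥(x, y, t)`; `P` is the pressure factor. -/
def energyPar (ρ : SpaceTime → ℝ) (v : SpaceTime → Space) (P : SpaceTime → ℝ)
    (x y : Space) (t : ℝ) : ℝ :=
  1 / 2 * ‖projPar (x - y) (v (x, t) - v (y, t))‖ ^ 2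
    + ρ (x, t) ^ (1 / 2 : ℝ) * P (x, t)

/-- The transversal energy `E^⊥(x, y, t)`; `P` is the pressure factor. -/
def energyPerp (ρ : SpaceTime → ℝ) (v : SpaceTime → Space) (P : SpaceTime → ℝ)
    (x y : Space) (t : ℝ) : ℝ :=
  1 / 2 * ‖projPerp (x - y) (v (x, t) - v (y, t))‖ ^ 2
    + 2 * (ρ (x, t) ^ (1 / 2 : ℝ) * P (x, t))

/-- `∫_{ℝ⁴} ρ(x,t) (∫_{B(x,s)} ρ(y,t) e(x,y,t) dy) dx dt` for a nonnegative `e` and `ρ`,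
as an integral with values in `[0, ∞]`. -/
def pairEnergy (ρ : SpaceTime → ℝ) (e : Space → Space → ℝ → ℝ) (s : ℝ) : ℝ≥0∞ :=
  ∫⁻ z : SpaceTime, ENNReal.ofReal (ρ z) *
    ∫⁻ y in Metric.ball z.1 s, ENNReal.ofReal (ρ (y, z.2) * e z.1 y z.2)

/-- `Γ(r) = (1/r) ∫ ρ(x,t) (∫_{B(x,r)} ρ(y,t) E^∥ dy) dx dt ∈ [0, ∞]`. -/
def Gam (ρ : SpaceTime → ℝ) (v : SpaceTime → Space) (P : SpaceTime → ℝ) (r : ℝ) : ℝ≥0∞ :=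
  ENNReal.ofReal (1 / r) * pairEnergy ρ (energyPar ρ v P) r

/-- `W(r) = ∫_0^r {∫ ρ(x,t) (∫_{B(x,s)} ρ(y,t) E^⊥ dy) dx dt} ds / s² ∈ [0, ∞]`. -/
def Wen (ρ : SpaceTime → ℝ) (v : SpaceTime → Space) (P : SpaceTime → ℝ) (r : ℝ) : ℝ≥0∞ :=
  ∫⁻ s in Ioo 0 r, pairEnergy ρ (energyPerp ρ v P) s * ENNReal.ofReal (1 / s ^ 2)

/-- `Φ = Γ - W` (meaningful where `Γ` and `W` are finite). -/
def Phi (ρ : SpaceTime → ℝ) (v : SpaceTime → Space) (P : SpaceTime → ℝ) (r : ℝ) : ℝ :=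
  (Gam ρ v P r).toReal - (Wen ρ v P r).toReal

end CriticalNS

end

/-! The proof is a two-point energy identity. The localized momentum equation at `x` is tested with
the field obtained by convolving `ρ(·, t)` with a radial vector kernel `K(x - y)`, and the localized
mass equation at `y` removes the time derivative. The total time derivative integrates to zero,
since the cut-off vanishes near the ends of the time interval. After symmetrization in `x` and `y`,
with `w = v(x,t) - v(y,t)`, there remains the integral of `ρ(x)ρ(y) {½ DK : w ⊗ w + ρ(x)^{1/2} P(x)
div K}`, and it equals an error.

The kernel is `K(z) = k(|z|) z` with `k(s) = ∫_s^r χ(σ) σ⁻² dσ`, so that `DK = k I - χ |z|⁻³ z ⊗ z`.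
The eigenvalue of `DK` is `k` across `z` and `k - χ/|z|` along `z`, and `div K = 2k + (k - χ/|z|)`;
this is why the pressure enters `E^⊥` twice and `E^∥` once. When `χ` tends to the indicator of `[δ,
r)`, `k` becomes the layer-cake weight `∫_δ^r 1_{s<σ} σ⁻² dσ`, and `k - χ/s` becomes `δ⁻¹ 1_{s<δ} -
r⁻¹ 1_{s<r}`. The identity then reads: (part of `W` over `(δ, r)`) `+ Γ(δ) - Γ(r) =` error.

Sizes come from the critical exponent 3/2: `ϱ ≤ a p + a⁻²` for every `a > 0`. With `a = r`, a ball
of radius `r` has mass at most `C r` (`Controlled.slice_dens_ball`), which bounds `Γ`. With `a = δM`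
and the shrinking of balls to the diagonal, `Γ(δ) → 0` (`Controlled.tendsto_ballInteraction`). In
the error, the stress is absorbed by Young's inequality and `∫ |DK|² ≤ C r`; the difference of
cut-offs compensates `|DK| ≤ 2/|z|`; the force meets the bounded kernel and the mass of a ball. The
source of the localized mass equation is the only term worse than `O(r)`: Young's inequality with
parameter `r^{-1/2}` makes it `O(√r)` (`Controlled.errBound_integral_le`). All these bounds are
uniform in `δ`, so `|Γ - W| ≤ C √r`, and `W ≤ Γ + C`.

The fields are too rough in time for the equations to be tested with each other directly.
`two_point_identity` therefore doubles the time variable, uses a kernel `θ(t - s)`, and lets `θ`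
concentrate. The algebra is in `symmetrized_integrand`, the passage `δ → 0` in `layers_limit`. -/

namespace CriticalNS

open Filter Topology

/-! ### Pair integrals and mollification in time -/

lemma ae_of_ae_time {p : ℝ → Prop} (h : ∀ᵐ t : ℝ, p t) : ∀ᵐ z : SpaceTime, p z.2 :=
  Measure.quasiMeasurePreserving_snd.ae h

/-- A product of an integrable density in `(x, t)` and a density in `(y, t)` whose integrals against
the kernel `κ (x - ·)` are uniformly bounded. -/
lemma pair_bound {X Y : SpaceTime → ℝ} {κ : Space → ℝ} {B : ℝ} (hX : Integrable X)
    (hX0 : ∀ z, 0 ≤ X z) (hY : Measurable Y) (hκ : Measurable κ)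
    (hYκ : ∀ z x, 0 ≤ Y z * κ x) (hB : 0 ≤ B)
    (hslice : ∀ᵐ t : ℝ, ∀ x : Space,
      ∫⁻ y : Space, ENNReal.ofReal (Y (y, t) * κ (x - y)) ≤ ENNReal.ofReal B) :
    Integrable (fun p : SpaceTime × Space => X p.1 * (Y (p.2, p.1.2) * κ (p.1.1 - p.2))) ∧
    ∫ p : SpaceTime × Space, X p.1 * (Y (p.2, p.1.2) * κ (p.1.1 - p.2)) ≤ (∫ z, X z) * B := by
  have hm : AEStronglyMeasurable
      (fun p : SpaceTime × Space => X p.1 * (Y (p.2, p.1.2) * κ (p.1.1 - p.2))) volume :=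
    (hX.1.comp_quasiMeasurePreserving Measure.quasiMeasurePreserving_fst).mul
      (Measurable.aestronglyMeasurable (by fun_prop))
  have h0 : ∀ p : SpaceTime × Space, 0 ≤ X p.1 * (Y (p.2, p.1.2) * κ (p.1.1 - p.2)) :=
    fun p => mul_nonneg (hX0 _) (hYκ _ _)
  have key : ∫⁻ p : SpaceTime × Space,
      ENNReal.ofReal (X p.1 * (Y (p.2, p.1.2) * κ (p.1.1 - p.2)))
        ≤ ENNReal.ofReal ((∫ z, X z) * B) := by
    rw [Measure.volume_eq_prod, lintegral_prod _ hm.aemeasurable.ennreal_ofReal]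
    calc ∫⁻ z : SpaceTime, ∫⁻ y : Space, ENNReal.ofReal (X z * (Y (y, z.2) * κ (z.1 - y)))
        = ∫⁻ z : SpaceTime, ENNReal.ofReal (X z) *
            ∫⁻ y : Space, ENNReal.ofReal (Y (y, z.2) * κ (z.1 - y)) := by
          refine lintegral_congr fun z => ?_
          rw [← lintegral_const_mul _ (by fun_prop)]
          exact lintegral_congr fun y => ENNReal.ofReal_mul (hX0 z)
      _ ≤ ∫⁻ z : SpaceTime, ENNReal.ofReal (X z) * ENNReal.ofReal B := by
          refine lintegral_mono_ae ?_
          filter_upwards [ae_of_ae_time hslice] with z hz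
          gcongr
          exact hz z.1
      _ = ENNReal.ofReal ((∫ z, X z) * B) := by
          rw [lintegral_mul_const'' _ hX.1.aemeasurable.ennreal_ofReal,
            ← ofReal_integral_eq_lintegral_ofReal hX (ae_of_all _ hX0),
            ENNReal.ofReal_mul (integral_nonneg hX0)]
  have hint : Integrable
      (fun p : SpaceTime × Space => X p.1 * (Y (p.2, p.1.2) * κ (p.1.1 - p.2))) := by
    refine ⟨hm, ?_⟩
    rw [hasFiniteIntegral_iff_ofReal (ae_of_all _ h0)]
    exact key.trans_lt ENNReal.ofReal_lt_top
  refine ⟨hint, ?_⟩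
  rw [← ofReal_integral_eq_lintegral_ofReal hint (ae_of_all _ h0)] at key
  exact (ENNReal.ofReal_le_ofReal_iff (mul_nonneg (integral_nonneg hX0) hB)).1 key

/-- A bounded kernel is dominated by its supremum, so `pair_bound` with the constant kernel 1
suffices. -/
lemma integrable_pair {a b : SpaceTime → ℝ} {κ : Space → ℝ} {C M : ℝ} (ha : Integrable a)
    (hb : Measurable b) (hC : 0 ≤ C)
    (hslice : ∀ᵐ t : ℝ, ∫⁻ y : Space, ‖b (y, t)‖ₑ ≤ ENNReal.ofReal C)
    (hκ : Measurable κ) (hM : ∀ x, |κ x| ≤ M) :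
    Integrable (fun p : SpaceTime × Space => a p.1 * b (p.2, p.1.2) * κ (p.1.1 - p.2)) := by
  have h1 := (pair_bound (X := fun z => |a z|) (Y := fun z => |b z|) (κ := fun _ => 1) (B := C)
    ha.abs (fun z => abs_nonneg _) hb.abs measurable_const (fun z x => by positivity) hC
    (by
      filter_upwards [hslice] with t ht x
      simpa [Real.enorm_eq_ofReal_abs] using ht)).1
  refine (h1.mul_const M).mono' ?_ (ae_of_all _ fun p => ?_)
  · exact ((ha.1.comp_quasiMeasurePreserving Measure.quasiMeasurePreserving_fst).mul
      (Measurable.aestronglyMeasurable (by fun_prop))).mul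
      (Measurable.aestronglyMeasurable (by fun_prop))
  · simp only [Real.norm_eq_abs, abs_mul, mul_one]
    exact mul_le_mul_of_nonneg_left (hM _) (by positivity)

/-- The potential of a slice. -/
noncomputable def slicePotential (b : SpaceTime → ℝ) (κ : Space → ℝ) (x : Space) (t : ℝ) : ℝ :=
  ∫ y : Space, b (y, t) * κ (x - y)

lemma abs_slicePotential_le {b : SpaceTime → ℝ} {κ : Space → ℝ} {C M : ℝ}
    (hC : 0 ≤ C) {t : ℝ} (ht : ∫⁻ y : Space, ‖b (y, t)‖ₑ ≤ ENNReal.ofReal C)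
    (hM : ∀ x, |κ x| ≤ M) (x : Space) : |slicePotential b κ x t| ≤ C * M := by
  have hM0 : 0 ≤ M := (abs_nonneg _).trans (hM 0)
  have h := enorm_integral_le_lintegral_enorm (μ := volume) (fun y : Space => b (y, t) * κ (x - y))
  rw [Real.enorm_eq_ofReal_abs] at h
  refine (ENNReal.ofReal_le_ofReal_iff (mul_nonneg hC hM0)).1 (h.trans ?_)
  calc ∫⁻ y : Space, ‖b (y, t) * κ (x - y)‖ₑ ≤ ∫⁻ y : Space, ‖b (y, t)‖ₑ * ENNReal.ofReal M := by
        refine lintegral_mono fun y => ?_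
        rw [enorm_mul, Real.enorm_eq_ofReal_abs (κ (x - y))]
        gcongr
        exact hM _
    _ = (∫⁻ y : Space, ‖b (y, t)‖ₑ) * ENNReal.ofReal M :=
        lintegral_mul_const' _ _ ENNReal.ofReal_ne_top
    _ ≤ ENNReal.ofReal (C * M) := by
        rw [ENNReal.ofReal_mul hC]; gcongr

lemma stronglyMeasurable_slicePotential {b : SpaceTime → ℝ} {κ : Space → ℝ} (hb : Measurable b)
    (hκ : Measurable κ) :
    StronglyMeasurable (fun z : SpaceTime => slicePotential b κ z.1 z.2) := by
  unfold slicePotential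
  have : Measurable (fun p : SpaceTime × Space => b (p.2, p.1.2) * κ (p.1.1 - p.2)) := by fun_prop
  exact this.stronglyMeasurable.integral_prod_right

lemma integrable_doubled {a b : SpaceTime → ℝ} {κ : Space → ℝ} {θ : ℝ → ℝ} {M N : ℝ}
    (ha : Integrable a) (hb : Integrable b) (hκ : Measurable κ) (hM : ∀ x, |κ x| ≤ M)
    (hθ : Measurable θ) (hN : ∀ s, |θ s| ≤ N) :
    Integrable (fun w : SpaceTime × SpaceTime =>
      a w.1 * b w.2 * (κ (w.1.1 - w.2.1) * θ (w.1.2 - w.2.2))) := by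
  refine (ha.mul_prod hb).mul_bdd (c := M * N)
    (Measurable.aestronglyMeasurable (by fun_prop)) (ae_of_all _ fun w => ?_)
  rw [Real.norm_eq_abs, abs_mul]
  exact mul_le_mul (hM _) (hN _) (abs_nonneg _) ((abs_nonneg _).trans (hM 0))

/-- Fubini in the order `y`, `s`, `(x, t)` leaves a convolution in time alone, acting on the slice
potential. -/
lemma integral_doubled_eq {a b : SpaceTime → ℝ} {κ : Space → ℝ} {θ : ℝ → ℝ} {M N : ℝ}
    (ha : Integrable a) (hb : Integrable b) (hκ : Measurable κ) (hM : ∀ x, |κ x| ≤ M)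
    (hθ : Measurable θ) (hN : ∀ s, |θ s| ≤ N) :
    ∫ w : SpaceTime × SpaceTime, a w.1 * b w.2 * (κ (w.1.1 - w.2.1) * θ (w.1.2 - w.2.2))
      = ∫ z : SpaceTime, a z * ∫ s : ℝ, θ (z.2 - s) * slicePotential b κ z.1 s := by
  rw [Measure.volume_eq_prod, integral_prod _ (integrable_doubled ha hb hκ hM hθ hN)]
  refine integral_congr_ae (ae_of_all _ fun z => ?_)
  have hi : Integrable (fun z' : SpaceTime => b z' * (κ (z.1 - z'.1) * θ (z.2 - z'.2))) := by
    refine hb.mul_bdd (c := M * N)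
      (Measurable.aestronglyMeasurable (by fun_prop)) (ae_of_all _ fun w => ?_)
    rw [Real.norm_eq_abs, abs_mul]
    exact mul_le_mul (hM _) (hN _) (abs_nonneg _) ((abs_nonneg _).trans (hM 0))
  simp only [mul_assoc]
  rw [integral_const_mul]
  congr 1
  rw [Measure.volume_eq_prod] at hi ⊢
  rw [integral_prod_symm _ hi]
  refine integral_congr_ae (ae_of_all _ fun s => ?_)
  simp only [slicePotential]
  rw [← integral_const_mul]
  exact integral_congr_ae (ae_of_all _ fun y => by ring)

lemma integral_pair_eq {a b : SpaceTime → ℝ} {κ : Space → ℝ} {C M : ℝ} (ha : Integrable a)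
    (hb : Measurable b) (hC : 0 ≤ C)
    (hslice : ∀ᵐ t : ℝ, ∫⁻ y : Space, ‖b (y, t)‖ₑ ≤ ENNReal.ofReal C)
    (hκ : Measurable κ) (hM : ∀ x, |κ x| ≤ M) :
    ∫ p : SpaceTime × Space, a p.1 * b (p.2, p.1.2) * κ (p.1.1 - p.2)
      = ∫ z : SpaceTime, a z * slicePotential b κ z.1 z.2 := by
  rw [Measure.volume_eq_prod, integral_prod _ (integrable_pair ha hb hC hslice hκ hM)]
  refine integral_congr_ae (ae_of_all _ fun z => ?_)
  simp only [slicePotential, mul_assoc]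
  rw [integral_const_mul]

/-- For fixed `x` the slice potential is bounded in time by `C * M`, so its mollifications converge
at almost every time by Lebesgue differentiation, and `|a| * (C * M)` dominates. The uniform bound
on the slices of `b` is what allows `a` to be merely integrable. -/
lemma tendsto_mollified_pair {a b : SpaceTime → ℝ} {κ : Space → ℝ} {C M : ℝ} (ha : Integrable a)
    (hb : Measurable b) (hbi : Integrable b) (hC : 0 ≤ C)
    (hslice : ∀ᵐ t : ℝ, ∫⁻ y : Space, ‖b (y, t)‖ₑ ≤ ENNReal.ofReal C)
    (hκ : Measurable κ) (hM : ∀ x, |κ x| ≤ M) (φ : ℕ → ContDiffBump (0 : ℝ)) {L : ℝ}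
    (hφ : Tendsto (fun n => (φ n).rOut) atTop (𝓝 0)) (hφ' : ∀ n, (φ n).rOut ≤ L * (φ n).rIn) :
    Tendsto (fun n => ∫ w : SpaceTime × SpaceTime,
        a w.1 * b w.2 * (κ (w.1.1 - w.2.1) * (φ n).normed volume (w.1.2 - w.2.2))) atTop
      (𝓝 (∫ p : SpaceTime × Space, a p.1 * b (p.2, p.1.2) * κ (p.1.1 - p.2))) := by
  have hM0 : 0 ≤ M := (abs_nonneg _).trans (hM 0)
  rw [integral_pair_eq ha hb hC hslice hκ hM]
  have hθm : ∀ n, Measurable ((φ n).normed (volume : Measure ℝ)) :=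
    fun n => (φ n).continuous_normed.measurable
  have hθb : ∀ n, ∃ N, ∀ s, |(φ n).normed (volume : Measure ℝ) s| ≤ N := fun n => by
    obtain ⟨N, hN⟩ := (φ n).hasCompactSupport_normed (μ := (volume : Measure ℝ))
      |>.exists_bound_of_continuous (φ n).continuous_normed
    exact ⟨N, hN⟩
  have hFb : ∀ x, ∀ᵐ t : ℝ, |slicePotential b κ x t| ≤ C * M := fun x => by
    filter_upwards [hslice] with t ht using abs_slicePotential_le hC ht hM x
  have hFm := stronglyMeasurable_slicePotential hb hκ
  have hFx : ∀ x, StronglyMeasurable (fun t => slicePotential b κ x t) := fun x =>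
    hFm.comp_measurable (measurable_const.prodMk measurable_id)
  have hb_int : ∀ n (z : SpaceTime),
      |∫ s : ℝ, (φ n).normed volume (z.2 - s) * slicePotential b κ z.1 s| ≤ C * M := by
    intro n z
    have h1 : ∫ s : ℝ, (φ n).normed volume (z.2 - s) * (C * M) = C * M := by
      rw [integral_mul_const, integral_sub_left_eq_self ((φ n).normed volume) volume z.2,
        (φ n).integral_normed, one_mul]
    rw [← h1, ← Real.norm_eq_abs]
    refine norm_integral_le_of_norm_le ?_ ?_
    · exact ((φ n).integrable_normed.comp_sub_left z.2).mul_const _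
    · filter_upwards [hFb z.1] with s hs
      rw [norm_mul, Real.norm_of_nonneg ((φ n).nonneg_normed _)]
      exact mul_le_mul_of_nonneg_left hs ((φ n).nonneg_normed _)
  have hGm : ∀ n, StronglyMeasurable (fun z : SpaceTime =>
      ∫ s : ℝ, (φ n).normed volume (z.2 - s) * slicePotential b κ z.1 s) := fun n => by
    have : StronglyMeasurable (fun q : SpaceTime × ℝ =>
        (φ n).normed volume (q.1.2 - q.2) * slicePotential b κ q.1.1 q.2) := by
      refine StronglyMeasurable.mul ?_ ?_
      · exact ((hθm n).comp (by fun_prop)).stronglyMeasurable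
      · exact hFm.comp_measurable (g := fun q : SpaceTime × ℝ => ((q.1.1, q.2) : SpaceTime))
          (by fun_prop)
    exact this.integral_prod_right
  have hpt : ∀ᵐ z : SpaceTime, Tendsto
      (fun n => ∫ s : ℝ, (φ n).normed volume (z.2 - s) * slicePotential b κ z.1 s) atTop
      (𝓝 (slicePotential b κ z.1 z.2)) := by
    -- Lebesgue differentiation gives a null set of times for each `x`; Fubini makes it a null set
    -- of space-time once the convergence set is known to be measurable.
    rw [Measure.volume_eq_prod, Measure.ae_prod_iff_ae_ae]
    · refine ae_of_all _ fun x => ?_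
      have hloc : LocallyIntegrable (fun t => slicePotential b κ x t) (volume : Measure ℝ) := by
        refine (locallyIntegrable_const (C * M)).mono (hFx x).aestronglyMeasurable ?_
        filter_upwards [hFb x] with t ht
        rwa [Real.norm_eq_abs, Real.norm_of_nonneg (by positivity)]
      have := ContDiffBump.ae_convolution_tendsto_right_of_locallyIntegrable hφ
        (Eventually.of_forall hφ') hloc
      filter_upwards [this] with t ht
      simpa only [convolution_lsmul_swap, smul_eq_mul] using ht
    -- The limit depends on `z`; subtracting it leaves convergence to the fixed value 0, whose set
    -- is measurable.
    · have : {z : SpaceTime | Tendsto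
          (fun n => ∫ s : ℝ, (φ n).normed volume (z.2 - s) * slicePotential b κ z.1 s) atTop
          (𝓝 (slicePotential b κ z.1 z.2))} = {z : SpaceTime | Tendsto
          (fun n => (∫ s : ℝ, (φ n).normed volume (z.2 - s) * slicePotential b κ z.1 s)
            - slicePotential b κ z.1 z.2) atTop (𝓝 0)} := by
        ext z
        exact tendsto_sub_nhds_zero_iff.symm
      rw [this]
      exact measurableSet_tendsto (𝓝 0) (fun n => ((hGm n).sub hFm).measurable)
  have hcongr : ∀ n, ∫ w : SpaceTime × SpaceTime,
      a w.1 * b w.2 * (κ (w.1.1 - w.2.1) * (φ n).normed volume (w.1.2 - w.2.2))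
      = ∫ z : SpaceTime, a z *
        ∫ s : ℝ, (φ n).normed volume (z.2 - s) * slicePotential b κ z.1 s := fun n => by
    obtain ⟨N, hN⟩ := hθb n
    exact integral_doubled_eq ha hbi hκ hM (hθm n) hN
  simp_rw [hcongr]
  refine tendsto_integral_of_dominated_convergence (fun z => |a z| * (C * M))
    (fun n => ha.1.mul (hGm n).aestronglyMeasurable) (ha.abs.mul_const _) (fun n => ?_) ?_
  · refine ae_of_all _ fun z => ?_
    rw [norm_mul, Real.norm_eq_abs, Real.norm_eq_abs]
    exact mul_le_mul_of_nonneg_left (hb_int n z) (abs_nonneg _)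
  · filter_upwards [hpt] with z hz using hz.const_mul _

/-! ### Balance laws and the two-point identity -/

/-- The partial derivative `∂_j k` on space. -/
noncomputable def partialD (j : Fin 3) (k : Space → ℝ) (x : Space) : ℝ :=
  fderiv ℝ k x (EuclideanSpace.single j 1)

/-- `∂_t q + div M = h` in the sense of distributions on all of space-time. -/
def IsBalance (q h : SpaceTime → ℝ) (M : Fin 3 → SpaceTime → ℝ) : Prop :=
  ∀ φ : SpaceTime → ℝ, ContDiff ℝ ∞ φ →
    ∫ z, (q z * timeDeriv φ z + ∑ j, M j z * spaceDeriv j φ z + h z * φ z) = 0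

lemma hasFDerivAt_tensor {g : Space → ℝ} {h : ℝ → ℝ} {z : SpaceTime}
    (hg : DifferentiableAt ℝ g z.1) (hh : DifferentiableAt ℝ h z.2) :
    HasFDerivAt (fun z : SpaceTime => g z.1 * h z.2)
      (g z.1 • ((fderiv ℝ h z.2).comp (ContinuousLinearMap.snd ℝ Space ℝ)) +
        h z.2 • ((fderiv ℝ g z.1).comp (ContinuousLinearMap.fst ℝ Space ℝ))) z :=
  (hg.hasFDerivAt.comp z hasFDerivAt_fst).mul (hh.hasFDerivAt.comp z hasFDerivAt_snd)

lemma timeDeriv_tensor {g : Space → ℝ} {h : ℝ → ℝ} {z : SpaceTime}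
    (hg : DifferentiableAt ℝ g z.1) (hh : DifferentiableAt ℝ h z.2) :
    timeDeriv (fun z : SpaceTime => g z.1 * h z.2) z = g z.1 * deriv h z.2 := by
  rw [timeDeriv, (hasFDerivAt_tensor hg hh).fderiv]
  simp

lemma spaceDeriv_tensor {g : Space → ℝ} {h : ℝ → ℝ} {z : SpaceTime} (j : Fin 3)
    (hg : DifferentiableAt ℝ g z.1) (hh : DifferentiableAt ℝ h z.2) :
    spaceDeriv j (fun z : SpaceTime => g z.1 * h z.2) z = partialD j g z.1 * h z.2 := by
  rw [spaceDeriv, (hasFDerivAt_tensor hg hh).fderiv]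
  simp [partialD, mul_comm]

lemma partialD_sub_const (j : Fin 3) (k : Space → ℝ) (x y : Space) :
    partialD j (fun x => k (x - y)) x = partialD j k (x - y) := by
  rw [partialD, fderiv_comp_sub, partialD]

lemma partialD_const_sub (j : Fin 3) {k : Space → ℝ} (hk : Differentiable ℝ k) (x y : Space) :
    partialD j (fun y => k (x - y)) y = -partialD j k (x - y) := by
  have h : HasFDerivAt (fun y => k (x - y))
      ((fderiv ℝ k (x - y)).comp (-ContinuousLinearMap.id ℝ Space)) y :=
    (hk (x - y)).hasFDerivAt.comp y ((hasFDerivAt_id y).const_sub x)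
  rw [partialD, h.fderiv, partialD]
  simp

lemma integrable_add_sum_add {α : Type*} [MeasurableSpace α] {μ : Measure α}
    {f g : α → ℝ} {F : Fin 3 → α → ℝ} (hf : Integrable f μ)
    (hF : ∀ j, Integrable (F j) μ) (hg : Integrable g μ) :
    Integrable (fun x => f x + ∑ j, F j x + g x) μ :=
  (hf.add (integrable_finsetSum _ fun j _ => hF j)).add hg

lemma integral_add_sum_add {α : Type*} [MeasurableSpace α] {μ : Measure α}
    {f g : α → ℝ} {F : Fin 3 → α → ℝ} (hf : Integrable f μ)
    (hF : ∀ j, Integrable (F j) μ) (hg : Integrable g μ) :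
    ∫ x, (f x + ∑ j, F j x + g x) ∂μ = ∫ x, f x ∂μ + ∑ j, ∫ x, F j x ∂μ + ∫ x, g x ∂μ := by
  have hFs : Integrable (fun x => ∑ j, F j x) μ := integrable_finsetSum _ fun j _ => hF j
  have hfF : Integrable (fun x => f x + ∑ j, F j x) μ := hf.add hFs
  rw [integral_add hfF hg, integral_add hf hFs, integral_finsetSum _ fun j _ => hF j]

/-- The doubling of variables for two balance laws, with a time kernel `θ (t - s)`. -/
lemma doubled_identity {q h ρ σ : SpaceTime → ℝ} {M J : Fin 3 → SpaceTime → ℝ}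
    (hq : Integrable q) (hh : Integrable h) (hρ : Integrable ρ) (hσ : Integrable σ)
    (hM : ∀ j, Integrable (M j)) (hJ : ∀ j, Integrable (J j))
    (hbal : IsBalance q h M) (hbal' : IsBalance ρ σ J)
    {k : Space → ℝ} (hk : ContDiff ℝ ∞ k) {A : ℝ} (hkb : ∀ x, |k x| ≤ A)
    (hkb' : ∀ j x, |partialD j k x| ≤ A) {θ : ℝ → ℝ} (hθ : ContDiff ℝ ∞ θ)
    (hθc : HasCompactSupport θ) :
    ((∑ j, ∫ w : SpaceTime × SpaceTime,
        M j w.1 * ρ w.2 * (partialD j k (w.1.1 - w.2.1) * θ (w.1.2 - w.2.2)))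
      + ∫ w : SpaceTime × SpaceTime, h w.1 * ρ w.2 * (k (w.1.1 - w.2.1) * θ (w.1.2 - w.2.2)))
    + ((-∑ j, ∫ w : SpaceTime × SpaceTime,
        q w.1 * J j w.2 * (partialD j k (w.1.1 - w.2.1) * θ (w.1.2 - w.2.2)))
      + ∫ w : SpaceTime × SpaceTime, q w.1 * σ w.2 * (k (w.1.1 - w.2.1) * θ (w.1.2 - w.2.2)))
      = 0 := by
  have hkd : Differentiable ℝ k := hk.differentiable (by simp)
  have hθd : Differentiable ℝ θ := hθ.differentiable (by simp)
  have hkm : Measurable k := hk.continuous.measurable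
  have hkm' : ∀ j, Measurable (partialD j k) := fun j =>
    ((hk.continuous_fderiv (by simp)).clm_apply continuous_const).measurable
  have hθm : Measurable θ := hθ.continuous.measurable
  have hθm' : Measurable (deriv θ) := (hθ.continuous_deriv (by simp)).measurable
  obtain ⟨N, hN⟩ := hθc.exists_bound_of_continuous hθ.continuous
  obtain ⟨N', hN'⟩ := hθc.deriv.exists_bound_of_continuous (hθ.continuous_deriv (by simp))
  have I₁ : ∀ {a b : SpaceTime → ℝ}, Integrable a → Integrable b →
      Integrable (fun w : SpaceTime × SpaceTime =>
        a w.1 * b w.2 * (k (w.1.1 - w.2.1) * θ (w.1.2 - w.2.2))) := fun ha hb =>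
    integrable_doubled ha hb hkm hkb hθm hN
  have I₂ : ∀ {a b : SpaceTime → ℝ} (j : Fin 3), Integrable a → Integrable b →
      Integrable (fun w : SpaceTime × SpaceTime =>
        a w.1 * b w.2 * (partialD j k (w.1.1 - w.2.1) * θ (w.1.2 - w.2.2))) := fun j ha hb =>
    integrable_doubled ha hb (hkm' j) (hkb' j) hθm hN
  have I₃ : ∀ {a b : SpaceTime → ℝ}, Integrable a → Integrable b →
      Integrable (fun w : SpaceTime × SpaceTime =>
        a w.1 * b w.2 * (k (w.1.1 - w.2.1) * deriv θ (w.1.2 - w.2.2))) := fun ha hb =>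
    integrable_doubled ha hb hkm hkb hθm' hN'
  have hneg : Integrable (fun w : SpaceTime × SpaceTime =>
      -(q w.1 * σ w.2 * (k (w.1.1 - w.2.1) * θ (w.1.2 - w.2.2)))) := (I₁ hq hσ).neg
  -- The first balance law is tested with the kernel as a function of the first point, the second
  -- point being frozen with weight `ρ`.
  have e₁ : ∫ w : SpaceTime × SpaceTime,
      (q w.1 * ρ w.2 * (k (w.1.1 - w.2.1) * deriv θ (w.1.2 - w.2.2))
        + ∑ j, M j w.1 * ρ w.2 * (partialD j k (w.1.1 - w.2.1) * θ (w.1.2 - w.2.2))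
        + h w.1 * ρ w.2 * (k (w.1.1 - w.2.1) * θ (w.1.2 - w.2.2))) = 0 := by
    rw [Measure.volume_eq_prod, integral_prod_symm _
      (integrable_add_sum_add (I₃ hq hρ) (fun j => I₂ j (hM j) hρ) (I₁ hh hρ))]
    refine integral_eq_zero_of_ae (ae_of_all _ fun z' => ?_)
    have := hbal (fun z => k (z.1 - z'.1) * θ (z.2 - z'.2)) (by fun_prop)
    rw [Pi.zero_apply, ← mul_zero (ρ z'), ← this, ← integral_const_mul]
    refine integral_congr_ae (ae_of_all _ fun z => ?_)
    have hg : DifferentiableAt ℝ (fun x => k (x - z'.1)) z.1 := by fun_prop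
    have hh : DifferentiableAt ℝ (fun t => θ (t - z'.2)) z.2 := by fun_prop
    simp only [timeDeriv_tensor hg hh, spaceDeriv_tensor _ hg hh, partialD_sub_const,
      deriv_comp_sub_const]
    simp only [Fin.sum_univ_three]
    ring
  -- Now the first point is frozen with weight `-q`. The derivatives in `y` and `s` change sign, so
  -- the term with `deriv θ` is the same as in `e₁`, and subtraction removes it before `θ`
  -- concentrates.
  have e₂ : ∫ w : SpaceTime × SpaceTime,
      (q w.1 * ρ w.2 * (k (w.1.1 - w.2.1) * deriv θ (w.1.2 - w.2.2))
        + ∑ j, q w.1 * J j w.2 * (partialD j k (w.1.1 - w.2.1) * θ (w.1.2 - w.2.2))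
        + -(q w.1 * σ w.2 * (k (w.1.1 - w.2.1) * θ (w.1.2 - w.2.2)))) = 0 := by
    rw [Measure.volume_eq_prod, integral_prod _
      (integrable_add_sum_add (I₃ hq hρ) (fun j => I₂ j hq (hJ j)) hneg)]
    refine integral_eq_zero_of_ae (ae_of_all _ fun z => ?_)
    have := hbal' (fun z' => k (z.1 - z'.1) * θ (z.2 - z'.2)) (by fun_prop)
    rw [Pi.zero_apply, ← mul_zero (-q z), ← this, ← integral_const_mul]
    refine integral_congr_ae (ae_of_all _ fun z' => ?_)
    have hg : DifferentiableAt ℝ (fun y => k (z.1 - y)) z'.1 := by fun_prop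
    have hh : DifferentiableAt ℝ (fun s => θ (z.2 - s)) z'.2 := by fun_prop
    simp only [timeDeriv_tensor hg hh, spaceDeriv_tensor _ hg hh, partialD_const_sub _ hkd,
      deriv_comp_const_sub]
    simp only [Fin.sum_univ_three]
    ring
  rw [integral_add_sum_add (I₃ hq hρ) (fun j => I₂ j (hM j) hρ) (I₁ hh hρ)] at e₁
  rw [integral_add_sum_add (I₃ hq hρ) (fun j => I₂ j hq (hJ j)) hneg] at e₂
  rw [integral_neg] at e₂
  linarith

/-- The two-point identity: two balance laws tested against each other with the kernel
`k (x - y)` at equal times. -/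
theorem two_point_identity {q h ρ σ : SpaceTime → ℝ} {M J : Fin 3 → SpaceTime → ℝ}
    (hq : Integrable q) (hh : Integrable h) (hM : ∀ j, Integrable (M j))
    (hρ : Integrable ρ) (hσ : Integrable σ) (hJ : ∀ j, Integrable (J j))
    (hρm : Measurable ρ) (hσm : Measurable σ) (hJm : ∀ j, Measurable (J j))
    {C : ℝ} (hC : 0 ≤ C) (hρs : ∀ᵐ t : ℝ, ∫⁻ y : Space, ‖ρ (y, t)‖ₑ ≤ ENNReal.ofReal C)
    (hσs : ∀ᵐ t : ℝ, ∫⁻ y : Space, ‖σ (y, t)‖ₑ ≤ ENNReal.ofReal C)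
    (hJs : ∀ j, ∀ᵐ t : ℝ, ∫⁻ y : Space, ‖J j (y, t)‖ₑ ≤ ENNReal.ofReal C)
    (hbal : IsBalance q h M) (hbal' : IsBalance ρ σ J)
    {k : Space → ℝ} (hk : ContDiff ℝ ∞ k) {A : ℝ} (hkb : ∀ x, |k x| ≤ A)
    (hkb' : ∀ j x, |partialD j k x| ≤ A) :
    Integrable (fun p : SpaceTime × Space =>
      (∑ j, (M j p.1 * ρ (p.2, p.1.2) - q p.1 * J j (p.2, p.1.2)) * partialD j k (p.1.1 - p.2)
        + (h p.1 * ρ (p.2, p.1.2) + q p.1 * σ (p.2, p.1.2)) * k (p.1.1 - p.2))) ∧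
    ∫ p : SpaceTime × Space,
      (∑ j, (M j p.1 * ρ (p.2, p.1.2) - q p.1 * J j (p.2, p.1.2)) * partialD j k (p.1.1 - p.2)
        + (h p.1 * ρ (p.2, p.1.2) + q p.1 * σ (p.2, p.1.2)) * k (p.1.1 - p.2)) = 0 := by
  have hkm : Measurable k := hk.continuous.measurable
  have hkm' : ∀ j, Measurable (partialD j k) := fun j =>
    ((hk.continuous_fderiv (by simp)).clm_apply continuous_const).measurable
  -- The ratio of the two radii stays equal to 2, as Lebesgue differentiation along bump functions
  -- requires.
  let φ : ℕ → ContDiffBump (0 : ℝ) := fun n =>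
    ⟨1 / ((n : ℝ) + 1), 2 * (1 / ((n : ℝ) + 1)), by positivity, by
      have : (0 : ℝ) < 1 / ((n : ℝ) + 1) := by positivity
      linarith⟩
  have hφ : Tendsto (fun n => (φ n).rOut) atTop (𝓝 0) := by
    simpa only [mul_zero] using (tendsto_one_div_add_atTop_nhds_zero_nat (𝕜 := ℝ)).const_mul 2
  have hφ' : ∀ n, (φ n).rOut ≤ 2 * (φ n).rIn := fun n => le_rfl
  have hzero := fun n => doubled_identity hq hh hρ hσ hM hJ hbal hbal' hk hkb hkb'
    (φ n).contDiff_normed (φ n).hasCompactSupport_normed (θ := (φ n).normed volume)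
  have L₁ := fun j => tendsto_mollified_pair (hM j) hρm hρ hC hρs (hkm' j) (hkb' j) φ hφ hφ'
  have L₂ := tendsto_mollified_pair hh hρm hρ hC hρs hkm hkb φ hφ hφ'
  have L₃ := fun j => tendsto_mollified_pair hq (hJm j) (hJ j) hC (hJs j) (hkm' j) (hkb' j) φ hφ hφ'
  have L₄ := tendsto_mollified_pair hq hσm hσ hC hσs hkm hkb φ hφ hφ'
  have Ltot := ((tendsto_finsetSum Finset.univ fun j _ => L₁ j).add L₂).add
    (((tendsto_finsetSum Finset.univ fun j _ => L₃ j).neg).add L₄)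
  have hlim := tendsto_nhds_unique (Ltot.congr hzero) tendsto_const_nhds
  have P₁ := fun j => integrable_pair (hM j) hρm hC hρs (hkm' j) (hkb' j)
  have P₂ := integrable_pair hh hρm hC hρs hkm hkb
  have P₃ := fun j => integrable_pair hq (hJm j) hC (hJs j) (hkm' j) (hkb' j)
  have P₄ := integrable_pair hq hσm hC hσs hkm hkb
  have hsum : ∀ p : SpaceTime × Space, h p.1 * ρ (p.2, p.1.2) * k (p.1.1 - p.2)
      + ∑ j, (M j p.1 * ρ (p.2, p.1.2) * partialD j k (p.1.1 - p.2)
        - q p.1 * J j (p.2, p.1.2) * partialD j k (p.1.1 - p.2))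
      + q p.1 * σ (p.2, p.1.2) * k (p.1.1 - p.2)
      = ∑ j, (M j p.1 * ρ (p.2, p.1.2) - q p.1 * J j (p.2, p.1.2)) * partialD j k (p.1.1 - p.2)
        + (h p.1 * ρ (p.2, p.1.2) + q p.1 * σ (p.2, p.1.2)) * k (p.1.1 - p.2) := fun p => by
    simp only [Fin.sum_univ_three]
    ring
  refine ⟨(integrable_add_sum_add P₂ (fun j => (P₁ j).sub (P₃ j)) P₄).congr
    (ae_of_all _ hsum), ?_⟩
  have e := integral_add_sum_add P₂ (fun j => (P₁ j).sub (P₃ j)) P₄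
  simp only [Pi.sub_apply] at e
  simp only [integral_sub (P₁ _) (P₃ _), Finset.sum_sub_distrib] at e
  rw [← hlim, add_comm (∑ j, _) (∫ p, _), add_assoc, ← add_assoc (∑ j, _), ← sub_eq_add_neg,
    ← add_assoc, ← e]
  refine integral_congr_ae (ae_of_all _ fun p => ?_)
  simp only [Fin.sum_univ_three]
  ring

/-! ### Indicators of balls -/

/-- The indicator function of the ball `B(0, r)`. -/
noncomputable def ballInd (r : ℝ) : Space → ℝ := (Metric.ball 0 r).indicator fun _ => 1

lemma measurable_ballInd (r : ℝ) : Measurable (ballInd r) :=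
  measurable_const.indicator Metric.isOpen_ball.measurableSet

lemma ballInd_nonneg (r : ℝ) (x : Space) : 0 ≤ ballInd r x :=
  indicator_nonneg (fun _ _ => zero_le_one) x

lemma ballInd_le_one (r : ℝ) (x : Space) : ballInd r x ≤ 1 :=
  indicator_le_self' (fun _ _ => zero_le_one) x |>.trans le_rfl

lemma ballInd_of_lt {r : ℝ} {x : Space} (h : ‖x‖ < r) : ballInd r x = 1 :=
  indicator_of_mem (by simpa using h) _

lemma ballInd_of_le {r : ℝ} {x : Space} (h : r ≤ ‖x‖) : ballInd r x = 0 :=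
  indicator_of_notMem (by simpa using h) _

lemma ballInd_neg (r : ℝ) (x : Space) : ballInd r (-x) = ballInd r x := by
  rcases lt_or_ge ‖x‖ r with h | h
  · rw [ballInd_of_lt h, ballInd_of_lt (by rwa [norm_neg])]
  · rw [ballInd_of_le h, ballInd_of_le (by rwa [norm_neg])]

/-- The volume of the unit ball of `ℝ³`. -/
noncomputable def unitBallVolume : ℝ := (volume (Metric.ball (0 : Space) 1)).toReal

lemma unitBallVolume_nonneg : 0 ≤ unitBallVolume := ENNReal.toReal_nonneg

lemma lintegral_ballInd (x : Space) {r : ℝ} (hr : 0 ≤ r) :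
    ∫⁻ y : Space, ENNReal.ofReal (ballInd r (x - y)) = ENNReal.ofReal (r ^ 3 * unitBallVolume) := by
  rw [lintegral_sub_left_eq_self (fun y => ENNReal.ofReal (ballInd r y)) x]
  have : ∀ y, ENNReal.ofReal (ballInd r y) = (Metric.ball (0 : Space) r).indicator 1 y := by
    intro y
    rcases lt_or_ge ‖y‖ r with h | h
    · rw [ballInd_of_lt h, indicator_of_mem (by simpa using h)]; simp
    · rw [ballInd_of_le h, indicator_of_notMem (by simpa using h)]; simp
  simp_rw [this]
  rw [lintegral_indicator_one Metric.isOpen_ball.measurableSet, Measure.addHaar_ball _ _ hr]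
  rw [ENNReal.ofReal_mul (by positivity), unitBallVolume, ENNReal.ofReal_toReal
    measure_ball_lt_top.ne]
  simp

/-! ### A priori bounds in the cylinder -/

/-- Bounds for the fields in the cylinder, `p` being the pressure. -/
structure Controlled (Ω : Set Space) (T : ℝ) (ϱ p : SpaceTime → ℝ) (u f : SpaceTime → Space)
    (S : SpaceTime → Matrix (Fin 3) (Fin 3) ℝ) (V E A c : ℝ) : Prop where
  isOpen : IsOpen Ω
  measurable_density : Measurable ϱ
  measurable_pressure : Measurable p
  measurable_velocity : Measurable u
  measurable_force : Measurable f
  measurable_stress : ∀ i j, Measurable fun z => S z i j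
  density_nonneg : ∀ z ∈ cylinder Ω T, 0 ≤ ϱ z
  pressure_nonneg : ∀ z ∈ cylinder Ω T, 0 ≤ p z
  -- The exponent 3/2 in usable form: optimizing in `a` gives `ϱ ≤ C p^{2/3}`, while `a`
  -- proportional to a radius gives the mass of a ball.
  density_le : ∀ z ∈ cylinder Ω T, ∀ a : ℝ, 0 < a → ϱ z ≤ a * p z + (a ^ 2)⁻¹
  V_nonneg : 0 ≤ V
  E_nonneg : 0 ≤ E
  A_nonneg : 0 ≤ A
  c_nonneg : 0 ≤ c
  slice_one : ∀ᵐ t : ℝ, ∫⁻ x : Space,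
    ENNReal.ofReal ((cylinder Ω T).indicator (fun _ => 1) (x, t)) ≤ ENNReal.ofReal V
  slice_kinetic : ∀ᵐ t : ℝ, ∫⁻ x : Space,
    ENNReal.ofReal ((cylinder Ω T).indicator (fun z => ϱ z * ‖u z‖ ^ 2) (x, t)) ≤ ENNReal.ofReal E
  slice_pressure : ∀ᵐ t : ℝ, ∫⁻ x : Space,
    ENNReal.ofReal ((cylinder Ω T).indicator p (x, t)) ≤ ENNReal.ofReal E
  total : ∫⁻ z : SpaceTime, ENNReal.ofReal ((cylinder Ω T).indicator
    (fun z => 1 + ϱ z + ϱ z * ‖u z‖ ^ 2 + p z + ∑ i, ∑ j, S z i j ^ 2) z) ≤ ENNReal.ofReal A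
  force_le : ∀ᵐ z ∂(volume.restrict (cylinder Ω T)), ‖f z‖ ≤ c

lemma measurableSet_cylinder {Ω : Set Space} (hΩ : IsOpen Ω) (T : ℝ) :
    MeasurableSet (cylinder Ω T) := hΩ.measurableSet.prod measurableSet_Ioo

lemma slice_bound {Ω : Set Space} (hΩ : IsOpen Ω) {T : ℝ} {g : SpaceTime → ℝ} {E : ℝ}
    (h0 : ∀ z ∈ cylinder Ω T, 0 ≤ g z) (h : normLinftyL1 Ω T g ≤ ENNReal.ofReal E) :
    ∀ᵐ t : ℝ, ∫⁻ x : Space,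
      ENNReal.ofReal ((cylinder Ω T).indicator g (x, t)) ≤ ENNReal.ofReal E := by
  have h1 := (ae_restrict_iff' measurableSet_Ioo).1
    (ENNReal.ae_le_essSup (μ := volume.restrict (Ioo 0 T)) fun t => ∫⁻ x in Ω, ‖g (x, t)‖ₑ)
  filter_upwards [h1] with t ht
  by_cases hT : t ∈ Ioo 0 T
  · refine le_trans (le_of_eq ?_) ((ht hT).trans h)
    rw [← lintegral_indicator hΩ.measurableSet]
    refine lintegral_congr fun x => ?_
    by_cases hx : x ∈ Ω
    · have hz : (x, t) ∈ cylinder Ω T := ⟨hx, hT⟩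
      rw [indicator_of_mem hz, indicator_of_mem hx, Real.enorm_eq_ofReal (h0 _ hz)]
    · rw [indicator_of_notMem (fun hz : (x, t) ∈ cylinder Ω T => hx hz.1), indicator_of_notMem hx]
      simp
  · have : ∀ x : Space, (cylinder Ω T).indicator g (x, t) = 0 := fun x =>
      indicator_of_notMem (fun hz : (x, t) ∈ cylinder Ω T => hT hz.2) _
    simp [this]

lemma lintegral_cylinder_le {Ω : Set Space} {T : ℝ} {g : SpaceTime → ℝ} {E : ℝ}
    (hT : 0 ≤ T) (hΩ : IsOpen Ω) (hg : Measurable g)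
    (h : ∀ᵐ t : ℝ, ∫⁻ x : Space,
      ENNReal.ofReal ((cylinder Ω T).indicator g (x, t)) ≤ ENNReal.ofReal E) :
    ∫⁻ z : SpaceTime, ENNReal.ofReal ((cylinder Ω T).indicator g z) ≤ ENNReal.ofReal (T * E) := by
  rw [Measure.volume_eq_prod, lintegral_prod_symm' _
    (hg.indicator (measurableSet_cylinder hΩ T)).ennreal_ofReal]
  calc _ ≤ ∫⁻ t : ℝ, (Ioo 0 T).indicator (fun _ => ENNReal.ofReal E) t := by
        refine lintegral_mono_ae ?_
        filter_upwards [h] with t ht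
        by_cases hT : t ∈ Ioo 0 T
        · rwa [indicator_of_mem hT]
        · have : ∀ x : Space, (cylinder Ω T).indicator g (x, t) = 0 := fun x =>
            indicator_of_notMem (fun hz : (x, t) ∈ cylinder Ω T => hT hz.2) _
          simp [this]
    _ = _ := by
        rw [lintegral_indicator measurableSet_Ioo, setLIntegral_const, Real.volume_Ioo, sub_zero,
          mul_comm, ENNReal.ofReal_mul hT]

/-- Either `a √x ≥ 1`, and the first term suffices, or `x ≤ a⁻²`. -/
lemma le_mul_rpow_add {x a : ℝ} (hx : 0 ≤ x) (ha : 0 < a) :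
    x ≤ a * x ^ (3 / 2 : ℝ) + (a ^ 2)⁻¹ := by
  have h1 : x ^ (3 / 2 : ℝ) = x * √x := by
    rw [Real.sqrt_eq_rpow, ← Real.rpow_one_add' hx (by norm_num)]; norm_num
  rw [h1]
  have hs := Real.sqrt_nonneg x
  rcases le_total 1 (a * √x) with h | h
  · have : 0 ≤ (a ^ 2)⁻¹ := by positivity
    nlinarith [mul_le_mul_of_nonneg_left h hx]
  · have h2 : a ^ 2 * x ≤ 1 := by
      have : (a * √x) ^ 2 ≤ 1 := pow_le_one₀ (by positivity) h
      rwa [mul_pow, Real.sq_sqrt hx] at this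
    have h3 : x ≤ (a ^ 2)⁻¹ := by
      rw [← one_div, le_div_iff₀ (by positivity)]
      linarith
    have : 0 ≤ a * (x * √x) := by positivity
    linarith

lemma one_le_pressureFactor {ε m : ℝ} (hε : 0 < ε) {ϱ : SpaceTime → ℝ} {z : SpaceTime}
    (hz : 0 ≤ ϱ z) : 1 ≤ pressureFactor ε m ϱ z := by
  have := Real.rpow_nonneg hz m
  unfold pressureFactor
  nlinarith [mul_nonneg hε.le this]

lemma measurable_pressureFactor {ε m : ℝ} {ϱ : SpaceTime → ℝ} (h : Measurable ϱ) :
    Measurable (pressureFactor ε m ϱ) := by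
  unfold pressureFactor; fun_prop

lemma measurable_pressure {ε m : ℝ} {ϱ : SpaceTime → ℝ} (h : Measurable ϱ) :
    Measurable (pressure ε m ϱ) := by
  unfold pressure
  have := measurable_pressureFactor (ε := ε) (m := m) h
  fun_prop

/-- In the total bound, the slice bounds for `1`, `ϱ ≤ 1 + p` (the case `a = 1`), `ϱ|u|²` and `p`
are integrated over `(0, T)`; `cS ^ 2` is the contribution of the stress. -/
theorem controlled_of_energyEstimate {Ω : Set Space} (hΩ : IsOpen Ω)
    (hΩb : Bornology.IsBounded Ω) {T : ℝ} (hT : 0 < T) {E cS cf : ℝ≥0} {ε m : ℝ} (hε : 0 < ε)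
    {ϱ : SpaceTime → ℝ} {u f : SpaceTime → Space} {S D : SpaceTime → Matrix (Fin 3) (Fin 3) ℝ}
    (hw : IsWeakSolution Ω T ε m ϱ u f S) (he : EnergyEstimate Ω T ε m ϱ u D E)
    (hS : normL2 (cylinder Ω T) S ≤ cS)
    (hf : ∀ᵐ z ∂(volume.restrict (cylinder Ω T)), ‖f z‖ ≤ cf) :
    Controlled Ω T ϱ (pressure ε m ϱ) u f S (volume Ω).toReal E
      (T * ((volume Ω).toReal + ((volume Ω).toReal + E) + E + E) + cS ^ 2) cf := by
  set V := (volume Ω).toReal with hV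
  have hV0 : 0 ≤ V := ENNReal.toReal_nonneg
  have hE0 : (0 : ℝ) ≤ E := E.2
  have hu := hw.measurable_velocity
  have hϱ := hw.measurable_density
  have hp := measurable_pressure (ε := ε) (m := m) hϱ
  have hQ := measurableSet_cylinder hΩ T
  have hp1 : ∀ z ∈ cylinder Ω T, ϱ z ^ (3 / 2 : ℝ) ≤ pressure ε m ϱ z := fun z hz => by
    have := Real.rpow_nonneg (hw.density_nonneg z hz) (3 / 2)
    exact le_mul_of_one_le_right this (one_le_pressureFactor hε (hw.density_nonneg z hz))
  have hp0 : ∀ z ∈ cylinder Ω T, 0 ≤ pressure ε m ϱ z := fun z hz =>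
    (Real.rpow_nonneg (hw.density_nonneg z hz) _).trans (hp1 z hz)
  have hEr : (E : ℝ≥0∞) = ENNReal.ofReal E := by simp
  have hk0 : ∀ z ∈ cylinder Ω T, 0 ≤ ϱ z * ‖u z‖ ^ 2 := fun z hz =>
    mul_nonneg (hw.density_nonneg z hz) (by positivity)
  have hd : ∀ z ∈ cylinder Ω T, ∀ a : ℝ, 0 < a → ϱ z ≤ a * pressure ε m ϱ z + (a ^ 2)⁻¹ :=
    fun z hz a ha => (le_mul_rpow_add (hw.density_nonneg z hz) ha).trans (by
      gcongr
      exact hp1 z hz)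
  have s1 : ∀ᵐ t : ℝ, ∫⁻ x : Space,
      ENNReal.ofReal ((cylinder Ω T).indicator (fun _ => 1) (x, t)) ≤ ENNReal.ofReal V := by
    refine slice_bound hΩ (fun z hz => zero_le_one) ?_
    refine essSup_le_of_ae_le _ (ae_of_all _ fun t => ?_)
    simp [hV, ENNReal.ofReal_toReal hΩb.measure_lt_top.ne]
  have s2 : ∀ᵐ t : ℝ, ∫⁻ x : Space, ENNReal.ofReal
      ((cylinder Ω T).indicator (fun z => ϱ z * ‖u z‖ ^ 2) (x, t)) ≤ ENNReal.ofReal E :=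
    slice_bound hΩ hk0 (hEr ▸ (le_add_self.trans le_self_add).trans he.2)
  have s3 : ∀ᵐ t : ℝ, ∫⁻ x : Space, ENNReal.ofReal
      ((cylinder Ω T).indicator (pressure ε m ϱ) (x, t)) ≤ ENNReal.ofReal E :=
    slice_bound hΩ hp0 (hEr ▸ (le_self_add.trans le_self_add).trans he.2)
  have s4 : ∀ᵐ t : ℝ, ∫⁻ x : Space,
      ENNReal.ofReal ((cylinder Ω T).indicator ϱ (x, t)) ≤ ENNReal.ofReal (V + E) := by
    filter_upwards [s1, s3] with t h1 h3
    rw [ENNReal.ofReal_add hV0 hE0]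
    refine le_trans ?_ (add_le_add h1 h3)
    have hm : Measurable fun x : Space =>
        ENNReal.ofReal ((cylinder Ω T).indicator (fun _ => (1 : ℝ)) (x, t)) :=
      ((measurable_const.indicator hQ).ennreal_ofReal).comp
        (measurable_id.prodMk measurable_const)
    rw [← lintegral_add_left hm]
    refine lintegral_mono fun x => ?_
    by_cases hz : (x, t) ∈ cylinder Ω T
    · simp only [indicator_of_mem hz]
      rw [← ENNReal.ofReal_add zero_le_one (hp0 _ hz)]
      have := hd _ hz 1 one_pos
      exact ENNReal.ofReal_le_ofReal (by linarith)
    · simp [indicator_of_notMem hz]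
  have hS2 : ∫⁻ z : SpaceTime, ENNReal.ofReal ((cylinder Ω T).indicator
      (fun z => ∑ i, ∑ j, S z i j ^ 2) z) ≤ ENNReal.ofReal (cS ^ 2) := by
    have h1 : ∀ z, ENNReal.ofReal ((cylinder Ω T).indicator (fun z => ∑ i, ∑ j, S z i j ^ 2) z)
        = (cylinder Ω T).indicator (fun z => ENNReal.ofReal (∑ i, ∑ j, S z i j ^ 2)) z := by
      intro z
      by_cases hz : z ∈ cylinder Ω T
      · simp [indicator_of_mem hz]
      · simp [indicator_of_notMem hz]
    simp_rw [h1]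
    rw [lintegral_indicator hQ]
    have h2 := ENNReal.rpow_le_rpow hS (z := 2) (by norm_num)
    rw [normL2, ← ENNReal.rpow_mul] at h2
    norm_num at h2
    refine h2.trans (le_of_eq ?_)
    rw [ENNReal.ofReal_pow cS.coe_nonneg]
    simp
  refine
  { isOpen := hΩ, measurable_density := hϱ, measurable_pressure := hp
    measurable_velocity := hu, measurable_force := hw.measurable_force
    measurable_stress := hw.measurable_stress, density_nonneg := hw.density_nonneg
    pressure_nonneg := hp0, density_le := hd, V_nonneg := hV0, E_nonneg := hE0
    A_nonneg := by positivity
    c_nonneg := cf.2, slice_one := s1, slice_kinetic := s2, slice_pressure := s3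
    total := ?_, force_le := hf }
  have hSm := hw.measurable_stress
  have i1 := lintegral_cylinder_le hT.le hΩ measurable_const s1
  have i2 := lintegral_cylinder_le hT.le hΩ (by fun_prop) s2
  have i3 := lintegral_cylinder_le hT.le hΩ hp s3
  have i4 := lintegral_cylinder_le hT.le hΩ hϱ s4
  have key : ENNReal.ofReal (T * (V + (V + E) + E + E) + cS ^ 2)
      = ENNReal.ofReal (T * V) + ENNReal.ofReal (T * (V + E)) + ENNReal.ofReal (T * E)
        + ENNReal.ofReal (T * E) + ENNReal.ofReal (cS ^ 2) := by
    rw [← ENNReal.ofReal_add, ← ENNReal.ofReal_add, ← ENNReal.ofReal_add, ← ENNReal.ofReal_add]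
    · congr 1; ring
    all_goals positivity
  rw [key]
  refine le_trans (le_of_eq ?_) (add_le_add (add_le_add (add_le_add (add_le_add i1 i4) i2) i3) hS2)
  have m1 : Measurable fun z => ENNReal.ofReal ((cylinder Ω T).indicator (fun _ => (1 : ℝ)) z) :=
    (measurable_const.indicator hQ).ennreal_ofReal
  have m2 := (hϱ.indicator hQ).ennreal_ofReal
  have m3 := (Measurable.indicator (f := fun z => ϱ z * ‖u z‖ ^ 2) (by fun_prop) hQ).ennreal_ofReal
  have m4 := (hp.indicator hQ).ennreal_ofReal
  rw [← lintegral_add_left m1, ← lintegral_add_left (by fun_prop), ← lintegral_add_left (by fun_prop),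
    ← lintegral_add_left (by fun_prop)]
  refine lintegral_congr fun z => ?_
  by_cases hz : z ∈ cylinder Ω T
  · have a1 := hw.density_nonneg z hz
    have a2 := hk0 z hz
    have a3 := hp0 z hz
    have a4 : 0 ≤ ∑ i, ∑ j, S z i j ^ 2 := by positivity
    simp only [indicator_of_mem hz]
    rw [ENNReal.ofReal_add, ENNReal.ofReal_add, ENNReal.ofReal_add, ENNReal.ofReal_add]
    all_goals positivity
  · simp [indicator_of_notMem hz]

/-! ### Localization of the equations -/

/-- The momentum flux `ϱ u ⊗ u + p I - S`. -/
noncomputable def rawFlux (ϱ p : SpaceTime → ℝ) (u : SpaceTime → Space)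
    (S : SpaceTime → Matrix (Fin 3) (Fin 3) ℝ) (i j : Fin 3) (z : SpaceTime) : ℝ :=
  ϱ z * u z i * u z j + (if i = j then p z else 0) - S z i j

/-- An integrable majorant of the momentum, its flux and the force. -/
noncomputable def majorant (Ω : Set Space) (T : ℝ) (ϱ p : SpaceTime → ℝ) (u : SpaceTime → Space)
    (S : SpaceTime → Matrix (Fin 3) (Fin 3) ℝ) : SpaceTime → ℝ :=
  (cylinder Ω T).indicator
    fun z => 1 + ϱ z + ϱ z * ‖u z‖ ^ 2 + p z + ∑ i, ∑ j, S z i j ^ 2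

/-- The localized momentum `l⁶ ϱ u`. -/
noncomputable def locMomentum (l ϱ : SpaceTime → ℝ) (u : SpaceTime → Space) (i : Fin 3)
    (z : SpaceTime) : ℝ := l z ^ 6 * (ϱ z * u z i)

/-- The localized momentum flux. -/
noncomputable def locFlux (l ϱ p : SpaceTime → ℝ) (u : SpaceTime → Space)
    (S : SpaceTime → Matrix (Fin 3) (Fin 3) ℝ) (i j : Fin 3) (z : SpaceTime) : ℝ :=
  l z ^ 6 * rawFlux ϱ p u S i j z

/-- The source in the localized momentum equation. -/
noncomputable def locForce (l ϱ p : SpaceTime → ℝ) (u f : SpaceTime → Space)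
    (S : SpaceTime → Matrix (Fin 3) (Fin 3) ℝ) (i : Fin 3) (z : SpaceTime) : ℝ :=
  6 * l z ^ 5 * timeDeriv l z * (ϱ z * u z i)
    + ∑ j, 6 * l z ^ 5 * spaceDeriv j l z * rawFlux ϱ p u S i j z + l z ^ 6 * (ϱ z * f z i)

/-- The localized mass flux `l⁴ ϱ u`. -/
noncomputable def locCurrent (l ϱ : SpaceTime → ℝ) (u : SpaceTime → Space) (j : Fin 3)
    (z : SpaceTime) : ℝ := l z ^ 4 * (ϱ z * u z j)

/-- The source in the localized mass equation. -/
noncomputable def locSource (l ϱ : SpaceTime → ℝ) (u : SpaceTime → Space) (z : SpaceTime) : ℝ :=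
  4 * l z ^ 3 * (timeDeriv l z * ϱ z + ∑ j, spaceDeriv j l z * (ϱ z * u z j))

/-- Bounds for the cut-off function. -/
structure CutoffBounds (Ω : Set Space) (T : ℝ) (l : SpaceTime → ℝ) (L : ℝ) : Prop where
  contDiff : ContDiff ℝ ∞ l
  nonneg : ∀ z, 0 ≤ l z
  one_le : 1 ≤ L
  le : ∀ z, l z ≤ L
  timeDeriv_le : ∀ z, |timeDeriv l z| ≤ L
  spaceDeriv_le : ∀ j z, |spaceDeriv j l z| ≤ L
  lipschitz : ∀ x y t, |l (x, t) - l (y, t)| ≤ L * ‖x - y‖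
  eq_zero : ∀ z ∉ cylinder Ω T, l z = 0

lemma norm_single_zero (j : Fin 3) : ‖((EuclideanSpace.single j 1, 0) : SpaceTime)‖ = 1 := by
  simp [Prod.norm_def]

lemma norm_zero_one : ‖((0, 1) : SpaceTime)‖ = 1 := by
  simp [Prod.norm_def]

lemma IsTest.eq_zero {X Y : Type*} [NormedAddCommGroup X] [NormedSpace ℝ X]
    [NormedAddCommGroup Y] [NormedSpace ℝ Y] {U : Set X} {ξ : X → Y} (h : IsTest U ξ) {x : X}
    (hx : x ∉ U) : ξ x = 0 := image_eq_zero_of_notMem_tsupport fun h' => hx (h.2.2 h')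

lemma exists_cutoffBounds {Ω : Set Space} {T : ℝ} {l : SpaceTime → ℝ}
    (hl : IsTest (cylinder Ω T) l) (hl0 : ∀ z, 0 ≤ l z) : ∃ L, CutoffBounds Ω T l L := by
  obtain ⟨C, hC⟩ := hl.2.1.exists_bound_of_continuous hl.1.continuous
  obtain ⟨K, hK⟩ := hl.1.lipschitzWith_of_hasCompactSupport hl.2.1 (by simp)
  have hd : ∀ z v, ‖v‖ = 1 → |fderiv ℝ l z v| ≤ K := fun z v hv => by
    have := (fderiv ℝ l z).le_opNorm v
    rw [hv, mul_one] at this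
    exact this.trans (norm_fderiv_le_of_lipschitz ℝ hK)
  have h1 : (K : ℝ) ≤ max 1 (max C K) := le_max_of_le_right (le_max_right _ _)
  refine ⟨max 1 (max C K), hl.1, hl0, le_max_left _ _, fun z => ?_, fun z => ?_, fun j z => ?_,
    fun x y t => ?_, fun z hz => hl.eq_zero hz⟩
  · exact ((le_abs_self _).trans (hC z)).trans (le_max_of_le_right (le_max_left _ _))
  · exact (hd z _ norm_zero_one).trans h1
  · exact (hd z _ (norm_single_zero j)).trans h1
  · have := hK.dist_le_mul (x, t) (y, t)
    rw [Real.dist_eq, Prod.dist_eq, dist_self, max_eq_left dist_nonneg, dist_eq_norm] at this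
    exact this.trans (by gcongr)

/-- The exponent is `n + 1` so that at least one factor `l` carries the support; `φ` itself need not
have compact support. -/
lemma IsTest.pow_mul {Ω : Set Space} {T : ℝ} {l φ : SpaceTime → ℝ} (hl : IsTest (cylinder Ω T) l)
    (hφ : ContDiff ℝ ∞ φ) (n : ℕ) : IsTest (cylinder Ω T) (fun z => l z ^ (n + 1) * φ z) := by
  have e : (fun z => l z ^ (n + 1) * φ z) = l * fun z => l z ^ n * φ z := by
    ext z; simp only [Pi.mul_apply]; ring
  refine ⟨(hl.1.pow _).mul hφ, ?_, ?_⟩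
  · rw [e]; exact hl.2.1.mul_right
  · rw [e]; exact (tsupport_mul_subset_left).trans hl.2.2

lemma fderiv_pow_mul {l φ : SpaceTime → ℝ} (hl : ContDiff ℝ ∞ l) (hφ : ContDiff ℝ ∞ φ) (n : ℕ)
    (z v : SpaceTime) : fderiv ℝ (fun z => l z ^ (n + 1) * φ z) z v
      = l z ^ (n + 1) * fderiv ℝ φ z v + ((n + 1 : ℕ) * l z ^ n * fderiv ℝ l z v) * φ z := by
  have h1 := (hl.differentiable (by simp) z).hasFDerivAt.pow (n + 1)
  have h2 := (hφ.differentiable (by simp) z).hasFDerivAt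
  have h3 : HasFDerivAt (fun z => l z ^ (n + 1) * φ z) _ z := h1.mul h2
  rw [h3.fderiv]
  simp
  ring

/-- The test function is `l⁴ φ`; the derivatives that fall on `l⁴` make up the source. -/
lemma mass_balance {Ω : Set Space} {T ε m : ℝ} {l ϱ : SpaceTime → ℝ}
    {u f : SpaceTime → Space} {S : SpaceTime → Matrix (Fin 3) (Fin 3) ℝ}
    (hl : IsTest (cylinder Ω T) l) (hw : IsWeakSolution Ω T ε m ϱ u f S) :
    IsBalance (locDensity l ϱ) (locSource l ϱ u) (locCurrent l ϱ u) := by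
  intro φ hφ
  have h := hw.mass _ (hl.pow_mul hφ 3)
  rw [← h, ← setIntegral_eq_integral_of_forall_compl_eq_zero (s := cylinder Ω T)]
  · refine integral_congr_ae (ae_of_all _ fun z => ?_)
    simp only [timeDeriv, spaceDeriv, fderiv_pow_mul hl.1 hφ, locDensity, locSource, locCurrent,
      Fin.sum_univ_three]
    push_cast
    ring
  · intro z hz
    simp [locDensity, locSource, locCurrent, hl.eq_zero hz]

section bounds

variable {Ω : Set Space} {T : ℝ} {ϱ p : SpaceTime → ℝ} {u f : SpaceTime → Space}
  {S : SpaceTime → Matrix (Fin 3) (Fin 3) ℝ} {V E A c : ℝ}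

lemma sq_le_sum_sq (M : Matrix (Fin 3) (Fin 3) ℝ) (i j : Fin 3) :
    M i j ^ 2 ≤ ∑ i, ∑ j, M i j ^ 2 :=
  (Finset.single_le_sum (f := fun j => M i j ^ 2) (fun _ _ => sq_nonneg _)
    (Finset.mem_univ j)).trans
    (Finset.single_le_sum (f := fun i => ∑ j, M i j ^ 2)
      (fun _ _ => Finset.sum_nonneg fun _ _ => sq_nonneg _) (Finset.mem_univ i))

lemma abs_coord_le (a : Space) (i : Fin 3) : |a i| ≤ ‖a‖ := by
  simpa using PiLp.norm_apply_le a i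

lemma Controlled.majorant_of_mem {z : SpaceTime} (hz : z ∈ cylinder Ω T) :
    majorant Ω T ϱ p u S z = 1 + ϱ z + ϱ z * ‖u z‖ ^ 2 + p z + ∑ i, ∑ j, S z i j ^ 2 :=
  indicator_of_mem hz _

lemma Controlled.majorant_nonneg (h : Controlled Ω T ϱ p u f S V E A c) (z : SpaceTime) :
    0 ≤ majorant Ω T ϱ p u S z := by
  refine indicator_nonneg (fun z hz => ?_) z
  have := h.density_nonneg z hz
  have := h.pressure_nonneg z hz
  positivity

lemma Controlled.measurable_majorant (h : Controlled Ω T ϱ p u f S V E A c) :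
    Measurable (majorant Ω T ϱ p u S) := by
  have h1 := h.measurable_density
  have h2 := h.measurable_pressure
  have h3 := h.measurable_velocity
  have h4 := h.measurable_stress
  exact Measurable.indicator (by fun_prop) (measurableSet_cylinder h.isOpen T)

lemma Controlled.integrable_majorant (h : Controlled Ω T ϱ p u f S V E A c) :
    Integrable (majorant Ω T ϱ p u S) := by
  refine ⟨h.measurable_majorant.aestronglyMeasurable, ?_⟩
  rw [hasFiniteIntegral_iff_ofReal (ae_of_all _ h.majorant_nonneg)]
  exact h.total.trans_lt ENNReal.ofReal_lt_top

lemma Controlled.integral_majorant_le (h : Controlled Ω T ϱ p u f S V E A c) :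
    ∫ z, majorant Ω T ϱ p u S z ≤ A := by
  have := h.total
  rwa [← majorant, ← ofReal_integral_eq_lintegral_ofReal h.integrable_majorant
    (ae_of_all _ h.majorant_nonneg), ENNReal.ofReal_le_ofReal_iff h.A_nonneg] at this

lemma mul_norm_le_add {r s : ℝ} (hr : 0 ≤ r) : r * s ≤ r + r * s ^ 2 := by
  nlinarith [mul_nonneg hr (sq_nonneg (s - 1)), mul_nonneg hr (sq_nonneg s)]

lemma Controlled.abs_density_mul_le (h : Controlled Ω T ϱ p u f S V E A c) {z : SpaceTime}
    (hz : z ∈ cylinder Ω T) (i : Fin 3) : |ϱ z * u z i| ≤ ϱ z + ϱ z * ‖u z‖ ^ 2 := by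
  have h0 := h.density_nonneg z hz
  rw [abs_mul, abs_of_nonneg h0]
  exact (mul_le_mul_of_nonneg_left (abs_coord_le _ i) h0).trans (mul_norm_le_add h0)

lemma Controlled.density_le_majorant (h : Controlled Ω T ϱ p u f S V E A c) {z : SpaceTime}
    (hz : z ∈ cylinder Ω T) : ϱ z + ϱ z * ‖u z‖ ^ 2 + p z ≤ majorant Ω T ϱ p u S z := by
  rw [majorant_of_mem hz]
  have : 0 ≤ ∑ i, ∑ j, S z i j ^ 2 := by positivity
  linarith

lemma Controlled.abs_momentum_le (h : Controlled Ω T ϱ p u f S V E A c) {z : SpaceTime}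
    (hz : z ∈ cylinder Ω T) (i : Fin 3) : |ϱ z * u z i| ≤ majorant Ω T ϱ p u S z := by
  have := h.abs_density_mul_le hz i
  have := h.density_le_majorant hz
  have := h.pressure_nonneg z hz
  linarith

lemma Controlled.abs_rawFlux_le (h : Controlled Ω T ϱ p u f S V E A c) {z : SpaceTime}
    (hz : z ∈ cylinder Ω T) (i j : Fin 3) :
    |rawFlux ϱ p u S i j z| ≤ majorant Ω T ϱ p u S z := by
  rw [majorant_of_mem hz]
  have h0 := h.density_nonneg z hz
  have h1 := h.pressure_nonneg z hz
  have h2 := sq_le_sum_sq (S z) i j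
  have h4 : |S z i j| ≤ 1 + S z i j ^ 2 := by
    rw [← sq_abs]; nlinarith [sq_nonneg (|S z i j| - 1), abs_nonneg (S z i j)]
  have h5 : |ϱ z * u z i * u z j| ≤ ϱ z * ‖u z‖ ^ 2 := by
    rw [mul_assoc, abs_mul, abs_of_nonneg h0, abs_mul, sq]
    gcongr <;> exact abs_coord_le _ _
  have h6 : |if i = j then p z else 0| ≤ p z := by
    split_ifs
    · rw [abs_of_nonneg h1]
    · simpa using h1
  have h7 := abs_sub (ϱ z * u z i * u z j + (if i = j then p z else 0)) (S z i j)
  have h8 := abs_add_le (ϱ z * u z i * u z j) (if i = j then p z else 0)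
  rw [rawFlux]
  linarith

lemma Controlled.abs_force_le (h : Controlled Ω T ϱ p u f S V E A c) {z : SpaceTime}
    (hz : z ∈ cylinder Ω T) (hf : ‖f z‖ ≤ c) (i : Fin 3) :
    |ϱ z * f z i| ≤ c * majorant Ω T ϱ p u S z := by
  have h0 := h.density_nonneg z hz
  have h1 := h.density_le_majorant hz
  have h2 := h.pressure_nonneg z hz
  have h3 : 0 ≤ ϱ z * ‖u z‖ ^ 2 := by positivity
  rw [abs_mul, abs_of_nonneg h0, mul_comm]
  have := h.c_nonneg
  gcongr
  · exact (abs_coord_le _ _).trans hf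
  · linarith

lemma Controlled.measurable_rawFlux (h : Controlled Ω T ϱ p u f S V E A c) (i j : Fin 3) :
    Measurable (rawFlux ϱ p u S i j) := by
  have h1 := h.measurable_density
  have h2 := h.measurable_pressure
  have h3 := h.measurable_velocity
  have h4 := h.measurable_stress
  unfold rawFlux
  split_ifs <;> fun_prop

lemma Controlled.integrableOn_of_le (h : Controlled Ω T ϱ p u f S V E A c) {g : SpaceTime → ℝ}
    (hg : Measurable g) {K : ℝ}
    (hgK : ∀ᵐ z ∂(volume.restrict (cylinder Ω T)), |g z| ≤ K * majorant Ω T ϱ p u S z) :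
    IntegrableOn g (cylinder Ω T) :=
  (h.integrable_majorant.const_mul K).integrableOn.mono' hg.aestronglyMeasurable hgK

/-- The test field is `l⁶ φ e_i`. The power 6 is 4 · 3/2: it makes the localized pressure `l⁶ p`
equal to `ρ^{3/2} P` with `ρ = l⁴ ϱ`. -/
lemma momentum_balance {ε m : ℝ} {l : SpaceTime → ℝ}
    (h : Controlled Ω T ϱ (pressure ε m ϱ) u f S V E A c)
    (hl : IsTest (cylinder Ω T) l) (hw : IsWeakSolution Ω T ε m ϱ u f S) (i : Fin 3) :
    IsBalance (locMomentum l ϱ u i) (locForce l ϱ (pressure ε m ϱ) u f S i)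
      (locFlux l ϱ (pressure ε m ϱ) u S i) := by
  intro φ hφ
  have hη := hl.pow_mul hφ 5
  set η : SpaceTime → ℝ := fun z => l z ^ (5 + 1) * φ z with hηdef
  have hηd := hη.1.differentiable (by simp)
  set ξ : SpaceTime → Space := fun z => η z • EuclideanSpace.single i (1 : ℝ) with hξdef
  have hξ : IsTest (cylinder Ω T) ξ := by
    refine ⟨hη.1.smul contDiff_const, hη.2.1.smul_right, ?_⟩
    exact (tsupport_smul_subset_left η _).trans hη.2.2
  have hd : ∀ z v, fderiv ℝ ξ z v = fderiv ℝ η z v • EuclideanSpace.single i (1 : ℝ) := by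
    intro z v
    rw [hξdef, ((hηd z).hasFDerivAt.smul_const (EuclideanSpace.single i (1 : ℝ))).fderiv]
    simp
  have hQ := measurableSet_cylinder h.isOpen T
  have h1 := h.measurable_density
  have h3 := h.measurable_velocity
  have h5 := h.measurable_force
  obtain ⟨N, hN⟩ := hη.2.1.exists_bound_of_continuous hη.1.continuous
  obtain ⟨K, hK⟩ := hη.1.lipschitzWith_of_hasCompactSupport hη.2.1 (by simp)
  have hb : ∀ z v, ‖v‖ = 1 → ‖fderiv ℝ η z v‖ ≤ K := fun z v hv => by
    have := (fderiv ℝ η z).le_opNorm v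
    rw [hv, mul_one] at this
    exact this.trans (norm_fderiv_le_of_lipschitz ℝ hK)
  have hcont : ∀ v, Continuous fun z => fderiv ℝ η z v := fun v =>
    (hη.1.continuous_fderiv (by simp)).clm_apply continuous_const
  -- The weak formulation has three separate integrals, the balance law a single one; merging them
  -- needs the integrability of each term.
  have I1 : IntegrableOn (fun z => ϱ z * u z i * timeDeriv η z) (cylinder Ω T) := by
    refine Integrable.mul_bdd (c := K) (h.integrableOn_of_le (K := 1) (by fun_prop) ?_)
      (hcont _).aestronglyMeasurable (ae_of_all _ fun z => hb z _ norm_zero_one)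
    filter_upwards [ae_restrict_mem hQ] with z hz
    rw [one_mul]; exact h.abs_momentum_le hz i
  have I2 : ∀ j, IntegrableOn (fun z => rawFlux ϱ (pressure ε m ϱ) u S i j z * spaceDeriv j η z)
      (cylinder Ω T) := fun j => by
    refine Integrable.mul_bdd (c := K) (h.integrableOn_of_le (K := 1) (h.measurable_rawFlux i j) ?_)
      (hcont _).aestronglyMeasurable (ae_of_all _ fun z => hb z _ (norm_single_zero j))
    filter_upwards [ae_restrict_mem hQ] with z hz
    rw [one_mul]; exact h.abs_rawFlux_le hz i j
  have I3 : IntegrableOn (fun z => ϱ z * f z i * η z) (cylinder Ω T) := by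
    refine Integrable.mul_bdd (c := N) (h.integrableOn_of_le (K := c) (by fun_prop) ?_)
      hη.1.continuous.aestronglyMeasurable (ae_of_all _ hN)
    filter_upwards [ae_restrict_mem hQ, h.force_le] with z hz hf
    exact h.abs_force_le hz hf i
  have hm := hw.momentum ξ hξ
  have e1 : ∀ z, ϱ z * inner ℝ (u z) (timeDeriv ξ z) = ϱ z * u z i * timeDeriv η z := by
    intro z
    rw [timeDeriv, hd, inner_smul_right, EuclideanSpace.inner_single_right]
    simp [timeDeriv]; ring
  have e2 : ∀ z, ∑ i', ∑ j, (ϱ z * u z i' * u z j + (if i' = j then pressure ε m ϱ z else 0)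
      - S z i' j) * spaceDeriv j ξ z i'
      = ∑ j, rawFlux ϱ (pressure ε m ϱ) u S i j z * spaceDeriv j η z := by
    intro z
    rw [Finset.sum_eq_single i]
    · refine Finset.sum_congr rfl fun j _ => ?_
      rw [spaceDeriv, hd, rawFlux]
      simp [spaceDeriv]
    · intro b _ hb
      refine Finset.sum_eq_zero fun j _ => ?_
      rw [spaceDeriv, hd]
      simp [hb]
    · simp
  have e3 : ∀ z, ϱ z * inner ℝ (f z) (ξ z) = ϱ z * f z i * η z := by
    intro z
    rw [hξdef, inner_smul_right, EuclideanSpace.inner_single_right]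
    simp; ring
  simp_rw [e1, e2, e3] at hm
  rw [integral_finsetSum _ fun j _ => I2 j, ← integral_add_sum_add I1 I2 I3] at hm
  rw [← hm, ← setIntegral_eq_integral_of_forall_compl_eq_zero (s := cylinder Ω T)]
  · refine integral_congr_ae (ae_of_all _ fun z => ?_)
    simp only [timeDeriv, spaceDeriv, hηdef, fderiv_pow_mul hl.1 hφ, locMomentum, locForce,
      locFlux, Fin.sum_univ_three]
    push_cast
    ring
  · intro z hz
    simp [locMomentum, locForce, locFlux, hl.eq_zero hz]

end bounds

/-! ### The radial kernel and its gradient -/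

lemma norm_projPar_sq (z w : Space) : ‖projPar z w‖ ^ 2 = inner ℝ z w ^ 2 / ‖z‖ ^ 2 := by
  rw [projPar, norm_smul, mul_pow, Real.norm_eq_abs, sq_abs]
  rcases eq_or_ne z 0 with rfl | hz
  · simp
  · have : ‖z‖ ≠ 0 := norm_ne_zero_iff.2 hz
    field_simp

lemma norm_projPerp_sq (z w : Space) : ‖projPerp z w‖ ^ 2 = ‖w‖ ^ 2 - ‖projPar z w‖ ^ 2 := by
  rw [projPerp, norm_sub_sq_real, norm_projPar_sq, projPar, inner_smul_right, real_inner_comm]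
  rcases eq_or_ne z 0 with rfl | hz
  · simp
  · have : ‖z‖ ≠ 0 := norm_ne_zero_iff.2 hz
    field_simp
    ring

lemma norm_projPar_sq_le (z w : Space) : ‖projPar z w‖ ^ 2 ≤ ‖w‖ ^ 2 := by
  have := norm_projPerp_sq z w
  have := sq_nonneg ‖projPerp z w‖
  linarith

lemma norm_projPerp_sq_le (z w : Space) : ‖projPerp z w‖ ^ 2 ≤ ‖w‖ ^ 2 := by
  have := norm_projPerp_sq z w
  have := sq_nonneg ‖projPar z w‖
  linarith

lemma inner_eq_sum (z w : Space) : inner ℝ z w = ∑ i, z i * w i := by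
  simp [PiLp.inner_apply, mul_comm]

/-- A smooth cut-off weight on `(0, r)`. -/
structure IsWeight (χ : ℝ → ℝ) (δ r : ℝ) : Prop where
  contDiff : ContDiff ℝ ∞ χ
  nonneg : ∀ s, 0 ≤ χ s
  le_one : ∀ s, χ s ≤ 1
  pos : 0 < δ
  lt : δ < r
  eq_zero_left : ∀ s, s ≤ δ → χ s = 0
  eq_zero_right : ∀ s, r ≤ s → χ s = 0

/-- The radial profile `s ↦ ∫_s^r χ(σ) σ⁻² dσ`. -/
noncomputable def profile (χ : ℝ → ℝ) (r s : ℝ) : ℝ := ∫ σ in s..r, χ σ / σ ^ 2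

/-- The components of the kernel `z ↦ (∫_{|z|}^r χ(σ) σ⁻² dσ) z`. -/
noncomputable def kernel (χ : ℝ → ℝ) (r : ℝ) (i : Fin 3) (z : Space) : ℝ :=
  profile χ r ‖z‖ * z i

namespace IsWeight

variable {χ : ℝ → ℝ} {δ r : ℝ}

/-- The weight vanishes on `(-∞, δ]`, which hides the pole at 0. -/
lemma contDiff_div (h : IsWeight χ δ r) : ContDiff ℝ ∞ fun σ => χ σ / σ ^ 2 := by
  rw [contDiff_iff_contDiffAt]
  intro s
  rcases lt_or_ge s δ with hs | hs
  · refine (contDiffAt_const (c := (0 : ℝ))).congr_of_eventuallyEq ?_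
    filter_upwards [eventually_lt_nhds hs] with σ hσ
    rw [h.eq_zero_left σ hσ.le, zero_div]
  · exact h.contDiff.contDiffAt.div (contDiffAt_id.pow 2) (by
      have := h.pos.trans_le hs
      positivity)

lemma hasDerivAt_profile (h : IsWeight χ δ r) (s : ℝ) :
    HasDerivAt (profile χ r) (-(χ s / s ^ 2)) s := by
  have hc := h.contDiff_div.continuous
  exact intervalIntegral.integral_hasDerivAt_left (hc.intervalIntegrable _ _)
    (hc.stronglyMeasurableAtFilter _ _) hc.continuousAt

lemma contDiff_profile (h : IsWeight χ δ r) : ContDiff ℝ ∞ (profile χ r) := by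
  rw [contDiff_infty_iff_deriv]
  refine ⟨fun s => (h.hasDerivAt_profile s).differentiableAt, ?_⟩
  have : deriv (profile χ r) = fun s => -(χ s / s ^ 2) :=
    funext fun s => (h.hasDerivAt_profile s).deriv
  rw [this]
  exact h.contDiff_div.neg

lemma profile_of_le (h : IsWeight χ δ r) {s : ℝ} (hs : s ≤ δ) : profile χ r s = profile χ r 0 := by
  have hc := h.contDiff_div.continuous
  have e : ∫ σ in s..0, χ σ / σ ^ 2 = 0 := by
    refine intervalIntegral.integral_zero_ae (ae_of_all _ fun σ hσ => ?_)
    rw [h.eq_zero_left σ, zero_div]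
    exact hσ.2.trans (max_le hs h.pos.le)
  rw [profile, profile, ← intervalIntegral.integral_add_adjacent_intervals
    (hc.intervalIntegrable s 0) (hc.intervalIntegrable 0 r), e, zero_add]

lemma profile_of_ge (h : IsWeight χ δ r) {s : ℝ} (hs : r ≤ s) : profile χ r s = 0 := by
  refine intervalIntegral.integral_zero_ae (ae_of_all _ fun σ hσ => ?_)
  rw [h.eq_zero_right σ, zero_div]
  rw [uIoc_of_ge hs] at hσ
  exact hσ.1.le

lemma profile_nonneg (h : IsWeight χ δ r) (s : ℝ) : 0 ≤ profile χ r s := by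
  rcases le_total r s with hs | hs
  · rw [h.profile_of_ge hs]
  · exact intervalIntegral.integral_nonneg hs fun σ _ => div_nonneg (h.nonneg σ) (sq_nonneg σ)

/-- Since `χ ≤ 1`, comparison with `∫_s^r σ⁻² dσ = 1/s - 1/r`; the bound does not see `δ`. -/
lemma profile_le (h : IsWeight χ δ r) {s : ℝ} (hs : 0 < s) : profile χ r s ≤ 1 / s := by
  rcases le_total r s with hr | hr
  · rw [h.profile_of_ge hr]; positivity
  have hc : ContinuousOn (fun σ : ℝ => (σ ^ 2)⁻¹) (uIcc s r) := by
    refine ContinuousOn.inv₀ (by fun_prop) fun σ hσ => ?_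
    rw [uIcc_of_le hr] at hσ
    have := hs.trans_le hσ.1
    positivity
  have e : ∫ σ in s..r, (σ ^ 2)⁻¹ = -r⁻¹ - -s⁻¹ := by
    refine intervalIntegral.integral_eq_sub_of_hasDerivAt (f := fun σ => -σ⁻¹) (fun σ hσ => ?_)
      hc.intervalIntegrable
    rw [uIcc_of_le hr] at hσ
    have := hs.trans_le hσ.1
    simpa using (hasDerivAt_inv this.ne').fun_neg
  have h2 : profile χ r s ≤ ∫ σ in s..r, (σ ^ 2)⁻¹ := by
    refine intervalIntegral.integral_mono_on hr
      (h.contDiff_div.continuous.intervalIntegrable _ _) hc.intervalIntegrable fun σ hσ => ?_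
    rw [div_eq_mul_inv]
    exact mul_le_of_le_one_left (by positivity) (h.le_one σ)
  have : 0 < r⁻¹ := inv_pos.2 (h.pos.trans h.lt)
  rw [e] at h2
  rw [one_div]
  linarith

/-- The profile is constant below `δ`, so the singularity of the norm at the origin does no harm. -/
lemma contDiff_profile_norm (h : IsWeight χ δ r) :
    ContDiff ℝ ∞ fun z : Space => profile χ r ‖z‖ := by
  rw [contDiff_iff_contDiffAt]
  intro z
  rcases eq_or_ne z 0 with rfl | hz
  · refine (contDiffAt_const (c := profile χ r 0)).congr_of_eventuallyEq ?_
    filter_upwards [Metric.ball_mem_nhds (0 : Space) h.pos] with y hy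
    exact h.profile_of_le (by simpa using (mem_ball_zero_iff.1 hy).le)
  · exact h.contDiff_profile.contDiffAt.comp z (contDiffAt_norm ℝ hz)

lemma contDiff_kernel (h : IsWeight χ δ r) (i : Fin 3) : ContDiff ℝ ∞ (kernel χ r i) :=
  h.contDiff_profile_norm.mul (by fun_prop)

lemma hasFDerivAt_profile_norm (h : IsWeight χ δ r) (z : Space) :
    HasFDerivAt (fun z : Space => profile χ r ‖z‖)
      ((-(χ ‖z‖ / ‖z‖ ^ 3)) • innerSL ℝ z) z := by
  rcases eq_or_ne z 0 with rfl | hz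
  · have : (-(χ ‖(0 : Space)‖ / ‖(0 : Space)‖ ^ 3)) • innerSL ℝ (0 : Space) = 0 := by simp
    rw [this]
    refine (hasFDerivAt_const (profile χ r 0) (0 : Space)).congr_of_eventuallyEq ?_
    filter_upwards [Metric.ball_mem_nhds (0 : Space) h.pos] with y hy
    exact h.profile_of_le (by simpa using (mem_ball_zero_iff.1 hy).le)
  · have hz' : 0 < ‖z‖ := norm_pos_iff.2 hz
    -- The norm is written as the square root of its square, which is differentiated by the chain
    -- rule away from 0.
    have h1 : HasDerivAt (fun τ => profile χ r √τ)
        (-(χ √(‖z‖ ^ 2) / √(‖z‖ ^ 2) ^ 2) * (1 / (2 * √(‖z‖ ^ 2)))) (‖z‖ ^ 2) :=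
      (h.hasDerivAt_profile _).comp _ (Real.hasDerivAt_sqrt (by positivity))
    have h2 := h1.comp_hasFDerivAt z (hasStrictFDerivAt_norm_sq z).hasFDerivAt
    rw [Real.sqrt_sq hz'.le] at h2
    refine (h2.congr_of_eventuallyEq (Eventually.of_forall fun y => ?_)).congr_fderiv ?_
    · simp [Real.sqrt_sq (norm_nonneg y)]
    · ext v
      simp
      field_simp

lemma partialD_kernel (h : IsWeight χ δ r) (i j : Fin 3) (z : Space) :
    partialD j (kernel χ r i) z
      = (if i = j then profile χ r ‖z‖ else 0) - χ ‖z‖ / ‖z‖ ^ 3 * (z i * z j) := by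
  have hi : HasFDerivAt (fun z : Space => z i)
      (EuclideanSpace.proj i : EuclideanSpace ℝ (Fin 3) →L[ℝ] ℝ) z :=
    (EuclideanSpace.proj i : EuclideanSpace ℝ (Fin 3) →L[ℝ] ℝ).hasFDerivAt
  have hk : HasFDerivAt (kernel χ r i) _ z := (h.hasFDerivAt_profile_norm z).mul hi
  have hin : inner ℝ z (EuclideanSpace.single j (1 : ℝ)) = z j := by
    rw [EuclideanSpace.inner_single_right]; simp
  rw [partialD, hk.fderiv]
  by_cases hij : i = j
  · simp [hij, hin]; ring
  · simp [hij, hin]; ring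

lemma partialD_kernel_neg (h : IsWeight χ δ r) (i j : Fin 3) (z : Space) :
    partialD j (kernel χ r i) (-z) = partialD j (kernel χ r i) z := by
  simp [h.partialD_kernel]

/-- The factor `1/|z|` from the profile cancels `|z_i|`, uniformly in the weight and in `δ`. -/
lemma abs_kernel_le (h : IsWeight χ δ r) (i : Fin 3) (z : Space) :
    |kernel χ r i z| ≤ ballInd r z := by
  rcases lt_or_ge ‖z‖ r with hz | hz
  · rw [ballInd_of_lt hz, kernel, abs_mul, abs_of_nonneg (h.profile_nonneg _)]
    rcases eq_or_ne z 0 with rfl | hz0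
    · simp
    · have hz' : 0 < ‖z‖ := norm_pos_iff.2 hz0
      calc _ ≤ 1 / ‖z‖ * ‖z‖ := mul_le_mul (h.profile_le hz') (abs_coord_le z i) (abs_nonneg _)
            (by positivity)
        _ = 1 := by field_simp
  · rw [kernel, h.profile_of_ge hz, zero_mul, abs_zero]
    exact ballInd_nonneg _ _

lemma partialD_kernel_of_ge (h : IsWeight χ δ r) (i j : Fin 3) {z : Space} (hz : r ≤ ‖z‖) :
    partialD j (kernel χ r i) z = 0 := by
  rw [h.partialD_kernel, h.profile_of_ge hz, h.eq_zero_right _ hz]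
  simp

lemma abs_partialD_kernel_le (h : IsWeight χ δ r) (i j : Fin 3) {z : Space} (hz0 : z ≠ 0) :
    |partialD j (kernel χ r i) z| ≤ 2 / ‖z‖ * ballInd r z := by
  have hz' : 0 < ‖z‖ := norm_pos_iff.2 hz0
  rcases lt_or_ge ‖z‖ r with hz | hz
  · rw [ballInd_of_lt hz, mul_one, h.partialD_kernel]
    have h1 : |if i = j then profile χ r ‖z‖ else 0| ≤ 1 / ‖z‖ := by
      split_ifs
      · rw [abs_of_nonneg (h.profile_nonneg _)]; exact h.profile_le hz'
      · rw [abs_zero]; positivity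
    have h2 : |χ ‖z‖ / ‖z‖ ^ 3 * (z i * z j)| ≤ 1 / ‖z‖ := by
      rw [abs_mul, abs_div, abs_of_nonneg (h.nonneg _), abs_of_pos (by positivity : 0 < ‖z‖ ^ 3),
        abs_mul]
      calc _ ≤ 1 / ‖z‖ ^ 3 * (‖z‖ * ‖z‖) := by
            gcongr
            · exact h.le_one _
            · exact abs_coord_le _ _
            · exact abs_coord_le _ _
        _ = 1 / ‖z‖ := by field_simp
    refine (abs_sub _ _).trans ?_
    calc _ ≤ 1 / ‖z‖ + 1 / ‖z‖ := add_le_add h1 h2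
      _ = 2 / ‖z‖ := by ring
  · rw [h.partialD_kernel_of_ge i j hz, abs_zero]
    exact mul_nonneg (by positivity) (ballInd_nonneg _ _)

/-- This serves where a Lipschitz difference of cut-offs supplies the factor `|z|`; again the
constant is independent of `δ`. -/
lemma abs_partialD_kernel_mul_le (h : IsWeight χ δ r) (i j : Fin 3) (z : Space) :
    |partialD j (kernel χ r i) z| * ‖z‖ ≤ 2 * ballInd r z := by
  rcases eq_or_ne z 0 with rfl | hz0
  · simpa using ballInd_nonneg r 0
  · have hz' : 0 < ‖z‖ := norm_pos_iff.2 hz0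
    calc _ ≤ 2 / ‖z‖ * ballInd r z * ‖z‖ := by
          gcongr; exact h.abs_partialD_kernel_le i j hz0
      _ = 2 * ballInd r z := by field_simp

lemma continuous_partialD_kernel (h : IsWeight χ δ r) (i j : Fin 3) :
    Continuous (partialD j (kernel χ r i)) :=
  ((h.contDiff_kernel i).continuous_fderiv (by simp)).clm_apply continuous_const

/-- This bound may blow up as `δ → 0`. It only makes the kernel admissible and the separate terms
integrable; it never enters an estimate. -/
lemma exists_bound (h : IsWeight χ δ r) :
    ∃ N, (∀ i z, |kernel χ r i z| ≤ N) ∧ ∀ i j z, |partialD j (kernel χ r i) z| ≤ N := by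
  have hb : ∀ i j, ∃ N, ∀ z, |partialD j (kernel χ r i) z| ≤ N := fun i j => by
    refine HasCompactSupport.exists_bound_of_continuous ?_ (h.continuous_partialD_kernel i j)
    refine HasCompactSupport.intro (isCompact_closedBall (0 : Space) r) fun z hz => ?_
    exact h.partialD_kernel_of_ge i j (by simpa using (not_le.1 (by simpa using hz)).le)
  choose N hN using hb
  refine ⟨1 + ∑ i, ∑ j, |N i j|, fun i z => ?_, fun i j z => ?_⟩
  · refine ((h.abs_kernel_le i z).trans (ballInd_le_one r z)).trans ?_
    have : 0 ≤ ∑ i, ∑ j, |N i j| := by positivity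
    linarith
  · have h1 : |N i j| ≤ ∑ j, |N i j| := Finset.single_le_sum (f := fun j => |N i j|)
      (fun _ _ => abs_nonneg _) (Finset.mem_univ j)
    have h2 : ∑ j, |N i j| ≤ ∑ i, ∑ j, |N i j| := Finset.single_le_sum (f := fun i => ∑ j, |N i j|)
      (fun _ _ => by positivity) (Finset.mem_univ i)
    have := hN i j z
    have := le_abs_self (N i j)
    linarith

/-- The trace `3k - χ/|z|` is arranged to show two transversal eigenvalues and one longitudinal. -/
lemma sum_partialD_kernel (h : IsWeight χ δ r) (z : Space) :
    ∑ i, partialD i (kernel χ r i) z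
      = 2 * profile χ r ‖z‖ + (profile χ r ‖z‖ - χ ‖z‖ / ‖z‖) := by
  simp only [h.partialD_kernel, if_true, Finset.sum_sub_distrib, ← Finset.mul_sum]
  have : ∑ i, z i * z i = ‖z‖ ^ 2 := by rw [← inner_eq_sum, real_inner_self_eq_norm_sq]
  rw [this]
  rcases eq_or_ne z 0 with rfl | hz0
  · simp; ring
  · have hz' : 0 < ‖z‖ := norm_pos_iff.2 hz0
    simp; field_simp; ring

/-- The matrix `k I - χ |z|⁻³ z ⊗ z` acts as `k` on the plane orthogonal to `z` and as `k - χ/|z|`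
on the line of `z`. -/
lemma sum_sum_partialD_kernel (h : IsWeight χ δ r) (z w : Space) :
    ∑ i, ∑ j, w i * w j * partialD j (kernel χ r i) z
      = profile χ r ‖z‖ * ‖projPerp z w‖ ^ 2
        + (profile χ r ‖z‖ - χ ‖z‖ / ‖z‖) * ‖projPar z w‖ ^ 2 := by
  have e1 : ∑ i, ∑ j, w i * w j * partialD j (kernel χ r i) z
      = profile χ r ‖z‖ * ‖w‖ ^ 2 - χ ‖z‖ / ‖z‖ ^ 3 * (inner ℝ z w) ^ 2 := by
    rw [← real_inner_self_eq_norm_sq, inner_eq_sum, inner_eq_sum]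
    simp only [h.partialD_kernel, Fin.sum_univ_three]
    simp
    ring
  rw [e1, norm_projPerp_sq, norm_projPar_sq]
  rcases eq_or_ne z 0 with rfl | hz0
  · simp
  · have hz' : 0 < ‖z‖ := norm_pos_iff.2 hz0
    field_simp
    ring

end IsWeight

/-! ### Exchange of the two points and pair estimates -/

/-- The exchange of the two space points. -/
def swapPoints : (SpaceTime × Space) ≃ᵐ (SpaceTime × Space) :=
  (MeasurableEquiv.prodAssoc.trans MeasurableEquiv.prodComm).trans
    (MeasurableEquiv.prodCongr MeasurableEquiv.prodComm (MeasurableEquiv.refl Space))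

lemma measurePreserving_swapPoints :
    MeasurePreserving swapPoints (volume : Measure (SpaceTime × Space)) volume :=
  ((Measure.measurePreserving_swap (μ := (volume : Measure ℝ))
      (ν := (volume : Measure Space))).prod (MeasurePreserving.id (volume : Measure Space))).comp
    ((Measure.measurePreserving_swap (μ := (volume : Measure Space))
      (ν := (volume : Measure (ℝ × Space)))).comp
      (measurePreserving_prodAssoc (volume : Measure Space) (volume : Measure ℝ)
        (volume : Measure Space)))

lemma integral_swapPoints (F : SpaceTime × Space → ℝ) :
    ∫ p : SpaceTime × Space, F ((p.2, p.1.2), p.1.1) = ∫ p, F p :=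
  measurePreserving_swapPoints.integral_comp' (f := swapPoints) F

lemma integrable_swapPoints {F : SpaceTime × Space → ℝ} (hF : Integrable F) :
    Integrable fun p : SpaceTime × Space => F ((p.2, p.1.2), p.1.1) :=
  (measurePreserving_swapPoints.integrable_comp_emb swapPoints.measurableEmbedding).2 hF

/-- The density, extended by zero. -/
noncomputable def dens (Ω : Set Space) (T : ℝ) (ϱ : SpaceTime → ℝ) : SpaceTime → ℝ :=
  (cylinder Ω T).indicator ϱ

/-- Twice the kinetic energy density, extended by zero. -/
noncomputable def kin (Ω : Set Space) (T : ℝ) (ϱ : SpaceTime → ℝ) (u : SpaceTime → Space) :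
    SpaceTime → ℝ :=
  (cylinder Ω T).indicator fun z => ϱ z * ‖u z‖ ^ 2

/-- In polar coordinates the Jacobian `s²` of dimension three cancels `s⁻²`. This makes the squared
kernel gradient integrate to `O(r)`. -/
lemma integral_ballInd_div_sq {r : ℝ} (hr : 0 ≤ r) :
    Integrable (fun z : Space => ballInd r z / ‖z‖ ^ 2) ∧
      ∫ z : Space, ballInd r z / ‖z‖ ^ 2 = 3 * unitBallVolume * r := by
  have hfun : (fun z : Space => ballInd r z / ‖z‖ ^ 2)
      = fun z : Space => (fun s : ℝ => (Iio r).indicator (fun s => 1 / s ^ 2) s) ‖z‖ := by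
    ext z
    rcases lt_or_ge ‖z‖ r with h | h
    · rw [ballInd_of_lt h]; simp [h]
    · rw [ballInd_of_le h]; simp [h]
  have hr3 : Module.finrank ℝ Space = 3 := by simp
  have hon : ∀ y ∈ Ioi (0 : ℝ), y ^ (Module.finrank ℝ Space - 1) •
      (Iio r).indicator (fun s : ℝ => 1 / s ^ 2) y = (Iio r).indicator (fun _ => (1 : ℝ)) y := by
    intro y hy
    have hy' : y ≠ 0 := ne_of_gt hy
    by_cases h : y < r
    · rw [hr3]; simp [h]; field_simp
    · simp [h]
  have hset : Iio r ∩ Ioi 0 = Ioo 0 r := by ext; simp [and_comm]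
  constructor
  · rw [hfun, integrable_fun_norm_addHaar volume]
    rw [integrableOn_congr_fun hon measurableSet_Ioi, IntegrableOn,
      integrable_indicator_iff measurableSet_Iio, IntegrableOn,
      Measure.restrict_restrict measurableSet_Iio, hset]
    exact integrable_const _
  · rw [hfun, integral_fun_norm_addHaar volume, setIntegral_congr_fun measurableSet_Ioi hon,
      integral_indicator measurableSet_Iio, Measure.restrict_restrict measurableSet_Iio, hset, hr3]
    simp [hr, unitBallVolume, Measure.real]
    ring

section bounds

variable {Ω : Set Space} {T : ℝ} {ϱ p : SpaceTime → ℝ} {u f : SpaceTime → Space}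
  {S : SpaceTime → Matrix (Fin 3) (Fin 3) ℝ} {V E A c : ℝ}

lemma Controlled.dens_nonneg (h : Controlled Ω T ϱ p u f S V E A c) (z : SpaceTime) :
    0 ≤ dens Ω T ϱ z := indicator_nonneg h.density_nonneg z

lemma Controlled.kin_nonneg (h : Controlled Ω T ϱ p u f S V E A c) (z : SpaceTime) :
    0 ≤ kin Ω T ϱ u z :=
  indicator_nonneg (fun z hz => mul_nonneg (h.density_nonneg z hz) (sq_nonneg _)) z

lemma Controlled.measurable_dens (h : Controlled Ω T ϱ p u f S V E A c) :
    Measurable (dens Ω T ϱ) := h.measurable_density.indicator (measurableSet_cylinder h.isOpen T)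

lemma Controlled.measurable_kin (h : Controlled Ω T ϱ p u f S V E A c) :
    Measurable (kin Ω T ϱ u) := by
  have h1 := h.measurable_density
  have h2 := h.measurable_velocity
  exact Measurable.indicator (by fun_prop) (measurableSet_cylinder h.isOpen T)

lemma Controlled.dens_add_kin_le (h : Controlled Ω T ϱ p u f S V E A c) (z : SpaceTime) :
    dens Ω T ϱ z + kin Ω T ϱ u z ≤ majorant Ω T ϱ p u S z := by
  by_cases hz : z ∈ cylinder Ω T
  · have h1 := h.density_le_majorant hz
    have h2 := h.pressure_nonneg z hz
    rw [dens, kin, indicator_of_mem hz, indicator_of_mem hz]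
    linarith
  · rw [dens, kin, majorant]; simp [hz]

lemma Controlled.integrable_dens (h : Controlled Ω T ϱ p u f S V E A c) :
    Integrable (dens Ω T ϱ) :=
  h.integrable_majorant.mono' h.measurable_dens.aestronglyMeasurable (ae_of_all _ fun z => by
    rw [Real.norm_of_nonneg (h.dens_nonneg z)]
    have := h.dens_add_kin_le z
    have := h.kin_nonneg z
    linarith)

lemma Controlled.integrable_kin (h : Controlled Ω T ϱ p u f S V E A c) :
    Integrable (kin Ω T ϱ u) :=
  h.integrable_majorant.mono' h.measurable_kin.aestronglyMeasurable (ae_of_all _ fun z => by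
    rw [Real.norm_of_nonneg (h.kin_nonneg z)]
    have := h.dens_add_kin_le z
    have := h.dens_nonneg z
    linarith)

lemma Controlled.integral_dens_le (h : Controlled Ω T ϱ p u f S V E A c) :
    ∫ z, dens Ω T ϱ z ≤ A :=
  (integral_mono h.integrable_dens h.integrable_majorant fun z => by
    have := h.dens_add_kin_le z
    have := h.kin_nonneg z
    linarith).trans h.integral_majorant_le

lemma Controlled.integral_kin_le (h : Controlled Ω T ϱ p u f S V E A c) :
    ∫ z, kin Ω T ϱ u z ≤ A :=
  (integral_mono h.integrable_kin h.integrable_majorant fun z => by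
    have := h.dens_add_kin_le z
    have := h.dens_nonneg z
    linarith).trans h.integral_majorant_le

lemma Controlled.slice_dens (h : Controlled Ω T ϱ p u f S V E A c) :
    ∀ᵐ t : ℝ, ∫⁻ x : Space, ENNReal.ofReal (dens Ω T ϱ (x, t)) ≤ ENNReal.ofReal (V + E) := by
  filter_upwards [h.slice_one, h.slice_pressure] with t h1 h3
  have hm : Measurable fun x : Space =>
      ENNReal.ofReal ((cylinder Ω T).indicator (fun _ => (1 : ℝ)) (x, t)) :=
    ((measurable_const.indicator (measurableSet_cylinder h.isOpen T)).ennreal_ofReal).comp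
      (measurable_id.prodMk measurable_const)
  rw [ENNReal.ofReal_add h.V_nonneg h.E_nonneg]
  refine le_trans ?_ (add_le_add h1 h3)
  rw [← lintegral_add_left hm]
  refine lintegral_mono fun x => ?_
  by_cases hz : (x, t) ∈ cylinder Ω T
  · simp only [dens, indicator_of_mem hz]
    rw [← ENNReal.ofReal_add zero_le_one (h.pressure_nonneg _ hz)]
    have := h.density_le _ hz 1 one_pos
    exact ENNReal.ofReal_le_ofReal (by linarith)
  · simp [dens, indicator_of_notMem hz]

/-- The mass in a small ball. -/
lemma Controlled.slice_dens_ball (h : Controlled Ω T ϱ p u f S V E A c) {r : ℝ} (hr : 0 < r) :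
    ∀ᵐ t : ℝ, ∀ x : Space, ∫⁻ y : Space,
      ENNReal.ofReal (dens Ω T ϱ (y, t) * ballInd r (x - y))
        ≤ ENNReal.ofReal ((E + unitBallVolume) * r) := by
  filter_upwards [h.slice_pressure] with t ht x
  -- The choice `a = r` in `density_le` balances both parts: `r E` from the pressure and `r⁻²` times
  -- the volume of the ball.
  have e : (E + unitBallVolume) * r = r * E + (r ^ 2)⁻¹ * (r ^ 3 * unitBallVolume) := by
    field_simp
  have hV := unitBallVolume_nonneg
  have hE := h.E_nonneg
  have hm := measurable_ballInd r
  rw [e, ENNReal.ofReal_add (by positivity) (by positivity), ENNReal.ofReal_mul hr.le,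
    ENNReal.ofReal_mul (by positivity : 0 ≤ (r ^ 2)⁻¹)]
  rw [← lintegral_ballInd x hr.le]
  refine le_trans ?_ (add_le_add_left (mul_le_mul_right ht _) _)
  rw [← lintegral_const_mul' _ _ ENNReal.ofReal_ne_top,
    ← lintegral_const_mul' _ _ ENNReal.ofReal_ne_top, ← lintegral_add_right _ (by fun_prop)]
  refine lintegral_mono fun y => ?_
  have hb := ballInd_nonneg r (x - y)
  by_cases hz : (y, t) ∈ cylinder Ω T
  · have hp := h.pressure_nonneg _ hz
    simp only [dens, indicator_of_mem hz]
    rw [← ENNReal.ofReal_mul hr.le, ← ENNReal.ofReal_mul (by positivity),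
      ← ENNReal.ofReal_add (by positivity) (by positivity)]
    refine ENNReal.ofReal_le_ofReal ?_
    have h1 := mul_le_mul_of_nonneg_right (h.density_le _ hz r hr) hb
    have h2 := mul_le_mul_of_nonneg_left (ballInd_le_one r (x - y)) (mul_nonneg hr.le hp)
    linarith
  · simp [dens, indicator_of_notMem hz]

/-- The basic pair estimate: the density in a small ball against an integrable function. -/
lemma Controlled.pair_dens_ball (h : Controlled Ω T ϱ p u f S V E A c) {r : ℝ} (hr : 0 < r)
    {X : SpaceTime → ℝ} (hX : Integrable X) (hX0 : ∀ z, 0 ≤ X z) :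
    Integrable (fun q : SpaceTime × Space =>
      X q.1 * (dens Ω T ϱ (q.2, q.1.2) * ballInd r (q.1.1 - q.2))) ∧
    ∫ q : SpaceTime × Space, X q.1 * (dens Ω T ϱ (q.2, q.1.2) * ballInd r (q.1.1 - q.2))
      ≤ (∫ z, X z) * ((E + unitBallVolume) * r) := by
  have := h.E_nonneg
  have := unitBallVolume_nonneg
  exact pair_bound hX hX0 h.measurable_dens (measurable_ballInd r)
    (fun z x => mul_nonneg (h.dens_nonneg z) (ballInd_nonneg r x)) (by positivity)
    (h.slice_dens_ball hr)

lemma Controlled.pair_kin (h : Controlled Ω T ϱ p u f S V E A c)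
    {X : SpaceTime → ℝ} (hX : Integrable X) (hX0 : ∀ z, 0 ≤ X z) :
    Integrable (fun q : SpaceTime × Space => X q.1 * kin Ω T ϱ u (q.2, q.1.2)) ∧
    ∫ q : SpaceTime × Space, X q.1 * kin Ω T ϱ u (q.2, q.1.2) ≤ (∫ z, X z) * E := by
  have := pair_bound (κ := fun _ => 1) hX hX0 h.measurable_kin measurable_const
    (fun z x => by simpa using h.kin_nonneg z) h.E_nonneg
    (by filter_upwards [h.slice_kinetic] with t ht x; simpa [kin] using ht)
  simpa using this

lemma Controlled.pair_dens (h : Controlled Ω T ϱ p u f S V E A c)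
    {X : SpaceTime → ℝ} (hX : Integrable X) (hX0 : ∀ z, 0 ≤ X z) :
    Integrable (fun q : SpaceTime × Space => X q.1 * dens Ω T ϱ (q.2, q.1.2)) ∧
    ∫ q : SpaceTime × Space, X q.1 * dens Ω T ϱ (q.2, q.1.2) ≤ (∫ z, X z) * (V + E) := by
  have := pair_bound (κ := fun _ => 1) hX hX0 h.measurable_dens measurable_const
    (fun z x => by simpa using h.dens_nonneg z) (add_nonneg h.V_nonneg h.E_nonneg)
    (by filter_upwards [h.slice_dens] with t ht x; simpa using ht)
  simpa using this

end bounds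

/-! ### Bounds for the localized fields -/

section bounds

variable {Ω : Set Space} {T : ℝ} {ϱ p : SpaceTime → ℝ} {u f : SpaceTime → Space}
  {S : SpaceTime → Matrix (Fin 3) (Fin 3) ℝ} {V E A c L : ℝ} {l : SpaceTime → ℝ}

lemma CutoffBounds.pow_le (hl : CutoffBounds Ω T l L) (n : ℕ) (z : SpaceTime) :
    l z ^ n ≤ L ^ n := pow_le_pow_left₀ (hl.nonneg z) (hl.le z) n

lemma CutoffBounds.measurable (hl : CutoffBounds Ω T l L) : Measurable l :=
  hl.contDiff.continuous.measurable

lemma CutoffBounds.measurable_timeDeriv (hl : CutoffBounds Ω T l L) :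
    Measurable (timeDeriv l) :=
  ((hl.contDiff.continuous_fderiv (by simp)).clm_apply continuous_const).measurable

lemma CutoffBounds.measurable_spaceDeriv (hl : CutoffBounds Ω T l L) (j : Fin 3) :
    Measurable (spaceDeriv j l) :=
  ((hl.contDiff.continuous_fderiv (by simp)).clm_apply continuous_const).measurable

lemma Controlled.locDensity_nonneg (h : Controlled Ω T ϱ p u f S V E A c)
    (hl : CutoffBounds Ω T l L) (z : SpaceTime) : 0 ≤ locDensity l ϱ z := by
  by_cases hz : z ∈ cylinder Ω T
  · exact mul_nonneg (pow_nonneg (hl.nonneg z) _) (h.density_nonneg z hz)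
  · simp [locDensity, hl.eq_zero z hz]

lemma Controlled.locDensity_le (h : Controlled Ω T ϱ p u f S V E A c)
    (hl : CutoffBounds Ω T l L) (z : SpaceTime) : locDensity l ϱ z ≤ L ^ 4 * dens Ω T ϱ z := by
  by_cases hz : z ∈ cylinder Ω T
  · rw [dens, indicator_of_mem hz, locDensity]
    exact mul_le_mul_of_nonneg_right (hl.pow_le 4 z) (h.density_nonneg z hz)
  · simp [locDensity, dens, hl.eq_zero z hz, hz]

lemma abs_pow_mul_le {a b x y : ℝ} {n : ℕ} (ha : 0 ≤ a) (hab : a ≤ b) (hxy : |x| ≤ y) :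
    |a ^ n * x| ≤ b ^ n * y := by
  rw [abs_mul, abs_of_nonneg (pow_nonneg ha n)]
  exact mul_le_mul (pow_le_pow_left₀ ha hab n) hxy (abs_nonneg _)
    (pow_nonneg (ha.trans hab) n)

lemma Controlled.abs_locMomentum_le (h : Controlled Ω T ϱ p u f S V E A c)
    (hl : CutoffBounds Ω T l L) (i : Fin 3) (z : SpaceTime) :
    |locMomentum l ϱ u i z| ≤ L ^ 6 * majorant Ω T ϱ p u S z := by
  by_cases hz : z ∈ cylinder Ω T
  · exact abs_pow_mul_le (hl.nonneg z) (hl.le z) (h.abs_momentum_le hz i)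
  · simp [locMomentum, majorant, hl.eq_zero z hz, hz]

lemma Controlled.abs_locFlux_le (h : Controlled Ω T ϱ p u f S V E A c)
    (hl : CutoffBounds Ω T l L) (i j : Fin 3) (z : SpaceTime) :
    |locFlux l ϱ p u S i j z| ≤ L ^ 6 * majorant Ω T ϱ p u S z := by
  by_cases hz : z ∈ cylinder Ω T
  · exact abs_pow_mul_le (hl.nonneg z) (hl.le z) (h.abs_rawFlux_le hz i j)
  · simp [locFlux, majorant, hl.eq_zero z hz, hz]

/-- The constant 24 is 6 + 3 · 6, from the derivatives of `l⁶` in time and in three space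
directions. The bound is almost everywhere because that of `f` is. -/
lemma Controlled.abs_locForce_le (h : Controlled Ω T ϱ p u f S V E A c)
    (hl : CutoffBounds Ω T l L) (i : Fin 3) : ∀ᵐ z : SpaceTime,
    |locForce l ϱ p u f S i z| ≤ (24 + c) * L ^ 6 * majorant Ω T ϱ p u S z := by
  filter_upwards [(ae_restrict_iff' (measurableSet_cylinder h.isOpen T)).1 h.force_le] with z hf
  by_cases hz : z ∈ cylinder Ω T
  · have hL := zero_le_one.trans hl.one_le
    have hH := h.majorant_nonneg z
    have key : ∀ {d x : ℝ}, |d| ≤ L → |x| ≤ majorant Ω T ϱ p u S z →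
        |6 * l z ^ 5 * d * x| ≤ 6 * (L ^ 6 * majorant Ω T ϱ p u S z) := fun {d x} hd hx => by
      have e : 6 * l z ^ 5 * d * x = 6 * (l z ^ 5 * (d * x)) := by ring
      have e2 : L ^ 6 * majorant Ω T ϱ p u S z = L ^ 5 * (L * majorant Ω T ϱ p u S z) := by ring
      rw [e, abs_mul, abs_of_pos (by norm_num : (0 : ℝ) < 6), e2]
      refine mul_le_mul_of_nonneg_left (abs_pow_mul_le (hl.nonneg z) (hl.le z) ?_) (by norm_num)
      rw [abs_mul]
      exact mul_le_mul hd hx (abs_nonneg _) hL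
    have h1 := key (hl.timeDeriv_le z) (h.abs_momentum_le hz i)
    have h2 := fun j => key (hl.spaceDeriv_le j z) (h.abs_rawFlux_le hz i j)
    have h3 := abs_pow_mul_le (n := 6) (hl.nonneg z) (hl.le z) (h.abs_force_le hz (hf hz) i)
    have h4 : |∑ j, 6 * l z ^ 5 * spaceDeriv j l z * rawFlux ϱ p u S i j z|
        ≤ ∑ _j : Fin 3, 6 * (L ^ 6 * majorant Ω T ϱ p u S z) :=
      (Finset.abs_sum_le_sum_abs _ _).trans (Finset.sum_le_sum fun j _ => h2 j)
    rw [Finset.sum_const, Finset.card_univ, Fintype.card_fin, nsmul_eq_mul] at h4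
    rw [locForce]
    refine (abs_add_three _ _ _).trans ((add_le_add (add_le_add h1 h4) h3).trans (le_of_eq ?_))
    push_cast
    ring
  · simp [locForce, majorant, hl.eq_zero z hz, hz]

lemma young_mul {r s a : ℝ} (hr : 0 ≤ r) (ha : 0 < a) : r * s ≤ a * r + a⁻¹ * (r * s ^ 2) := by
  have h1 : s ≤ a + a⁻¹ * s ^ 2 := by
    have : 0 ≤ a⁻¹ * ((s - a) ^ 2 + s ^ 2 + a ^ 2) := by positivity
    have e : a⁻¹ * ((s - a) ^ 2 + s ^ 2 + a ^ 2) = 2 * (a + a⁻¹ * s ^ 2 - s) := by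
      field_simp; ring
    linarith
  nlinarith [mul_le_mul_of_nonneg_left h1 hr]

lemma Controlled.abs_density_mul_le_young (h : Controlled Ω T ϱ p u f S V E A c) {z : SpaceTime}
    (hz : z ∈ cylinder Ω T) (i : Fin 3) {a : ℝ} (ha : 0 < a) :
    |ϱ z * u z i| ≤ a * dens Ω T ϱ z + a⁻¹ * kin Ω T ϱ u z := by
  have h0 := h.density_nonneg z hz
  rw [abs_mul, abs_of_nonneg h0, dens, kin, indicator_of_mem hz, indicator_of_mem hz]
  exact (mul_le_mul_of_nonneg_left (abs_coord_le _ i) h0).trans (young_mul h0 ha)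

lemma Controlled.abs_locCurrent_le (h : Controlled Ω T ϱ p u f S V E A c)
    (hl : CutoffBounds Ω T l L) (i : Fin 3) (z : SpaceTime) :
    |locCurrent l ϱ u i z| ≤ L ^ 4 * (dens Ω T ϱ z + kin Ω T ϱ u z) := by
  by_cases hz : z ∈ cylinder Ω T
  · have := h.abs_density_mul_le_young hz i one_pos
    exact abs_pow_mul_le (hl.nonneg z) (hl.le z) (by simpa using this)
  · simp [locCurrent, dens, kin, hl.eq_zero z hz, hz]

/-- The constant 16 is 4 · (1 + 3), from the derivatives of `l⁴`. The parameter will be `a =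
r^{-1/2}`: the density gains a factor `r` on small balls, whereas only the uniform-in-time bound is
available for the kinetic energy there, so its coefficient must be small. With `a ≥ 1` the term `ϱ
∂_t l` fits under the same bound. -/
lemma Controlled.abs_locSource_le (h : Controlled Ω T ϱ p u f S V E A c)
    (hl : CutoffBounds Ω T l L) (z : SpaceTime) {a : ℝ} (ha : 1 ≤ a) :
    |locSource l ϱ u z| ≤ 16 * L ^ 4 * (a * dens Ω T ϱ z + a⁻¹ * kin Ω T ϱ u z) := by
  have hL := zero_le_one.trans hl.one_le
  have ha0 : 0 < a := zero_lt_one.trans_le ha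
  have hB := h.dens_nonneg z
  have hJ := h.kin_nonneg z
  by_cases hz : z ∈ cylinder Ω T
  · set Y := a * dens Ω T ϱ z + a⁻¹ * kin Ω T ϱ u z with hY
    have hdY : |ϱ z| ≤ Y := by
      have e : dens Ω T ϱ z = ϱ z := indicator_of_mem hz _
      rw [abs_of_nonneg (h.density_nonneg z hz), ← e]
      have : 0 ≤ a⁻¹ * kin Ω T ϱ u z := by positivity
      nlinarith
    have key : ∀ {d x : ℝ}, |d| ≤ L → |x| ≤ Y → |d * x| ≤ L * Y := fun hd hx => by
      rw [abs_mul]; exact mul_le_mul hd hx (abs_nonneg _) hL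
    have h4 : |∑ j, spaceDeriv j l z * (ϱ z * u z j)| ≤ ∑ _j : Fin 3, L * Y :=
      (Finset.abs_sum_le_sum_abs _ _).trans (Finset.sum_le_sum fun j _ =>
        key (hl.spaceDeriv_le j z) (h.abs_density_mul_le_young hz j ha0))
    rw [Finset.sum_const, Finset.card_univ, Fintype.card_fin, nsmul_eq_mul] at h4
    have h5 := (abs_add_le _ _).trans (add_le_add (key (hl.timeDeriv_le z) hdY) h4)
    have h6 := abs_pow_mul_le (n := 3) (hl.nonneg z) (hl.le z) h5
    have e : locSource l ϱ u z = 4 * (l z ^ 3 * (timeDeriv l z * ϱ z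
        + ∑ j, spaceDeriv j l z * (ϱ z * u z j))) := by rw [locSource]; ring
    rw [e, abs_mul, abs_of_pos (by norm_num : (0 : ℝ) < 4)]
    refine (mul_le_mul_of_nonneg_left h6 (by norm_num)).trans (le_of_eq ?_)
    push_cast
    ring
  · simp [locSource, dens, kin, hl.eq_zero z hz, hz]

lemma Controlled.measurable_locDensity (h : Controlled Ω T ϱ p u f S V E A c)
    (hl : CutoffBounds Ω T l L) : Measurable (locDensity l ϱ) := by
  have h1 := h.measurable_density
  have h2 := hl.measurable
  unfold locDensity; fun_prop

lemma Controlled.measurable_locMomentum (h : Controlled Ω T ϱ p u f S V E A c)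
    (hl : CutoffBounds Ω T l L) (i : Fin 3) : Measurable (locMomentum l ϱ u i) := by
  have h1 := h.measurable_density
  have h2 := hl.measurable
  have h3 := h.measurable_velocity
  unfold locMomentum; fun_prop

lemma Controlled.measurable_locCurrent (h : Controlled Ω T ϱ p u f S V E A c)
    (hl : CutoffBounds Ω T l L) (i : Fin 3) : Measurable (locCurrent l ϱ u i) := by
  have h1 := h.measurable_density
  have h2 := hl.measurable
  have h3 := h.measurable_velocity
  unfold locCurrent; fun_prop

lemma Controlled.measurable_locFlux (h : Controlled Ω T ϱ p u f S V E A c)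
    (hl : CutoffBounds Ω T l L) (i j : Fin 3) : Measurable (locFlux l ϱ p u S i j) := by
  have h1 := h.measurable_rawFlux i j
  have h2 := hl.measurable
  unfold locFlux; fun_prop

lemma Controlled.measurable_locForce (h : Controlled Ω T ϱ p u f S V E A c)
    (hl : CutoffBounds Ω T l L) (i : Fin 3) : Measurable (locForce l ϱ p u f S i) := by
  have h0 := h.measurable_density
  have h1 := h.measurable_rawFlux i
  have h2 := hl.measurable
  have h3 := h.measurable_velocity
  have h4 := h.measurable_force
  have h5 := hl.measurable_timeDeriv
  have h6 := hl.measurable_spaceDeriv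
  unfold locForce; fun_prop

lemma Controlled.measurable_locSource (h : Controlled Ω T ϱ p u f S V E A c)
    (hl : CutoffBounds Ω T l L) : Measurable (locSource l ϱ u) := by
  have h0 := h.measurable_density
  have h2 := hl.measurable
  have h3 := h.measurable_velocity
  have h5 := hl.measurable_timeDeriv
  have h6 := hl.measurable_spaceDeriv
  unfold locSource; fun_prop

lemma Controlled.integrable_of_le (h : Controlled Ω T ϱ p u f S V E A c) {g : SpaceTime → ℝ}
    (hg : Measurable g) {K : ℝ} (hgK : ∀ᵐ z : SpaceTime, |g z| ≤ K * majorant Ω T ϱ p u S z) :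
    Integrable g :=
  (h.integrable_majorant.const_mul K).mono' hg.aestronglyMeasurable hgK

lemma Controlled.integrable_of_le_dens (h : Controlled Ω T ϱ p u f S V E A c) {g : SpaceTime → ℝ}
    (hg : Measurable g) {K : ℝ}
    (hgK : ∀ z : SpaceTime, |g z| ≤ K * (dens Ω T ϱ z + kin Ω T ϱ u z)) : Integrable g :=
  ((h.integrable_dens.add h.integrable_kin).const_mul K).mono' hg.aestronglyMeasurable
    (ae_of_all _ hgK)

lemma Controlled.slice_of_le (h : Controlled Ω T ϱ p u f S V E A c) {g : SpaceTime → ℝ} {K : ℝ}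
    (hK : 0 ≤ K) (hgK : ∀ z : SpaceTime, |g z| ≤ K * (dens Ω T ϱ z + kin Ω T ϱ u z)) :
    ∀ᵐ t : ℝ, ∫⁻ y : Space, ‖g (y, t)‖ₑ ≤ ENNReal.ofReal (K * (V + E + E)) := by
  filter_upwards [h.slice_dens, h.slice_kinetic] with t h1 h2
  have hB := h.measurable_dens
  have hV := h.V_nonneg
  have hE := h.E_nonneg
  calc ∫⁻ y : Space, ‖g (y, t)‖ₑ ≤ ∫⁻ y : Space, ENNReal.ofReal K *
        (ENNReal.ofReal (dens Ω T ϱ (y, t)) + ENNReal.ofReal (kin Ω T ϱ u (y, t))) := by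
        refine lintegral_mono fun y => ?_
        rw [Real.enorm_eq_ofReal_abs, ← ENNReal.ofReal_add (h.dens_nonneg _) (h.kin_nonneg _),
          ← ENNReal.ofReal_mul hK]
        exact ENNReal.ofReal_le_ofReal (hgK _)
    _ ≤ ENNReal.ofReal K * (ENNReal.ofReal (V + E) + ENNReal.ofReal E) := by
        rw [lintegral_const_mul' _ _ ENNReal.ofReal_ne_top, lintegral_add_left (by fun_prop)]
        gcongr
        exact h2
    _ = _ := by
        rw [← ENNReal.ofReal_add (by positivity) hE, ← ENNReal.ofReal_mul hK]

/-- The two-point identity for the localized equations. -/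
lemma Controlled.localized_identity (h : Controlled Ω T ϱ p u f S V E A c)
    (hl : CutoffBounds Ω T l L)
    (hmass : IsBalance (locDensity l ϱ) (locSource l ϱ u) (locCurrent l ϱ u))
    (hmom : ∀ i, IsBalance (locMomentum l ϱ u i) (locForce l ϱ p u f S i) (locFlux l ϱ p u S i))
    (i : Fin 3) {k : Space → ℝ} (hk : ContDiff ℝ ∞ k) {N : ℝ} (hkb : ∀ x, |k x| ≤ N)
    (hkb' : ∀ j x, |partialD j k x| ≤ N) :
    Integrable (fun q : SpaceTime × Space =>
      (∑ j, (locFlux l ϱ p u S i j q.1 * locDensity l ϱ (q.2, q.1.2)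
          - locMomentum l ϱ u i q.1 * locCurrent l ϱ u j (q.2, q.1.2)) * partialD j k (q.1.1 - q.2)
        + (locForce l ϱ p u f S i q.1 * locDensity l ϱ (q.2, q.1.2)
          + locMomentum l ϱ u i q.1 * locSource l ϱ u (q.2, q.1.2)) * k (q.1.1 - q.2))) ∧
    ∫ q : SpaceTime × Space,
      (∑ j, (locFlux l ϱ p u S i j q.1 * locDensity l ϱ (q.2, q.1.2)
          - locMomentum l ϱ u i q.1 * locCurrent l ϱ u j (q.2, q.1.2)) * partialD j k (q.1.1 - q.2)
        + (locForce l ϱ p u f S i q.1 * locDensity l ϱ (q.2, q.1.2)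
          + locMomentum l ϱ u i q.1 * locSource l ϱ u (q.2, q.1.2)) * k (q.1.1 - q.2)) = 0 := by
  have hL := zero_le_one.trans hl.one_le
  have hV := h.V_nonneg
  have hE := h.E_nonneg
  have b1 : ∀ z, |locDensity l ϱ z| ≤ 16 * L ^ 4 * (dens Ω T ϱ z + kin Ω T ϱ u z) := fun z => by
    rw [abs_of_nonneg (h.locDensity_nonneg hl z)]
    have := h.locDensity_le hl z
    have := mul_nonneg (pow_nonneg hL 4) (h.dens_nonneg z)
    have := mul_nonneg (pow_nonneg hL 4) (h.kin_nonneg z)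
    nlinarith
  have b2 : ∀ z, |locSource l ϱ u z| ≤ 16 * L ^ 4 * (dens Ω T ϱ z + kin Ω T ϱ u z) := fun z => by
    simpa using h.abs_locSource_le hl z le_rfl
  have b3 : ∀ j z, |locCurrent l ϱ u j z| ≤ 16 * L ^ 4 * (dens Ω T ϱ z + kin Ω T ϱ u z) :=
    fun j z => by
    have := h.abs_locCurrent_le hl j z
    have := mul_nonneg (pow_nonneg hL 4) (add_nonneg (h.dens_nonneg z) (h.kin_nonneg z))
    nlinarith
  have m1 := h.measurable_locDensity hl
  have m2 := h.measurable_locSource hl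
  have m3 := h.measurable_locCurrent hl
  have hK : 0 ≤ 16 * L ^ 4 := by positivity
  -- One slice constant must serve density, source and current; `16 * L ^ 4` is dictated by the
  -- source.
  exact two_point_identity (C := 16 * L ^ 4 * (V + E + E))
    (h.integrable_of_le (h.measurable_locMomentum hl i) (ae_of_all _ (h.abs_locMomentum_le hl i)))
    (h.integrable_of_le (h.measurable_locForce hl i) (h.abs_locForce_le hl i))
    (fun j => h.integrable_of_le (h.measurable_locFlux hl i j)
      (ae_of_all _ (h.abs_locFlux_le hl i j)))
    (h.integrable_of_le_dens m1 b1) (h.integrable_of_le_dens m2 b2)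
    (fun j => h.integrable_of_le_dens (m3 j) (b3 j)) m1 m2 m3 (by positivity)
    (h.slice_of_le hK b1) (h.slice_of_le hK b2) (fun j => h.slice_of_le hK (b3 j))
    (hmom i) hmass hk hkb hkb'

end bounds

/-! ### Splitting of the identity and estimate of the error -/

/-- The convective part of the two-point identity, before symmetrization. -/
noncomputable def convTerm (l ϱ : SpaceTime → ℝ) (u : SpaceTime → Space)
    (K : Fin 3 → Space → ℝ) (q : SpaceTime × Space) : ℝ :=
  ∑ i, ∑ j, locDensity l ϱ q.1 * locDensity l ϱ (q.2, q.1.2)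
    * (locVelocity l u q.1 i * (locVelocity l u q.1 j - locVelocity l u (q.2, q.1.2) j))
    * partialD j (K i) (q.1.1 - q.2)

/-- The pressure part of the two-point identity. -/
noncomputable def presTerm (l ϱ p : SpaceTime → ℝ) (K : Fin 3 → Space → ℝ)
    (q : SpaceTime × Space) : ℝ :=
  (l q.1 ^ 6 * p q.1) * locDensity l ϱ (q.2, q.1.2) * ∑ i, partialD i (K i) (q.1.1 - q.2)

/-- The error part of the two-point identity. -/
noncomputable def errTerm (l ϱ p : SpaceTime → ℝ) (u f : SpaceTime → Space)
    (S : SpaceTime → Matrix (Fin 3) (Fin 3) ℝ) (K : Fin 3 → Space → ℝ)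
    (q : SpaceTime × Space) : ℝ :=
  ∑ i, (∑ j, (-(l q.1 ^ 6 * S q.1 i j * locDensity l ϱ (q.2, q.1.2)
          * partialD j (K i) (q.1.1 - q.2))
        - l q.1 ^ 5 * (ϱ q.1 * u q.1 i) * (l q.1 - l (q.2, q.1.2))
          * locCurrent l ϱ u j (q.2, q.1.2) * partialD j (K i) (q.1.1 - q.2))
      + (locForce l ϱ p u f S i q.1 * locDensity l ϱ (q.2, q.1.2)
          * K i (q.1.1 - q.2)
        + locMomentum l ϱ u i q.1 * locSource l ϱ u (q.2, q.1.2) * K i (q.1.1 - q.2)))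

/-- The cut-offs in the product of momentum and current are `l(x)⁶ l(y)⁴ = l(x)⁵ l(y)⁵ + l(x)⁵ l(y)⁴
(l(x) - l(y))`. The first part is what `ρ(x)ρ(y) v_i(x) v_j(y)` needs, the second is the commutator
in the error. -/
lemma sum_identity_integrand (l ϱ p : SpaceTime → ℝ) (u f : SpaceTime → Space)
    (S : SpaceTime → Matrix (Fin 3) (Fin 3) ℝ) (K : Fin 3 → Space → ℝ)
    (q : SpaceTime × Space) :
    ∑ i, (∑ j, (locFlux l ϱ p u S i j q.1 * locDensity l ϱ (q.2, q.1.2)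
          - locMomentum l ϱ u i q.1 * locCurrent l ϱ u j (q.2, q.1.2))
            * partialD j (K i) (q.1.1 - q.2)
        + (locForce l ϱ p u f S i q.1 * locDensity l ϱ (q.2, q.1.2)
          + locMomentum l ϱ u i q.1 * locSource l ϱ u (q.2, q.1.2)) * K i (q.1.1 - q.2))
      = convTerm l ϱ u K q + presTerm l ϱ p K q + errTerm l ϱ p u f S K q := by
  rw [convTerm, presTerm, errTerm, Finset.mul_sum, ← Finset.sum_add_distrib,
    ← Finset.sum_add_distrib]
  refine Finset.sum_congr rfl fun i _ => ?_
  -- The pressure acts on the diagonal only; written as a sum over `j`, it can be compared with the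
  -- flux entry by entry.
  have hp : l q.1 ^ 6 * p q.1 * locDensity l ϱ (q.2, q.1.2) * partialD i (K i) (q.1.1 - q.2)
      = ∑ j, (if i = j then l q.1 ^ 6 * p q.1 * locDensity l ϱ (q.2, q.1.2)
          * partialD j (K i) (q.1.1 - q.2) else 0) := by simp
  rw [hp, add_mul, ← add_assoc, ← add_assoc, ← add_assoc, ← Finset.sum_add_distrib,
    ← Finset.sum_add_distrib]
  congr 2
  refine Finset.sum_congr rfl fun j _ => ?_
  simp only [locFlux, rawFlux, locDensity, locMomentum, locCurrent, locVelocity, PiLp.smul_apply,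
    smul_eq_mul]
  split_ifs <;> ring

section bounds

variable {Ω : Set Space} {T : ℝ} {ϱ p : SpaceTime → ℝ} {u f : SpaceTime → Space}
  {S : SpaceTime → Matrix (Fin 3) (Fin 3) ℝ} {V E A c L : ℝ} {l : SpaceTime → ℝ}
  {χ : ℝ → ℝ} {δ r : ℝ}

/-- The square of the kernel gradient. -/
noncomputable def gradSq (χ : ℝ → ℝ) (r : ℝ) (z : Space) : ℝ :=
  ∑ i, ∑ j, partialD j (kernel χ r i) z ^ 2

lemma IsWeight.measurable_gradSq (hχ : IsWeight χ δ r) : Measurable (gradSq χ r) := by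
  have := fun i j => (hχ.continuous_partialD_kernel i j).measurable
  unfold gradSq; fun_prop

lemma gradSq_nonneg (χ : ℝ → ℝ) (r : ℝ) (z : Space) : 0 ≤ gradSq χ r z := by
  unfold gradSq; positivity

/-- Nine entries, each at most `2/|z|` on the ball, and `∫ |z|⁻² = 3 r` times the unit volume: 108 =
9 · 4 · 3. -/
lemma IsWeight.lintegral_gradSq_le (hχ : IsWeight χ δ r) (x : Space) :
    ∫⁻ y : Space, ENNReal.ofReal (gradSq χ r (x - y))
      ≤ ENNReal.ofReal (108 * unitBallVolume * r) := by
  have hr : 0 < r := hχ.pos.trans hχ.lt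
  rw [lintegral_sub_left_eq_self (fun y => ENNReal.ofReal (gradSq χ r y)) x]
  obtain ⟨hi, he⟩ := integral_ballInd_div_sq hr.le
  have h0 : ∀ z : Space, 0 ≤ 36 * (ballInd r z / ‖z‖ ^ 2) := fun z => by
    have := ballInd_nonneg r z
    positivity
  have e : 108 * unitBallVolume * r = ∫ z : Space, 36 * (ballInd r z / ‖z‖ ^ 2) := by
    rw [integral_const_mul, he]; ring
  rw [e, ofReal_integral_eq_lintegral_ofReal (hi.const_mul 36) (ae_of_all _ h0)]
  refine lintegral_mono_ae ?_
  -- The pointwise bound on the gradient excludes the origin, a null set.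
  have hne : ∀ᵐ z : Space, z ≠ 0 := by
    simp [ae_iff, measure_singleton]
  filter_upwards [hne] with z hz
  refine ENNReal.ofReal_le_ofReal ?_
  have hz' : 0 < ‖z‖ := norm_pos_iff.2 hz
  have hsq : ballInd r z ^ 2 = ballInd r z := by
    rcases lt_or_ge ‖z‖ r with h | h
    · rw [ballInd_of_lt h]; norm_num
    · rw [ballInd_of_le h]; norm_num
  have hterm : ∀ i j, partialD j (kernel χ r i) z ^ 2 ≤ 4 * (ballInd r z / ‖z‖ ^ 2) := by
    intro i j
    have := pow_le_pow_left₀ (abs_nonneg _) (hχ.abs_partialD_kernel_le i j hz) 2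
    rw [sq_abs, mul_pow, hsq] at this
    refine this.trans (le_of_eq ?_)
    field_simp
    ring
  calc gradSq χ r z ≤ ∑ _i : Fin 3, ∑ _j : Fin 3, 4 * (ballInd r z / ‖z‖ ^ 2) :=
        Finset.sum_le_sum fun i _ => Finset.sum_le_sum fun j _ => hterm i j
    _ = 36 * (ballInd r z / ‖z‖ ^ 2) := by simp; ring

lemma gradSq_neg (hχ : IsWeight χ δ r) (z : Space) : gradSq χ r (-z) = gradSq χ r z := by
  simp [gradSq, hχ.partialD_kernel_neg]

/-- Young's inequality for `|S| |DK|`: the part `S²` meets the mass of a small ball, the part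
`|DK|²` has integral `O(r)`. Both are of order `r`. -/
lemma Controlled.abs_stress_term_le (h : Controlled Ω T ϱ p u f S V E A c)
    (hl : CutoffBounds Ω T l L) (hχ : IsWeight χ δ r) (i j : Fin 3) (q : SpaceTime × Space) :
    |l q.1 ^ 6 * S q.1 i j * locDensity l ϱ (q.2, q.1.2)
        * partialD j (kernel χ r i) (q.1.1 - q.2)|
      ≤ L ^ 10 * (majorant Ω T ϱ p u S q.1 * (dens Ω T ϱ (q.2, q.1.2) * ballInd r (q.1.1 - q.2))
        + dens Ω T ϱ (q.2, q.1.2) * partialD j (kernel χ r i) (q.1.1 - q.2) ^ 2) := by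
  have hL := zero_le_one.trans hl.one_le
  have hB := h.dens_nonneg (q.2, q.1.2)
  have hH := h.majorant_nonneg q.1
  have hb := ballInd_nonneg r (q.1.1 - q.2)
  set d := partialD j (kernel χ r i) (q.1.1 - q.2) with hd
  by_cases hz : q.1 ∈ cylinder Ω T
  · have hS2 : S q.1 i j ^ 2 ≤ majorant Ω T ϱ p u S q.1 := by
      rw [majorant_of_mem hz]
      have h0 := h.density_nonneg _ hz
      have h1 := h.pressure_nonneg _ hz
      have h2 := sq_le_sum_sq (S q.1) i j
      have h3 : 0 ≤ ϱ q.1 * ‖u q.1‖ ^ 2 := by positivity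
      linarith
    have hdS : |S q.1 i j * d| ≤ majorant Ω T ϱ p u S q.1 * ballInd r (q.1.1 - q.2) + d ^ 2 := by
      rcases lt_or_ge ‖q.1.1 - q.2‖ r with hr | hr
      · rw [ballInd_of_lt hr, abs_mul]
        nlinarith [sq_nonneg (|S q.1 i j| - |d|), sq_abs (S q.1 i j), sq_abs d]
      · rw [hd, hχ.partialD_kernel_of_ge i j hr, ballInd_of_le hr]; simp
    have h2 : |locDensity l ϱ (q.2, q.1.2)| ≤ L ^ 4 * dens Ω T ϱ (q.2, q.1.2) := by
      rw [abs_of_nonneg (h.locDensity_nonneg hl _)]; exact h.locDensity_le hl _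
    have e : l q.1 ^ 6 * S q.1 i j * locDensity l ϱ (q.2, q.1.2) * d
        = l q.1 ^ 6 * ((S q.1 i j * d) * locDensity l ϱ (q.2, q.1.2)) := by ring
    rw [e]
    refine (abs_pow_mul_le (y := (majorant Ω T ϱ p u S q.1 * ballInd r (q.1.1 - q.2) + d ^ 2)
      * (L ^ 4 * dens Ω T ϱ (q.2, q.1.2))) (hl.nonneg _) (hl.le _) ?_).trans (le_of_eq (by ring))
    rw [abs_mul]
    exact mul_le_mul hdS h2 (abs_nonneg _) (by positivity)
  · rw [hl.eq_zero _ hz]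
    simp only [ne_eq, OfNat.ofNat_ne_zero, not_false_eq_true, zero_pow, zero_mul, abs_zero]
    positivity

/-- The Lipschitz bound of `l` absorbs the singularity `1/|z|` of the kernel gradient. The remaining
`2|u(x)||u(y)|` is split so that each kinetic density is paired with the density at the other point
inside the ball. -/
lemma Controlled.abs_commutator_term_le (h : Controlled Ω T ϱ p u f S V E A c)
    (hl : CutoffBounds Ω T l L) (hχ : IsWeight χ δ r) (i j : Fin 3) (q : SpaceTime × Space) :
    |l q.1 ^ 5 * (ϱ q.1 * u q.1 i) * (l q.1 - l (q.2, q.1.2))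
        * locCurrent l ϱ u j (q.2, q.1.2) * partialD j (kernel χ r i) (q.1.1 - q.2)|
      ≤ L ^ 10 * (majorant Ω T ϱ p u S q.1 * (dens Ω T ϱ (q.2, q.1.2) * ballInd r (q.1.1 - q.2))
        + kin Ω T ϱ u (q.2, q.1.2) * (dens Ω T ϱ q.1 * ballInd r (q.1.1 - q.2))) := by
  have hL := zero_le_one.trans hl.one_le
  have hB := h.dens_nonneg (q.2, q.1.2)
  have hB' := h.dens_nonneg q.1
  have hJ := h.kin_nonneg (q.2, q.1.2)
  have hH := h.majorant_nonneg q.1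
  have hb := ballInd_nonneg r (q.1.1 - q.2)
  set d := partialD j (kernel χ r i) (q.1.1 - q.2) with hd
  by_cases hz : q.1 ∈ cylinder Ω T
  swap
  · rw [hl.eq_zero _ hz]
    simp only [ne_eq, OfNat.ofNat_ne_zero, not_false_eq_true, zero_pow, zero_mul, abs_zero]
    positivity
  by_cases hz' : (q.2, q.1.2) ∈ cylinder Ω T
  swap
  · rw [locCurrent, hl.eq_zero _ hz']
    simp only [ne_eq, OfNat.ofNat_ne_zero, not_false_eq_true, zero_pow, zero_mul, mul_zero,
      abs_zero]
    positivity
  have hr0 := h.density_nonneg _ hz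
  have hr1 := h.density_nonneg _ hz'
  have hkin : ϱ q.1 * ‖u q.1‖ ^ 2 ≤ majorant Ω T ϱ p u S q.1 := by
    have := h.density_le_majorant hz
    have := h.pressure_nonneg _ hz
    linarith
  have e1 : dens Ω T ϱ (q.2, q.1.2) = ϱ (q.2, q.1.2) := indicator_of_mem hz' _
  have e2 : dens Ω T ϱ q.1 = ϱ q.1 := indicator_of_mem hz _
  have e3 : kin Ω T ϱ u (q.2, q.1.2) = ϱ (q.2, q.1.2) * ‖u (q.2, q.1.2)‖ ^ 2 :=
    indicator_of_mem hz' _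
  have a1 : |l q.1 ^ 5 * (ϱ q.1 * u q.1 i)| ≤ L ^ 5 * (ϱ q.1 * ‖u q.1‖) := by
    refine abs_pow_mul_le (hl.nonneg _) (hl.le _) ?_
    rw [abs_mul, abs_of_nonneg hr0]
    exact mul_le_mul_of_nonneg_left (abs_coord_le _ _) hr0
  have a2 : |locCurrent l ϱ u j (q.2, q.1.2)|
      ≤ L ^ 4 * (ϱ (q.2, q.1.2) * ‖u (q.2, q.1.2)‖) := by
    refine abs_pow_mul_le (hl.nonneg _) (hl.le _) ?_
    rw [abs_mul, abs_of_nonneg hr1]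
    exact mul_le_mul_of_nonneg_left (abs_coord_le _ _) hr1
  have a3 : |(l q.1 - l (q.2, q.1.2)) * d| ≤ L * (2 * ballInd r (q.1.1 - q.2)) := by
    rw [abs_mul]
    have h1 := hl.lipschitz q.1.1 q.2 q.1.2
    have h2 := hχ.abs_partialD_kernel_mul_le i j (q.1.1 - q.2)
    calc _ ≤ L * ‖q.1.1 - q.2‖ * |d| := mul_le_mul_of_nonneg_right h1 (abs_nonneg _)
      _ = L * (|d| * ‖q.1.1 - q.2‖) := by ring
      _ ≤ _ := mul_le_mul_of_nonneg_left h2 hL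
  have e : l q.1 ^ 5 * (ϱ q.1 * u q.1 i) * (l q.1 - l (q.2, q.1.2))
        * locCurrent l ϱ u j (q.2, q.1.2) * d
      = l q.1 ^ 5 * (ϱ q.1 * u q.1 i) * locCurrent l ϱ u j (q.2, q.1.2)
        * ((l q.1 - l (q.2, q.1.2)) * d) := by ring
  rw [e, abs_mul, abs_mul, e1, e2, e3]
  calc _ ≤ L ^ 5 * (ϱ q.1 * ‖u q.1‖) * (L ^ 4 * (ϱ (q.2, q.1.2) * ‖u (q.2, q.1.2)‖))
        * (L * (2 * ballInd r (q.1.1 - q.2))) := by gcongr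
    _ = L ^ 10 * ((ϱ q.1 * ϱ (q.2, q.1.2)) * (2 * ‖u q.1‖ * ‖u (q.2, q.1.2)‖)
        * ballInd r (q.1.1 - q.2)) := by ring
    _ ≤ L ^ 10 * ((ϱ q.1 * ϱ (q.2, q.1.2)) * (‖u q.1‖ ^ 2 + ‖u (q.2, q.1.2)‖ ^ 2)
        * ballInd r (q.1.1 - q.2)) := by
        gcongr
        exact two_mul_le_add_sq _ _
    _ = L ^ 10 * ((ϱ q.1 * ‖u q.1‖ ^ 2) * (ϱ (q.2, q.1.2) * ballInd r (q.1.1 - q.2))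
        + ϱ (q.2, q.1.2) * ‖u (q.2, q.1.2)‖ ^ 2 * (ϱ q.1 * ballInd r (q.1.1 - q.2))) := by ring
    _ ≤ _ := by gcongr

/-- The majorant of the error, `a` being a free parameter. -/
noncomputable def errBound (Ω : Set Space) (T : ℝ) (ϱ p : SpaceTime → ℝ) (u : SpaceTime → Space)
    (S : SpaceTime → Matrix (Fin 3) (Fin 3) ℝ) (c a : ℝ) (χ : ℝ → ℝ) (r : ℝ)
    (q : SpaceTime × Space) : ℝ :=
  -- There are nine stress and nine commutator terms and three components of force and source: 90 +
  -- 3c = 9 + 9 + 3(24 + c) and 48 = 3 · 16.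
  (90 + 3 * c + 48 * a)
      * (majorant Ω T ϱ p u S q.1 * (dens Ω T ϱ (q.2, q.1.2) * ballInd r (q.1.1 - q.2)))
    + 9 * (kin Ω T ϱ u (q.2, q.1.2) * (dens Ω T ϱ q.1 * ballInd r (q.2 - q.1.1)))
    + dens Ω T ϱ (q.2, q.1.2) * (1 * gradSq χ r (q.2 - q.1.1))
    + 48 * a⁻¹ * (majorant Ω T ϱ p u S q.1 * kin Ω T ϱ u (q.2, q.1.2))

/-- Only the kernel bounds that are uniform in `δ` are used, so the estimate survives the limit `δ →
0`. -/
lemma Controlled.abs_errTerm_le (h : Controlled Ω T ϱ p u f S V E A c)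
    (hl : CutoffBounds Ω T l L) (hχ : IsWeight χ δ r) {a : ℝ} (ha : 1 ≤ a) :
    ∀ᵐ q : SpaceTime × Space, |errTerm l ϱ p u f S (kernel χ r) q|
      ≤ L ^ 10 * errBound Ω T ϱ p u S c a χ r q := by
  have hf : ∀ᵐ q : SpaceTime × Space, ∀ i, |locForce l ϱ p u f S i q.1|
      ≤ (24 + c) * L ^ 6 * majorant Ω T ϱ p u S q.1 :=
    ae_all_iff.2 fun i => Measure.quasiMeasurePreserving_fst.ae (h.abs_locForce_le hl i)
  filter_upwards [hf] with q hq
  have hL := zero_le_one.trans hl.one_le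
  have ha0 : 0 < a := zero_lt_one.trans_le ha
  have hc := h.c_nonneg
  have hB := h.dens_nonneg (q.2, q.1.2)
  have hJ := h.kin_nonneg (q.2, q.1.2)
  have hH := h.majorant_nonneg q.1
  have hb := ballInd_nonneg r (q.1.1 - q.2)
  have hb1 := ballInd_le_one r (q.1.1 - q.2)
  have hρ : |locDensity l ϱ (q.2, q.1.2)| ≤ L ^ 4 * dens Ω T ϱ (q.2, q.1.2) := by
    rw [abs_of_nonneg (h.locDensity_nonneg hl _)]; exact h.locDensity_le hl _
  have t1 := fun i j => h.abs_stress_term_le hl hχ i j q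
  have t2 := fun i j => h.abs_commutator_term_le hl hχ i j q
  have t3 : ∀ i, |locForce l ϱ p u f S i q.1 * locDensity l ϱ (q.2, q.1.2)
      * kernel χ r i (q.1.1 - q.2)| ≤ L ^ 10 * ((24 + c)
      * (majorant Ω T ϱ p u S q.1 * (dens Ω T ϱ (q.2, q.1.2) * ballInd r (q.1.1 - q.2)))) := by
    intro i
    rw [abs_mul, abs_mul]
    calc _ ≤ (24 + c) * L ^ 6 * majorant Ω T ϱ p u S q.1 * (L ^ 4 * dens Ω T ϱ (q.2, q.1.2))
          * ballInd r (q.1.1 - q.2) := by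
          gcongr
          · exact hq i
          · exact hχ.abs_kernel_le i _
      _ = _ := by ring
  have t4 : ∀ i, |locMomentum l ϱ u i q.1 * locSource l ϱ u (q.2, q.1.2)
      * kernel χ r i (q.1.1 - q.2)| ≤ L ^ 10 * (16 * a
      * (majorant Ω T ϱ p u S q.1 * (dens Ω T ϱ (q.2, q.1.2) * ballInd r (q.1.1 - q.2)))
      + 16 * a⁻¹ * (majorant Ω T ϱ p u S q.1 * kin Ω T ϱ u (q.2, q.1.2))) := by
    intro i
    rw [abs_mul, abs_mul]
    calc _ ≤ L ^ 6 * majorant Ω T ϱ p u S q.1 * (16 * L ^ 4 *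
          (a * dens Ω T ϱ (q.2, q.1.2) + a⁻¹ * kin Ω T ϱ u (q.2, q.1.2)))
          * ballInd r (q.1.1 - q.2) := by
          gcongr
          · exact h.abs_locMomentum_le hl i _
          · exact h.abs_locSource_le hl _ ha
          · exact hχ.abs_kernel_le i _
      _ = L ^ 10 * (16 * a * (majorant Ω T ϱ p u S q.1
            * (dens Ω T ϱ (q.2, q.1.2) * ballInd r (q.1.1 - q.2)))
          + 16 * a⁻¹ * (majorant Ω T ϱ p u S q.1 * kin Ω T ϱ u (q.2, q.1.2))
            * ballInd r (q.1.1 - q.2)) := by ring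
      _ ≤ _ := by
          refine mul_le_mul_of_nonneg_left (add_le_add le_rfl ?_) (by positivity)
          exact mul_le_of_le_one_right (by positivity) hb1
  have e1 : ballInd r (q.2 - q.1.1) = ballInd r (q.1.1 - q.2) := by
    rw [← ballInd_neg, neg_sub]
  have e2 : gradSq χ r (q.2 - q.1.1) = gradSq χ r (q.1.1 - q.2) := by
    rw [← gradSq_neg hχ, neg_sub]
  calc |errTerm l ϱ p u f S (kernel χ r) q|
      ≤ ∑ i, (∑ j, (L ^ 10 * (majorant Ω T ϱ p u S q.1
            * (dens Ω T ϱ (q.2, q.1.2) * ballInd r (q.1.1 - q.2))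
          + dens Ω T ϱ (q.2, q.1.2) * partialD j (kernel χ r i) (q.1.1 - q.2) ^ 2)
        + L ^ 10 * (majorant Ω T ϱ p u S q.1
            * (dens Ω T ϱ (q.2, q.1.2) * ballInd r (q.1.1 - q.2))
          + kin Ω T ϱ u (q.2, q.1.2) * (dens Ω T ϱ q.1 * ballInd r (q.1.1 - q.2))))
        + (L ^ 10 * ((24 + c) * (majorant Ω T ϱ p u S q.1
            * (dens Ω T ϱ (q.2, q.1.2) * ballInd r (q.1.1 - q.2))))
          + L ^ 10 * (16 * a * (majorant Ω T ϱ p u S q.1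
            * (dens Ω T ϱ (q.2, q.1.2) * ballInd r (q.1.1 - q.2)))
          + 16 * a⁻¹ * (majorant Ω T ϱ p u S q.1 * kin Ω T ϱ u (q.2, q.1.2))))) := by
        refine (Finset.abs_sum_le_sum_abs _ _).trans (Finset.sum_le_sum fun i _ => ?_)
        refine (abs_add_le _ _).trans (add_le_add ?_ ?_)
        · refine (Finset.abs_sum_le_sum_abs _ _).trans (Finset.sum_le_sum fun j _ => ?_)
          refine (abs_sub _ _).trans (add_le_add ?_ (t2 i j))
          rw [abs_neg]
          exact t1 i j
        · exact (abs_add_le _ _).trans (add_le_add (t3 i) (t4 i))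
    _ = L ^ 10 * errBound Ω T ϱ p u S c a χ r q := by
        rw [errBound, e1, e2, gradSq]
        simp only [Fin.sum_univ_three]
        ring

/-- With `a = r^{-1/2}`, both `a · O(r)` and `a⁻¹ · O(1)` are `O(√r)`; the other terms are `O(r)`,
and `r ≤ √r`. The constant 147 is 90 + 9 + 48. -/
lemma Controlled.errBound_integral_le (h : Controlled Ω T ϱ p u f S V E A c)
    (hχ : IsWeight χ δ r) (hr1 : r ≤ 1) :
    Integrable (errBound Ω T ϱ p u S c (√r)⁻¹ χ r) ∧
    ∫ q, errBound Ω T ϱ p u S c (√r)⁻¹ χ r q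
      ≤ A * ((147 + 3 * c) * (E + unitBallVolume) + 108 * unitBallVolume + 48 * E) * √r := by
  have hr : 0 < r := hχ.pos.trans hχ.lt
  have hA := h.A_nonneg
  have hE := h.E_nonneg
  have hc := h.c_nonneg
  have hV1 := unitBallVolume_nonneg
  have hs : 0 < √r := Real.sqrt_pos.2 hr
  have hss : √r * √r = r := Real.mul_self_sqrt hr.le
  have hs1 : √r ≤ 1 := Real.sqrt_le_one.2 hr1
  have hrs : r ≤ √r := by nlinarith
  obtain ⟨i1, b1⟩ := h.pair_dens_ball hr h.integrable_majorant h.majorant_nonneg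
  obtain ⟨i2, b2⟩ := h.pair_dens_ball hr h.integrable_kin h.kin_nonneg
  obtain ⟨i4, b4⟩ := h.pair_kin h.integrable_majorant h.majorant_nonneg
  obtain ⟨i3, b3⟩ := pair_bound (Y := fun _ => 1) (κ := gradSq χ r)
    (B := 108 * unitBallVolume * r) h.integrable_dens h.dens_nonneg measurable_const
    hχ.measurable_gradSq (fun z x => by simpa using gradSq_nonneg χ r x) (by positivity)
    (ae_of_all _ fun t x => by simpa using hχ.lintegral_gradSq_le x)
  -- Two terms carry their integrable factor at `y`; exchanging the points brings them from the form
  -- given by `pair_bound` to that of `errBound`.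
  have i2' := integrable_swapPoints i2
  have i3' := integrable_swapPoints i3
  rw [← integral_swapPoints] at b2 b3
  simp only at i2' i3' b2 b3
  have j1 := i1.const_mul (90 + 3 * c + 48 * (√r)⁻¹)
  have j2 := i2'.const_mul 9
  have j4 := i4.const_mul (48 * ((√r)⁻¹)⁻¹)
  refine ⟨((j1.add j2).add i3').add j4, ?_⟩
  have e : ∫ q, errBound Ω T ϱ p u S c (√r)⁻¹ χ r q = _ :=
    (integral_add ((j1.add j2).add i3') j4).trans
      (congrArg₂ (· + ·) ((integral_add (j1.add j2) i3').trans
        (congrArg₂ (· + ·) (integral_add j1 j2) rfl)) rfl)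
  rw [e, integral_const_mul, integral_const_mul, integral_const_mul, inv_inv]
  have c1 := h.integral_majorant_le
  have c2 := h.integral_dens_le
  have c3 := h.integral_kin_le
  have k1 := b1.trans (mul_le_mul_of_nonneg_right c1 (by positivity))
  have k2 := b2.trans (mul_le_mul_of_nonneg_right c3 (by positivity))
  have k3 := b3.trans (mul_le_mul_of_nonneg_right c2 (by positivity))
  have k4 := b4.trans (mul_le_mul_of_nonneg_right c1 (by positivity))
  have e5 : (√r)⁻¹ * r = √r := by
    rw [inv_mul_eq_div, div_eq_iff hs.ne', hss]
  calc _ ≤ (90 + 3 * c + 48 * (√r)⁻¹) * (A * ((E + unitBallVolume) * r))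
        + 9 * (A * ((E + unitBallVolume) * r)) + A * (108 * unitBallVolume * r)
        + 48 * √r * (A * E) := by gcongr
    _ = (99 + 3 * c) * (A * (E + unitBallVolume)) * r
        + 48 * (A * (E + unitBallVolume)) * ((√r)⁻¹ * r)
        + A * (108 * unitBallVolume) * r + 48 * (A * E) * √r := by ring
    _ ≤ (99 + 3 * c) * (A * (E + unitBallVolume)) * √r
        + 48 * (A * (E + unitBallVolume)) * √r
        + A * (108 * unitBallVolume) * √r + 48 * (A * E) * √r := by
        rw [e5]; gcongr
    _ = _ := by ring

end bounds

/-! ### Symmetrization and the weighted identity -/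

/-- The integrand of `pairEnergy` on triples `((x, t), y)`. -/
noncomputable def pairDensity (ρ : SpaceTime → ℝ) (e : Space → Space → ℝ → ℝ)
    (q : SpaceTime × Space) : ℝ :=
  ρ q.1 * (ρ (q.2, q.1.2) * e q.1.1 q.2 q.1.2)

section bounds

variable {Ω : Set Space} {T : ℝ} {ϱ p P : SpaceTime → ℝ} {u f : SpaceTime → Space}
  {S : SpaceTime → Matrix (Fin 3) (Fin 3) ℝ} {V E A c L : ℝ} {l : SpaceTime → ℝ}
  {χ : ℝ → ℝ} {δ r : ℝ}

lemma abs_density_coord_coord_le {r : ℝ} (hr : 0 ≤ r) (a : Space) (i j : Fin 3) :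
    |r * (a i * a j)| ≤ r * ‖a‖ ^ 2 := by
  rw [abs_mul, abs_of_nonneg hr, abs_mul, sq]
  gcongr <;> exact abs_coord_le _ _

lemma Controlled.locDensity_mul_norm_sq_le (h : Controlled Ω T ϱ p u f S V E A c)
    (hl : CutoffBounds Ω T l L) (z : SpaceTime) :
    locDensity l ϱ z * ‖locVelocity l u z‖ ^ 2 ≤ L ^ 6 * kin Ω T ϱ u z := by
  have e : locDensity l ϱ z * ‖locVelocity l u z‖ ^ 2 = l z ^ 6 * (ϱ z * ‖u z‖ ^ 2) := by
    rw [locDensity, locVelocity, norm_smul, Real.norm_of_nonneg (hl.nonneg z)]; ring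
  rw [e]
  by_cases hz : z ∈ cylinder Ω T
  · rw [kin, indicator_of_mem hz]
    have := h.density_nonneg z hz
    exact mul_le_mul_of_nonneg_right (hl.pow_le 6 z) (by positivity)
  · simp [kin, hl.eq_zero z hz, hz]

lemma Controlled.abs_vmom_le (h : Controlled Ω T ϱ p u f S V E A c)
    (hl : CutoffBounds Ω T l L) (i : Fin 3) (z : SpaceTime) :
    |locDensity l ϱ z * locVelocity l u z i| ≤ L ^ 5 * (dens Ω T ϱ z + kin Ω T ϱ u z) := by
  have e : locDensity l ϱ z * locVelocity l u z i = l z ^ 5 * (ϱ z * u z i) := by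
    simp only [locDensity, locVelocity, PiLp.smul_apply, smul_eq_mul]; ring
  rw [e]
  by_cases hz : z ∈ cylinder Ω T
  · have := h.abs_density_mul_le_young hz i one_pos
    exact abs_pow_mul_le (hl.nonneg z) (hl.le z) (by simpa using this)
  · simp [dens, kin, hl.eq_zero z hz, hz]

lemma measurable_locVelocity {l : SpaceTime → ℝ} {u : SpaceTime → Space} (hl : Measurable l)
    (hu : Measurable u) : Measurable (locVelocity l u) := by
  unfold locVelocity; fun_prop

lemma Controlled.integrable_convTerm (h : Controlled Ω T ϱ p u f S V E A c)
    (hl : CutoffBounds Ω T l L) (hχ : IsWeight χ δ r) :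
    Integrable (convTerm l ϱ u (kernel χ r)) := by
  have hL := zero_le_one.trans hl.one_le
  have hV := h.V_nonneg
  have hE := h.E_nonneg
  obtain ⟨N, -, hN⟩ := hχ.exists_bound
  have m1 := h.measurable_locDensity hl
  have hv : ∀ i, Measurable fun z => locVelocity l u z i := fun i => by
    have h1 := hl.measurable
    have h2 := h.measurable_velocity
    simp only [locVelocity, PiLp.smul_apply, smul_eq_mul]
    fun_prop
  have b1 : ∀ z, |locDensity l ϱ z| ≤ L ^ 4 * (dens Ω T ϱ z + kin Ω T ϱ u z) := fun z => by
    rw [abs_of_nonneg (h.locDensity_nonneg hl z)]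
    have := h.locDensity_le hl z
    have := mul_nonneg (pow_nonneg hL 4) (h.kin_nonneg z)
    linarith
  refine integrable_finsetSum _ fun i _ => integrable_finsetSum _ fun j _ => ?_
  have b2 : ∀ z, |locDensity l ϱ z * (locVelocity l u z i * locVelocity l u z j)|
      ≤ L ^ 6 * (dens Ω T ϱ z + kin Ω T ϱ u z) := fun z => by
    have h1 := abs_density_coord_coord_le (h.locDensity_nonneg hl z) (locVelocity l u z) i j
    have h2 := h.locDensity_mul_norm_sq_le hl z
    have h3 := mul_nonneg (pow_nonneg hL 6) (h.dens_nonneg z)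
    linarith
  have i1 : Integrable fun z => locDensity l ϱ z * (locVelocity l u z i * locVelocity l u z j) :=
    h.integrable_of_le_dens (K := L ^ 6) (m1.mul ((hv i).mul (hv j))) b2
  have i2 : Integrable fun z => locDensity l ϱ z * locVelocity l u z i :=
    h.integrable_of_le_dens (m1.mul (hv i)) (h.abs_vmom_le hl i)
  have hm := (hχ.continuous_partialD_kernel i j).measurable
  have k1 := integrable_pair i1 m1 (by positivity)
    (h.slice_of_le (by positivity : 0 ≤ L ^ 4) b1) hm (hN i j)
  have k2 := integrable_pair (b := fun z => locDensity l ϱ z * locVelocity l u z j) i2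
    (m1.mul (hv j)) (by positivity)
    (h.slice_of_le (by positivity : 0 ≤ L ^ 5) (h.abs_vmom_le hl j)) hm (hN i j)
  refine (k1.sub k2).congr (ae_of_all _ fun q => ?_)
  simp only [Pi.sub_apply]
  ring

lemma Controlled.abs_pow_mul_pressure_le (h : Controlled Ω T ϱ p u f S V E A c)
    (hl : CutoffBounds Ω T l L) (z : SpaceTime) :
    |l z ^ 6 * p z| ≤ L ^ 6 * majorant Ω T ϱ p u S z := by
  by_cases hz : z ∈ cylinder Ω T
  · refine abs_pow_mul_le (hl.nonneg z) (hl.le z) ?_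
    rw [abs_of_nonneg (h.pressure_nonneg z hz)]
    have := h.density_le_majorant hz
    have := h.density_nonneg z hz
    have : 0 ≤ ϱ z * ‖u z‖ ^ 2 := by positivity
    linarith
  · simp [majorant, hl.eq_zero z hz, hz]

lemma Controlled.integrable_presTerm (h : Controlled Ω T ϱ p u f S V E A c)
    (hl : CutoffBounds Ω T l L) (hχ : IsWeight χ δ r) :
    Integrable (presTerm l ϱ p (kernel χ r)) := by
  have hL := zero_le_one.trans hl.one_le
  have hV := h.V_nonneg
  have hE := h.E_nonneg
  obtain ⟨N, -, hN⟩ := hχ.exists_bound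
  have m1 := h.measurable_locDensity hl
  have m2 := h.measurable_pressure
  have m3 := hl.measurable
  have hm := fun i => (hχ.continuous_partialD_kernel i i).measurable
  have b1 : ∀ z, |locDensity l ϱ z| ≤ L ^ 4 * (dens Ω T ϱ z + kin Ω T ϱ u z) := fun z => by
    rw [abs_of_nonneg (h.locDensity_nonneg hl z)]
    have := h.locDensity_le hl z
    have := mul_nonneg (pow_nonneg hL 4) (h.kin_nonneg z)
    linarith
  refine integrable_pair (κ := fun z => ∑ i, partialD i (kernel χ r i) z) (M := 3 * N)
    (h.integrable_of_le (by fun_prop) (ae_of_all _ (h.abs_pow_mul_pressure_le hl))) m1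
    (by positivity) (h.slice_of_le (by positivity : 0 ≤ L ^ 4) b1) (by fun_prop) fun z => ?_
  calc |∑ i, partialD i (kernel χ r i) z| ≤ ∑ _i : Fin 3, N :=
        (Finset.abs_sum_le_sum_abs _ _).trans (Finset.sum_le_sum fun i _ => hN i i z)
    _ = 3 * N := by simp

lemma Controlled.integrable_errTerm (h : Controlled Ω T ϱ p u f S V E A c)
    (hl : CutoffBounds Ω T l L) (hχ : IsWeight χ δ r) (hr1 : r ≤ 1) :
    Integrable (errTerm l ϱ p u f S (kernel χ r)) ∧
    |∫ q, errTerm l ϱ p u f S (kernel χ r) q| ≤ L ^ 10 * (A * ((147 + 3 * c)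
      * (E + unitBallVolume) + 108 * unitBallVolume + 48 * E) * √r) := by
  have hr : 0 < r := hχ.pos.trans hχ.lt
  have hs : 0 < √r := Real.sqrt_pos.2 hr
  have hs1 : 1 ≤ (√r)⁻¹ := (one_le_inv₀ hs).2 (Real.sqrt_le_one.2 hr1)
  have hL := zero_le_one.trans hl.one_le
  obtain ⟨hi, hb⟩ := h.errBound_integral_le hχ hr1
  have hle := h.abs_errTerm_le hl hχ hs1
  have m1 := h.measurable_locDensity hl
  have m2 := h.measurable_locMomentum hl
  have m3 := h.measurable_locCurrent hl
  have m4 := h.measurable_locForce hl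
  have m5 := h.measurable_locSource hl
  have m6 := hl.measurable
  have m7 := h.measurable_density
  have m8 := h.measurable_velocity
  have m9 := h.measurable_stress
  have k1 := fun i j => (hχ.continuous_partialD_kernel i j).measurable
  have k2 := fun i => (hχ.contDiff_kernel i).continuous.measurable
  have hmeas : Measurable (errTerm l ϱ p u f S (kernel χ r)) := by
    unfold errTerm
    refine Finset.measurable_sum _ fun i _ => Measurable.add
      (Finset.measurable_sum _ fun j _ => ?_) ?_
    · have := m9 i j
      fun_prop
    · fun_prop
  refine ⟨(hi.const_mul (L ^ 10)).mono' hmeas.aestronglyMeasurable hle, ?_⟩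
  have := norm_integral_le_of_norm_le (f := errTerm l ϱ p u f S (kernel χ r))
    (hi.const_mul (L ^ 10)) hle
  rw [integral_const_mul] at this
  exact this.trans (mul_le_mul_of_nonneg_left hb (by positivity))

/-- Here the powers 4 and 6 of the cut-off fit together: `l⁶ ϱ^{3/2} = (l⁴ ϱ)^{3/2}`. Outside the
cylinder both sides vanish. -/
lemma Controlled.pressure_eq (h : Controlled Ω T ϱ p u f S V E A c) (hl : CutoffBounds Ω T l L)
    (hP : ∀ z, p z = ϱ z ^ (3 / 2 : ℝ) * P z) (z : SpaceTime) :
    l z ^ 6 * p z = locDensity l ϱ z * (locDensity l ϱ z ^ (1 / 2 : ℝ) * P z) := by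
  by_cases hz : z ∈ cylinder Ω T
  · have h0 := h.density_nonneg z hz
    have hl0 := hl.nonneg z
    have e1 : ϱ z ^ (3 / 2 : ℝ) = ϱ z * √(ϱ z) := by
      rw [Real.sqrt_eq_rpow, ← Real.rpow_one_add' h0 (by norm_num)]; norm_num
    have e2 : √(l z ^ 4 * ϱ z) = l z ^ 2 * √(ϱ z) := by
      rw [Real.sqrt_mul (by positivity), show l z ^ 4 = (l z ^ 2) ^ 2 by ring,
        Real.sqrt_sq (by positivity)]
    rw [hP, e1, ← Real.sqrt_eq_rpow, locDensity, e2]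
    ring
  · simp [locDensity, hl.eq_zero z hz]

/-- The kernel gradient is even, so the exchange adds `v_i(y)(v_j(y) - v_j(x))` to `v_i(x)(v_j(x) -
v_j(y))`, and the sum is `w_i w_j` for `w = v(x) - v(y)`. The pressure is left as it is, since both
energies evaluate it at `x`. -/
lemma symmetrized_integrand (hχ : IsWeight χ δ r) (l ϱ p P : SpaceTime → ℝ)
    (u : SpaceTime → Space)
    (hP : ∀ z, l z ^ 6 * p z = locDensity l ϱ z * (locDensity l ϱ z ^ (1 / 2 : ℝ) * P z))
    (q : SpaceTime × Space) :
    1 / 2 * (convTerm l ϱ u (kernel χ r) q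
        + convTerm l ϱ u (kernel χ r) ((q.2, q.1.2), q.1.1)) + presTerm l ϱ p (kernel χ r) q
      = pairDensity (locDensity l ϱ) (energyPerp (locDensity l ϱ) (locVelocity l u) P) q
          * profile χ r ‖q.1.1 - q.2‖
        + pairDensity (locDensity l ϱ) (energyPar (locDensity l ϱ) (locVelocity l u) P) q
          * (profile χ r ‖q.1.1 - q.2‖ - χ ‖q.1.1 - q.2‖ / ‖q.1.1 - q.2‖) := by
  have e1 : convTerm l ϱ u (kernel χ r) q + convTerm l ϱ u (kernel χ r) ((q.2, q.1.2), q.1.1)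
      = locDensity l ϱ q.1 * locDensity l ϱ (q.2, q.1.2) *
        (profile χ r ‖q.1.1 - q.2‖
          * ‖projPerp (q.1.1 - q.2) (locVelocity l u q.1 - locVelocity l u (q.2, q.1.2))‖ ^ 2
        + (profile χ r ‖q.1.1 - q.2‖ - χ ‖q.1.1 - q.2‖ / ‖q.1.1 - q.2‖)
          * ‖projPar (q.1.1 - q.2) (locVelocity l u q.1 - locVelocity l u (q.2, q.1.2))‖ ^ 2) := by
    rw [← hχ.sum_sum_partialD_kernel, convTerm, convTerm, ← Finset.sum_add_distrib, Finset.mul_sum]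
    refine Finset.sum_congr rfl fun i _ => ?_
    rw [← Finset.sum_add_distrib, Finset.mul_sum]
    refine Finset.sum_congr rfl fun j _ => ?_
    have e : partialD j (kernel χ r i) (q.2 - q.1.1) = partialD j (kernel χ r i) (q.1.1 - q.2) := by
      rw [← hχ.partialD_kernel_neg, neg_sub]
    simp only [e, PiLp.sub_apply]
    ring
  rw [e1, presTerm, hχ.sum_partialD_kernel, hP]
  simp only [pairDensity, energyPerp, energyPar]
  ring

/-- The regularized form of the identity `W - Γ = error`. -/
theorem Controlled.weighted_bound (h : Controlled Ω T ϱ p u f S V E A c)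
    (hl : CutoffBounds Ω T l L) (hχ : IsWeight χ δ r) (hr1 : r ≤ 1)
    (hP : ∀ z, p z = ϱ z ^ (3 / 2 : ℝ) * P z)
    (hmass : IsBalance (locDensity l ϱ) (locSource l ϱ u) (locCurrent l ϱ u))
    (hmom : ∀ i, IsBalance (locMomentum l ϱ u i) (locForce l ϱ p u f S i)
      (locFlux l ϱ p u S i)) :
    |∫ q, (pairDensity (locDensity l ϱ) (energyPerp (locDensity l ϱ) (locVelocity l u) P) q
          * profile χ r ‖q.1.1 - q.2‖
        + pairDensity (locDensity l ϱ) (energyPar (locDensity l ϱ) (locVelocity l u) P) q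
          * (profile χ r ‖q.1.1 - q.2‖ - χ ‖q.1.1 - q.2‖ / ‖q.1.1 - q.2‖))|
      ≤ L ^ 10 * (A * ((147 + 3 * c)
        * (E + unitBallVolume) + 108 * unitBallVolume + 48 * E) * √r) := by
  obtain ⟨N, hN, hN'⟩ := hχ.exists_bound
  obtain ⟨hierr, herr⟩ := h.integrable_errTerm hl hχ hr1
  have hconv := h.integrable_convTerm hl hχ
  have hpres := h.integrable_presTerm hl hχ
  have hconv' := integrable_swapPoints hconv
  have hid := fun i => h.localized_identity hl hmass hmom i (hχ.contDiff_kernel i) (hN i) (hN' i)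
  have htot : ∫ q, (convTerm l ϱ u (kernel χ r) q + presTerm l ϱ p (kernel χ r) q
      + errTerm l ϱ p u f S (kernel χ r) q) = 0 := by
    simp_rw [← sum_identity_integrand]
    rw [integral_finsetSum _ fun i _ => (hid i).1]
    exact Finset.sum_eq_zero fun i _ => (hid i).2
  have hcp : Integrable fun q => convTerm l ϱ u (kernel χ r) q + presTerm l ϱ p (kernel χ r) q :=
    hconv.add hpres
  rw [integral_add hcp hierr, integral_add hconv hpres] at htot
  have hcc : Integrable fun q : SpaceTime × Space => 1 / 2 * (convTerm l ϱ u (kernel χ r) q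
        + convTerm l ϱ u (kernel χ r) ((q.2, q.1.2), q.1.1)) := (hconv.add hconv').const_mul _
  simp_rw [← symmetrized_integrand hχ l ϱ p P u (h.pressure_eq hl hP)]
  rw [integral_add hcc hpres, integral_const_mul, integral_add hconv hconv',
    integral_swapPoints (convTerm l ϱ u (kernel χ r))]
  -- The exchange preserves the integral, so the symmetrized convective part has the integral of the
  -- original one.
  have e : 1 / 2 * ((∫ q, convTerm l ϱ u (kernel χ r) q) + ∫ q, convTerm l ϱ u (kernel χ r) q)
      + ∫ q, presTerm l ϱ p (kernel χ r) q = -∫ q, errTerm l ϱ p u f S (kernel χ r) q := by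
    linarith
  rw [e, abs_neg]
  exact herr

/-- One statement for both energies: either projection is a contraction, and `k` is 2 for the
transversal energy, 1 for the longitudinal one. The majorant is a sum of products of functions of
one point each. -/
lemma Controlled.pairDensity_bounds (h : Controlled Ω T ϱ p u f S V E A c)
    (hl : CutoffBounds Ω T l L) (hP : ∀ z, p z = ϱ z ^ (3 / 2 : ℝ) * P z)
    (hP0 : ∀ z ∈ cylinder Ω T, 0 ≤ P z) {pr : Space → Space → Space} {k : ℝ}
    (hpr : ∀ η a, ‖pr η a‖ ^ 2 ≤ ‖a‖ ^ 2) (hk0 : 0 ≤ k) (hk : k ≤ 2) (q : SpaceTime × Space) :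
    0 ≤ locDensity l ϱ q.1 * (locDensity l ϱ (q.2, q.1.2) *
      (1 / 2 * ‖pr (q.1.1 - q.2) (locVelocity l u q.1 - locVelocity l u (q.2, q.1.2))‖ ^ 2
        + k * (locDensity l ϱ q.1 ^ (1 / 2 : ℝ) * P q.1))) ∧
    locDensity l ϱ q.1 * (locDensity l ϱ (q.2, q.1.2) *
      (1 / 2 * ‖pr (q.1.1 - q.2) (locVelocity l u q.1 - locVelocity l u (q.2, q.1.2))‖ ^ 2
        + k * (locDensity l ϱ q.1 ^ (1 / 2 : ℝ) * P q.1)))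
      ≤ L ^ 10 * (2 * (majorant Ω T ϱ p u S q.1 * dens Ω T ϱ (q.2, q.1.2))
        + kin Ω T ϱ u (q.2, q.1.2) * dens Ω T ϱ q.1) := by
  have hL := zero_le_one.trans hl.one_le
  have r0 := h.locDensity_nonneg hl q.1
  have r1 := h.locDensity_nonneg hl (q.2, q.1.2)
  have hB := h.dens_nonneg (q.2, q.1.2)
  have hB' := h.dens_nonneg q.1
  have hJ := h.kin_nonneg (q.2, q.1.2)
  have hJ' := h.kin_nonneg q.1
  have hH := h.majorant_nonneg q.1
  have hpe := h.pressure_eq hl hP q.1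
  set a := locVelocity l u q.1 with ha
  set b := locVelocity l u (q.2, q.1.2) with hb
  have d0 := h.locDensity_le hl q.1
  have d1 := h.locDensity_le hl (q.2, q.1.2)
  have k0 := h.locDensity_mul_norm_sq_le hl q.1
  have k1 := h.locDensity_mul_norm_sq_le hl (q.2, q.1.2)
  rw [← ha] at k0
  rw [← hb] at k1
  -- The majorant contains kinetic energy and pressure once each, so twice the majorant covers the
  -- first plus twice the second.
  have hpos : 0 ≤ locDensity l ϱ q.1 * (locDensity l ϱ q.1 ^ (1 / 2 : ℝ) * P q.1) ∧
      L ^ 6 * kin Ω T ϱ u q.1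
        + 2 * (locDensity l ϱ q.1 * (locDensity l ϱ q.1 ^ (1 / 2 : ℝ) * P q.1))
        ≤ 2 * (L ^ 6 * majorant Ω T ϱ p u S q.1) := by
    by_cases hz : q.1 ∈ cylinder Ω T
    · refine ⟨mul_nonneg r0 (mul_nonneg (Real.rpow_nonneg r0 _) (hP0 _ hz)), ?_⟩
      rw [← hpe]
      have e : kin Ω T ϱ u q.1 = ϱ q.1 * ‖u q.1‖ ^ 2 := indicator_of_mem hz _
      have h1 := h.density_le_majorant hz
      have h2 := h.density_nonneg _ hz
      have h3 := h.pressure_nonneg _ hz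
      have h4 := mul_le_mul_of_nonneg_right (hl.pow_le 6 q.1) h3
      have h5 := mul_le_mul_of_nonneg_left h1 (pow_nonneg hL 6)
      have h6 := mul_nonneg (pow_nonneg hL 6) h2
      have h7 := mul_nonneg (pow_nonneg hL 6) hJ'
      rw [← e] at h5
      nlinarith
    · have : kin Ω T ϱ u q.1 = 0 := indicator_of_notMem hz _
      simp only [locDensity, hl.eq_zero _ hz, this]
      simp
      positivity
  obtain ⟨hp0, hp1⟩ := hpos
  have hw : ‖a - b‖ ^ 2 ≤ 2 * (‖a‖ ^ 2 + ‖b‖ ^ 2) := by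
    have := parallelogram_law_with_norm ℝ a b
    nlinarith [sq_nonneg ‖a + b‖]
  have hX := (hpr (q.1.1 - q.2) (a - b)).trans hw
  set X := ‖pr (q.1.1 - q.2) (a - b)‖ ^ 2 with hXdef
  have hX0 : 0 ≤ X := sq_nonneg _
  have e : locDensity l ϱ q.1 * (locDensity l ϱ (q.2, q.1.2) *
      (1 / 2 * X + k * (locDensity l ϱ q.1 ^ (1 / 2 : ℝ) * P q.1)))
      = 1 / 2 * (locDensity l ϱ q.1 * locDensity l ϱ (q.2, q.1.2) * X)
        + k * (locDensity l ϱ q.1 * (locDensity l ϱ q.1 ^ (1 / 2 : ℝ) * P q.1))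
          * locDensity l ϱ (q.2, q.1.2) := by ring
  rw [e]
  refine ⟨by positivity, ?_⟩
  calc _ ≤ 1 / 2 * (locDensity l ϱ q.1 * locDensity l ϱ (q.2, q.1.2)
          * (2 * (‖a‖ ^ 2 + ‖b‖ ^ 2)))
        + 2 * (locDensity l ϱ q.1 * (locDensity l ϱ q.1 ^ (1 / 2 : ℝ) * P q.1))
          * locDensity l ϱ (q.2, q.1.2) := by gcongr
    _ = (locDensity l ϱ q.1 * ‖a‖ ^ 2
          + 2 * (locDensity l ϱ q.1 * (locDensity l ϱ q.1 ^ (1 / 2 : ℝ) * P q.1)))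
          * locDensity l ϱ (q.2, q.1.2)
        + (locDensity l ϱ (q.2, q.1.2) * ‖b‖ ^ 2) * locDensity l ϱ q.1 := by ring
    _ ≤ (2 * (L ^ 6 * majorant Ω T ϱ p u S q.1)) * (L ^ 4 * dens Ω T ϱ (q.2, q.1.2))
        + (L ^ 6 * kin Ω T ϱ u (q.2, q.1.2)) * (L ^ 4 * dens Ω T ϱ q.1) := by
        gcongr
        linarith
    _ = _ := by ring

end bounds

/-! ### Passage to a sharp truncation -/

/-- Smooth weights on `(0, r)` that converge to the indicator function of `[δ, r)`. -/
noncomputable def stepWeight (δ r : ℝ) (n : ℕ) (s : ℝ) : ℝ :=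
  -- A slope of at least `2/δ` makes the first factor vanish up to `δ/2`. The shift by 1 makes it
  -- equal to 1 at `s = δ`, while the second factor vanishes at `s = r`: the limiting interval is
  -- half-open.
  Real.smoothTransition ((2 / δ + n) * (s - δ) + 1)
    * Real.smoothTransition ((2 / δ + n) * (r - s))

lemma isWeight_stepWeight {δ r : ℝ} (hδ : 0 < δ) (hr : δ < r) (n : ℕ) :
    IsWeight (stepWeight δ r n) (δ / 2) r where
  contDiff := (Real.smoothTransition.contDiff.comp (by fun_prop)).mul
    (Real.smoothTransition.contDiff.comp (by fun_prop))
  nonneg s := mul_nonneg (Real.smoothTransition.nonneg _) (Real.smoothTransition.nonneg _)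
  le_one s := mul_le_one₀ (Real.smoothTransition.le_one _) (Real.smoothTransition.nonneg _)
    (Real.smoothTransition.le_one _)
  pos := by positivity
  lt := by linarith
  eq_zero_left s hs := by
    rw [stepWeight, Real.smoothTransition.zero_of_nonpos, zero_mul]
    have h1 : (2 / δ + n) * (s - δ) ≤ (2 / δ + n) * (-(δ / 2)) :=
      mul_le_mul_of_nonneg_left (by linarith) (by positivity)
    have h2 : (2 / δ + n) * (-(δ / 2)) = -1 - n * (δ / 2) := by field_simp; ring
    have h3 : 0 ≤ n * (δ / 2) := by positivity
    linarith
  eq_zero_right s hs := by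
    rw [stepWeight, Real.smoothTransition.zero_of_nonpos (x := (2 / δ + n) * (r - s)), mul_zero]
    exact mul_nonpos_of_nonneg_of_nonpos (by positivity) (by linarith)

lemma tendsto_affine_atTop {a b c : ℝ} (hc : 0 < c) :
    Tendsto (fun n : ℕ => (a + n) * c + b) atTop atTop :=
  tendsto_atTop_add_const_right _ _
    ((tendsto_atTop_add_const_left _ _ tendsto_natCast_atTop_atTop).atTop_mul_const hc)

lemma tendsto_stepWeight {δ r : ℝ} (hδ : 0 < δ) (s : ℝ) :
    Tendsto (fun n => stepWeight δ r n s) atTop (𝓝 ((Ico δ r).indicator (fun _ => 1) s)) := by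
  rcases lt_or_ge s δ with h1 | h1
  · rw [indicator_of_notMem (by simp [h1])]
    refine tendsto_const_nhds.congr' ?_
    filter_upwards [(tendsto_affine_atTop (a := 2 / δ) (b := -1)
      (sub_pos.2 h1)).eventually_ge_atTop 0] with n hn
    rw [stepWeight, Real.smoothTransition.zero_of_nonpos, zero_mul]
    linarith
  rcases le_or_gt r s with h2 | h2
  · rw [indicator_of_notMem (by simp [h2])]
    have h0 : ∀ n, stepWeight δ r n s = 0 := fun n => by
      rw [stepWeight, Real.smoothTransition.zero_of_nonpos (x := (2 / δ + n) * (r - s)), mul_zero]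
      exact mul_nonpos_of_nonneg_of_nonpos (by positivity) (by linarith)
    simp_rw [h0]
    exact tendsto_const_nhds
  · rw [indicator_of_mem (show s ∈ Ico δ r from ⟨h1, h2⟩)]
    refine tendsto_const_nhds.congr' ?_
    filter_upwards [(tendsto_affine_atTop (a := 2 / δ) (b := 0)
      (sub_pos.2 h2)).eventually_ge_atTop 1] with n hn
    rw [stepWeight, Real.smoothTransition.one_of_one_le, Real.smoothTransition.one_of_one_le,
      one_mul]
    · linarith
    · have : 0 ≤ (2 / δ + n) * (s - δ) := mul_nonneg (by positivity) (by linarith)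
      linarith

namespace IsWeight

variable {χ : ℝ → ℝ} {δ r : ℝ}

lemma profile_le_const (h : IsWeight χ δ r) (s : ℝ) : profile χ r s ≤ 1 / δ := by
  have hδ := h.pos
  rcases le_total s δ with hs | hs
  · rw [h.profile_of_le hs, ← h.profile_of_le le_rfl]
    exact h.profile_le hδ
  · exact (h.profile_le (hδ.trans_le hs)).trans (by gcongr)

lemma div_nonneg_of_nonneg (h : IsWeight χ δ r) {s : ℝ} (hs : 0 ≤ s) : 0 ≤ χ s / s :=
  div_nonneg (h.nonneg s) hs

lemma div_le_const (h : IsWeight χ δ r) (s : ℝ) : χ s / s ≤ 1 / δ := by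
  have hδ := h.pos
  rcases le_total s δ with hs | hs
  · rw [h.eq_zero_left s hs, zero_div]; positivity
  · have := h.le_one s
    have := hδ.trans_le hs
    gcongr

lemma profile_eq_setIntegral (h : IsWeight χ δ r) (s : ℝ) :
    profile χ r s = ∫ σ in Ioi s, χ σ / σ ^ 2 := by
  rcases le_total r s with hr | hr
  · rw [h.profile_of_ge hr, setIntegral_eq_zero_of_forall_eq_zero]
    intro σ hσ
    rw [h.eq_zero_right σ (hr.trans (le_of_lt hσ)), zero_div]
  · rw [profile, intervalIntegral.integral_of_le hr]
    refine (setIntegral_eq_of_subset_of_forall_sdiff_eq_zero measurableSet_Ioi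
      Ioc_subset_Ioi_self fun σ hσ => ?_).symm
    have : r ≤ σ := by
      by_contra hlt
      exact hσ.2 ⟨hσ.1, (not_le.1 hlt).le⟩
    rw [h.eq_zero_right σ this, zero_div]

end IsWeight

/-- The truncated profile `s ↦ ∫_{(δ, r)} 1_{s < σ} σ⁻² dσ`. -/
noncomputable def cutProfile (δ r s : ℝ) : ℝ :=
  ∫ σ in Ioo δ r, (Ioi s).indicator (fun σ => 1 / σ ^ 2) σ

lemma integral_Ioo_one_div_sq {a b : ℝ} (ha : 0 < a) (hab : a ≤ b) :
    ∫ σ in Ioo a b, 1 / σ ^ 2 = 1 / a - 1 / b := by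
  have hc : ContinuousOn (fun σ : ℝ => 1 / σ ^ 2) (uIcc a b) := by
    refine ContinuousOn.div (by fun_prop) (by fun_prop) fun σ hσ => ?_
    rw [uIcc_of_le hab] at hσ
    have := ha.trans_le hσ.1
    positivity
  rw [← integral_Ioc_eq_integral_Ioo, ← intervalIntegral.integral_of_le hab,
    intervalIntegral.integral_eq_sub_of_hasDerivAt (f := fun σ => -σ⁻¹) (fun σ hσ => ?_)
      hc.intervalIntegrable]
  · ring
  · rw [uIcc_of_le hab] at hσ
    have := ha.trans_le hσ.1
    simpa using (hasDerivAt_inv this.ne').fun_neg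

lemma integrableOn_one_div_sq {δ r : ℝ} (hδ : 0 < δ) :
    IntegrableOn (fun σ : ℝ => 1 / σ ^ 2) (Ioo δ r) := by
  refine IntegrableOn.mono_set (ContinuousOn.integrableOn_Icc (a := δ) (b := r) ?_)
    Ioo_subset_Icc_self
  refine ContinuousOn.div (by fun_prop) (by fun_prop) fun σ hσ => ?_
  have := hδ.trans_le hσ.1
  positivity

/-- This turns the longitudinal weight into that of `Γ(δ) - Γ(r)`. The half-open interval makes the
identity exact at `s = δ` and `s = r`, in agreement with open balls. -/
lemma cutProfile_sub {δ r s : ℝ} (hδ : 0 < δ) (hr : δ < r) :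
    cutProfile δ r s - (Ico δ r).indicator (fun _ => 1) s / s
      = 1 / δ * (Iio δ).indicator (fun _ => 1) s - 1 / r * (Iio r).indicator (fun _ => 1) s := by
  have e : cutProfile δ r s = ∫ σ in Ioo (max δ s) r, 1 / σ ^ 2 := by
    rw [cutProfile, setIntegral_indicator measurableSet_Ioi, Ioo_inter_Ioi]
  rcases lt_or_ge s δ with h1 | h1
  · rw [e, max_eq_left h1.le, integral_Ioo_one_div_sq hδ hr.le]
    simp [h1, h1.trans hr, not_le.2 h1]
  · rw [e, max_eq_right h1]
    rcases lt_or_ge s r with h2 | h2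
    · rw [integral_Ioo_one_div_sq (hδ.trans_le h1) h2.le]
      simp [h1, h2, not_lt.2 h1]
    · simp [not_lt.2 h1, not_lt.2 h2]

lemma tendsto_profile {δ r : ℝ} (hδ : 0 < δ) (hr : δ < r) (s : ℝ) :
    Tendsto (fun n => profile (stepWeight δ r n) r s) atTop (𝓝 (cutProfile δ r s)) := by
  have hχ := isWeight_stepWeight hδ hr
  have e : cutProfile δ r s
      = ∫ σ in Ioi s, (Ico δ r).indicator (fun _ => 1) σ / σ ^ 2 := by
    have e1 : ∀ σ : ℝ, (Ico δ r).indicator (fun _ => (1 : ℝ)) σ / σ ^ 2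
        = (Ico δ r).indicator (fun σ => 1 / σ ^ 2) σ := fun σ => by
      by_cases h : σ ∈ Ico δ r
      · simp only [indicator_of_mem h]
      · simp only [indicator_of_notMem h, zero_div]
    simp_rw [e1]
    rw [setIntegral_indicator measurableSet_Ico, inter_comm, cutProfile,
      ← integral_Ico_eq_integral_Ioo, setIntegral_indicator measurableSet_Ioi]
  rw [e]
  simp_rw [fun n => (hχ n).profile_eq_setIntegral s]
  -- All weights are supported away from 0, between `δ/2` and `r`, where `σ⁻²` is at most `(δ/2)⁻²`.
  refine tendsto_integral_of_dominated_convergence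
    ((Ioc (δ / 2) r).indicator fun _ => ((δ / 2) ^ 2)⁻¹)
    (fun n => (hχ n).contDiff_div.continuous.aestronglyMeasurable) ?_
    (fun n => ae_of_all _ fun σ => ?_) (ae_of_all _ fun σ => ?_)
  · refine Integrable.integrableOn ?_
    rw [integrable_indicator_iff measurableSet_Ioc]
    exact integrableOn_const measure_Ioc_lt_top.ne
  · rw [Real.norm_of_nonneg (div_nonneg ((hχ n).nonneg σ) (sq_nonneg σ))]
    by_cases h : σ ∈ Ioc (δ / 2) r
    · rw [indicator_of_mem h, div_eq_mul_inv]
      have h1 : (σ ^ 2)⁻¹ ≤ ((δ / 2) ^ 2)⁻¹ := by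
        have := h.1
        gcongr
      exact (mul_le_of_le_one_left (by positivity) ((hχ n).le_one σ)).trans h1
    · rw [indicator_of_notMem h]
      have : stepWeight δ r n σ = 0 := by
        rcases le_or_gt σ (δ / 2) with h1 | h1
        · exact (hχ n).eq_zero_left σ h1
        · exact (hχ n).eq_zero_right σ (le_of_not_ge fun h2 => h ⟨h1, h2⟩)
      rw [this, zero_div]
  · exact (tendsto_stepWeight hδ σ).div_const _

lemma cutProfile_nonneg (δ r s : ℝ) : 0 ≤ cutProfile δ r s :=
  integral_nonneg fun σ => indicator_nonneg (fun _ _ => by positivity) σ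

lemma cutProfile_le {δ r : ℝ} (hδ : 0 < δ) (hr : δ < r) (s : ℝ) :
    cutProfile δ r s ≤ 1 / (δ / 2) :=
  le_of_tendsto' (tendsto_profile hδ hr s) fun n =>
    (isWeight_stepWeight hδ hr n).profile_le_const s

lemma ballInd_eq_indicator (s : ℝ) (z : Space) :
    ballInd s z = (Iio s).indicator (fun _ => 1) ‖z‖ := by
  rcases lt_or_ge ‖z‖ s with h | h
  · rw [ballInd_of_lt h]; simp [h]
  · rw [ballInd_of_le h]; simp [h]

/-- The weighted integrals converge to the truncated ones. -/
lemma tendsto_weighted_integral {δ r : ℝ} (hδ : 0 < δ) (hr : δ < r)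
    {F G : SpaceTime × Space → ℝ} (hF : Integrable F) (hG : Integrable G) :
    Tendsto (fun n => ∫ q, (F q * profile (stepWeight δ r n) r ‖q.1.1 - q.2‖
        + G q * (profile (stepWeight δ r n) r ‖q.1.1 - q.2‖
          - stepWeight δ r n ‖q.1.1 - q.2‖ / ‖q.1.1 - q.2‖))) atTop
      (𝓝 ((∫ q, F q * cutProfile δ r ‖q.1.1 - q.2‖)
        + 1 / δ * (∫ q, G q * ballInd δ (q.1.1 - q.2))
        - 1 / r * ∫ q, G q * ballInd r (q.1.1 - q.2))) := by
  have hχ := isWeight_stepWeight hδ hr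
  have hpm : ∀ n, Measurable (profile (stepWeight δ r n) r) := fun n =>
    (hχ n).contDiff_profile.continuous.measurable
  have hcm : Measurable (cutProfile δ r) :=
    measurable_of_tendsto_metrizable hpm (tendsto_pi_nhds.2 (tendsto_profile hδ hr))
  have hbm := measurable_ballInd
  have iF : Integrable fun q : SpaceTime × Space => F q * cutProfile δ r ‖q.1.1 - q.2‖ :=
    hF.mul_bdd (c := 1 / (δ / 2)) (Measurable.aestronglyMeasurable (by fun_prop))
      (ae_of_all _ fun q => by
        rw [Real.norm_of_nonneg (cutProfile_nonneg _ _ _)]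
        exact cutProfile_le hδ hr _)
  have iG : ∀ s, Integrable fun q : SpaceTime × Space => G q * ballInd s (q.1.1 - q.2) := fun s =>
    hG.mul_bdd (c := 1) (Measurable.aestronglyMeasurable ((hbm s).comp (by fun_prop)))
      (ae_of_all _ fun q => by
        rw [Real.norm_of_nonneg (ballInd_nonneg _ _)]
        exact ballInd_le_one _ _)
  have i1 : Integrable fun q : SpaceTime × Space => F q * cutProfile δ r ‖q.1.1 - q.2‖
      + 1 / δ * (G q * ballInd δ (q.1.1 - q.2)) := iF.add ((iG δ).const_mul _)
  rw [← integral_const_mul, ← integral_const_mul, ← integral_add iF ((iG δ).const_mul _),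
    ← integral_sub i1 ((iG r).const_mul _)]
  have hwm : ∀ n, Measurable (stepWeight δ r n) := fun n => (hχ n).contDiff.continuous.measurable
  refine tendsto_integral_of_dominated_convergence
    (fun q => |F q| * (1 / (δ / 2)) + |G q| * (1 / (δ / 2)))
    (fun n => ?_) ((hF.abs.mul_const _).add (hG.abs.mul_const _))
    (fun n => ae_of_all _ fun q => ?_) (ae_of_all _ fun q => ?_)
  · have := hpm n
    have := hwm n
    exact (hF.1.mul (Measurable.aestronglyMeasurable (by fun_prop))).add
      (hG.1.mul (Measurable.aestronglyMeasurable (by fun_prop)))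
  · have h0 := (hχ n).profile_nonneg ‖q.1.1 - q.2‖
    have h1 := (hχ n).profile_le_const ‖q.1.1 - q.2‖
    have h2 := (hχ n).div_nonneg_of_nonneg (norm_nonneg (q.1.1 - q.2))
    have h3 := (hχ n).div_le_const ‖q.1.1 - q.2‖
    refine (norm_add_le _ _).trans ?_
    rw [norm_mul, norm_mul, Real.norm_eq_abs, Real.norm_eq_abs, Real.norm_eq_abs, Real.norm_eq_abs]
    gcongr
    · rwa [abs_of_nonneg h0]
    · rw [abs_le]; constructor <;> linarith
  · have hp := tendsto_profile hδ hr ‖q.1.1 - q.2‖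
    have hw := (tendsto_stepWeight (r := r) hδ ‖q.1.1 - q.2‖).div_const ‖q.1.1 - q.2‖
    have key := (hp.const_mul (F q)).add ((hp.sub hw).const_mul (G q))
    rw [cutProfile_sub hδ hr, ← ballInd_eq_indicator, ← ballInd_eq_indicator] at key
    convert key using 2
    ring

/-! ### Layer-cake formula and the limit of vanishing truncation -/

/-- The layer-cake form of the truncated weight. -/
lemma lintegral_layers {δ r : ℝ} (hδ : 0 < δ) {F : SpaceTime × Space → ℝ}
    (hF : Measurable F) (hF0 : ∀ q, 0 ≤ F q) :
    ∫⁻ s in Ioo δ r, (∫⁻ q : SpaceTime × Space, ENNReal.ofReal (F q * ballInd s (q.1.1 - q.2)))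
        * ENNReal.ofReal (1 / s ^ 2)
      = ∫⁻ q : SpaceTime × Space, ENNReal.ofReal (F q * cutProfile δ r ‖q.1.1 - q.2‖) := by
  have hmeas : Measurable fun a : ℝ × (SpaceTime × Space) =>
      ENNReal.ofReal (F a.2 * ballInd a.1 (a.2.1.1 - a.2.2)) * ENNReal.ofReal (1 / a.1 ^ 2) := by
    have hb : Measurable fun a : ℝ × (SpaceTime × Space) => ballInd a.1 (a.2.1.1 - a.2.2) := by
      have hset : MeasurableSet {a : ℝ × (SpaceTime × Space) | ‖a.2.1.1 - a.2.2‖ < a.1} :=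
        measurableSet_lt (by fun_prop) (by fun_prop)
      have e : (fun a : ℝ × (SpaceTime × Space) => ballInd a.1 (a.2.1.1 - a.2.2))
          = {a : ℝ × (SpaceTime × Space) | ‖a.2.1.1 - a.2.2‖ < a.1}.indicator fun _ => 1 := by
        ext a
        rcases lt_or_ge ‖a.2.1.1 - a.2.2‖ a.1 with h | h
        · rw [ballInd_of_lt h, indicator_of_mem (by exact h)]
        · rw [ballInd_of_le h, indicator_of_notMem (by simpa using h)]
      rw [e]
      exact measurable_const.indicator hset
    fun_prop
  calc _ = ∫⁻ s in Ioo δ r, ∫⁻ q : SpaceTime × Space,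
        ENNReal.ofReal (F q * ballInd s (q.1.1 - q.2)) * ENNReal.ofReal (1 / s ^ 2) := by
        refine lintegral_congr fun s => ?_
        rw [lintegral_mul_const' _ _ ENNReal.ofReal_ne_top]
    _ = ∫⁻ q : SpaceTime × Space, ∫⁻ s in Ioo δ r,
        ENNReal.ofReal (F q * ballInd s (q.1.1 - q.2)) * ENNReal.ofReal (1 / s ^ 2) :=
        lintegral_lintegral_swap hmeas.aemeasurable
    _ = _ := by
        refine lintegral_congr fun q => ?_
        have hi : Integrable (fun σ : ℝ => (Ioi ‖q.1.1 - q.2‖).indicator (fun σ => 1 / σ ^ 2) σ)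
            (volume.restrict (Ioo δ r)) :=
          (integrableOn_one_div_sq hδ).indicator measurableSet_Ioi
        rw [ENNReal.ofReal_mul (hF0 q), cutProfile, ofReal_integral_eq_lintegral_ofReal hi
          (ae_of_all _ fun σ => indicator_nonneg (fun _ _ => by positivity) σ),
          ← lintegral_const_mul' _ _ ENNReal.ofReal_ne_top]
        refine lintegral_congr fun s => ?_
        rw [ENNReal.ofReal_mul (hF0 q), mul_assoc]
        congr 1
        rcases lt_or_ge ‖q.1.1 - q.2‖ s with h | h
        · rw [ballInd_of_lt h, indicator_of_mem (by exact h)]; simp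
        · rw [ballInd_of_le h, indicator_of_notMem (by simpa using h)]; simp

lemma pairEnergy_eq {ρ : SpaceTime → ℝ} {e : Space → Space → ℝ → ℝ} (hρ : ∀ z, 0 ≤ ρ z)
    (hm : Measurable (pairDensity ρ e)) (s : ℝ) :
    pairEnergy ρ e s
      = ∫⁻ q : SpaceTime × Space, ENNReal.ofReal (pairDensity ρ e q * ballInd s (q.1.1 - q.2)) := by
  have hb := measurable_ballInd s
  rw [Measure.volume_eq_prod, lintegral_prod _ (by fun_prop), pairEnergy]
  refine lintegral_congr fun z => ?_
  rw [← lintegral_const_mul' _ _ ENNReal.ofReal_ne_top,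
    ← lintegral_indicator Metric.isOpen_ball.measurableSet]
  refine lintegral_congr fun y => ?_
  by_cases hy : y ∈ Metric.ball z.1 s
  · rw [indicator_of_mem hy, ballInd_of_lt (by rwa [Metric.mem_ball, dist_comm, dist_eq_norm] at hy),
      ← ENNReal.ofReal_mul (hρ z), mul_one, pairDensity]
  · rw [indicator_of_notMem hy, ballInd_of_le (by
      rwa [Metric.mem_ball, dist_comm, dist_eq_norm, not_lt] at hy), mul_zero, ENNReal.ofReal_zero]

/-- The limit `δ → 0` in the weighted balance, for nonnegative transversal and longitudinal
densities `F` and `G`. -/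
lemma layers_limit {r K : ℝ} (hr : 0 < r) {F G : SpaceTime × Space → ℝ} (hFm : Measurable F)
    (hF0 : ∀ q, 0 ≤ F q) (hF : Integrable F) (hG0 : ∀ q, 0 ≤ G q) (hG : Integrable G)
    (hGlim : Tendsto (fun δ : ℝ => 1 / δ * ∫ q, G q * ballInd δ (q.1.1 - q.2)) (𝓝[>] 0) (𝓝 0))
    (hw : ∀ (χ : ℝ → ℝ) (δ : ℝ), IsWeight χ δ r →
      |∫ q, (F q * profile χ r ‖q.1.1 - q.2‖
        + G q * (profile χ r ‖q.1.1 - q.2‖ - χ ‖q.1.1 - q.2‖ / ‖q.1.1 - q.2‖))| ≤ K) :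
    (∫⁻ s in Ioo 0 r, (∫⁻ q : SpaceTime × Space,
        ENNReal.ofReal (F q * ballInd s (q.1.1 - q.2))) * ENNReal.ofReal (1 / s ^ 2)
      ≤ ENNReal.ofReal (1 / r * (∫ q, G q * ballInd r (q.1.1 - q.2)) + K)) ∧
    |1 / r * (∫ q, G q * ballInd r (q.1.1 - q.2))
      - (∫⁻ s in Ioo 0 r, (∫⁻ q : SpaceTime × Space,
        ENNReal.ofReal (F q * ballInd s (q.1.1 - q.2))) * ENNReal.ofReal (1 / s ^ 2)).toReal|
      ≤ K := by
  set γ : ℝ → ℝ := fun δ => 1 / δ * ∫ q, G q * ballInd δ (q.1.1 - q.2)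
  set φ : ℝ → ℝ≥0∞ := fun s => (∫⁻ q : SpaceTime × Space,
    ENNReal.ofReal (F q * ballInd s (q.1.1 - q.2))) * ENNReal.ofReal (1 / s ^ 2)
  set w : ℝ → ℝ := fun δ => ∫ q, F q * cutProfile δ r ‖q.1.1 - q.2‖
  change (∫⁻ s in Ioo 0 r, φ s ≤ ENNReal.ofReal (γ r + K))
    ∧ |γ r - (∫⁻ s in Ioo 0 r, φ s).toReal| ≤ K
  have hγ0 : ∀ δ : ℝ, 0 < δ → 0 ≤ γ δ := fun δ hδ => mul_nonneg (by positivity)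
    (integral_nonneg fun q => mul_nonneg (hG0 q) (ballInd_nonneg _ _))
  have hw0 : ∀ δ : ℝ, 0 ≤ w δ := fun δ =>
    integral_nonneg fun q => mul_nonneg (hF0 q) (cutProfile_nonneg _ _ _)
  -- The constant `K` does not depend on the smooth weight, so the bound passes to the sharp
  -- truncation, whose longitudinal part is `γ δ - γ r`.
  have hbound : ∀ δ : ℝ, 0 < δ → δ < r → |w δ + γ δ - γ r| ≤ K := fun δ hδ hδr =>
    le_of_tendsto' (tendsto_weighted_integral hδ hδr hF hG).abs
      fun n => hw _ _ (isWeight_stepWeight hδ hδr n)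
  have hlay : ∀ δ : ℝ, 0 < δ → δ < r → ∫⁻ s in Ioo δ r, φ s = ENNReal.ofReal (w δ) := by
    intro δ hδ hδr
    have hcm : Measurable (cutProfile δ r) := measurable_of_tendsto_metrizable
      (fun n => (isWeight_stepWeight hδ hδr n).contDiff_profile.continuous.measurable)
      (tendsto_pi_nhds.2 (tendsto_profile hδ hδr))
    rw [lintegral_layers hδ hFm hF0, ofReal_integral_eq_lintegral_ofReal
      (hF.mul_bdd (c := 1 / (δ / 2)) (Measurable.aestronglyMeasurable (by fun_prop))
        (ae_of_all _ fun q => by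
          rw [Real.norm_of_nonneg (cutProfile_nonneg _ _ _)]
          exact cutProfile_le hδ hδr _))
      (ae_of_all _ fun q => mul_nonneg (hF0 q) (cutProfile_nonneg _ _ _))]
  -- A sequence in `(0, r)` decreasing to 0: the truncated integrals increase to the full one, so
  -- its finiteness need not be known beforehand.
  set d : ℕ → ℝ := fun n => r / (n + 2)
  have hd0 : ∀ n, 0 < d n := fun n => by positivity
  have hdr : ∀ n, d n < r := fun n => by
    rw [div_lt_iff₀ (by positivity)]
    have : (0 : ℝ) ≤ n := n.cast_nonneg
    nlinarith
  have hanti : Antitone d := fun i j hij => by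
    have : (i : ℝ) ≤ j := by exact_mod_cast hij
    simp only [d]
    gcongr
  have hdlim : Tendsto d atTop (𝓝 0) :=
    tendsto_const_nhds.div_atTop (tendsto_atTop_add_const_right _ _ tendsto_natCast_atTop_atTop)
  have hmono : Monotone fun n => Ioo (d n) r := fun i j hij => Ioo_subset_Ioo_left (hanti hij)
  have hU : ⋃ n, Ioo (d n) r = Ioo 0 r := by
    ext s
    simp only [mem_iUnion, mem_Ioo]
    refine ⟨fun ⟨n, h1, h2⟩ => ⟨(hd0 n).trans h1, h2⟩, fun ⟨h1, h2⟩ => ?_⟩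
    obtain ⟨n, hn⟩ := (hdlim.eventually_lt_const h1).exists
    exact ⟨n, hn, h2⟩
  have hlim : Tendsto (fun n => ENNReal.ofReal (w (d n))) atTop (𝓝 (∫⁻ s in Ioo 0 r, φ s)) := by
    rw [← hU, setLIntegral_iUnion_of_directed _ hmono.directed_le]
    simp_rw [← fun n => hlay (d n) (hd0 n) (hdr n)]
    exact tendsto_atTop_iSup fun i j hij => lintegral_mono_set (hmono hij)
  -- Dropping `γ (d n) ≥ 0` bounds the truncated integrals uniformly; this is where finiteness comes
  -- from.
  have hle : ∫⁻ s in Ioo 0 r, φ s ≤ ENNReal.ofReal (γ r + K) := by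
    refine le_of_tendsto' hlim fun n => ENNReal.ofReal_le_ofReal ?_
    have h1 := (abs_le.1 (hbound (d n) (hd0 n) (hdr n))).2
    have h2 := hγ0 (d n) (hd0 n)
    linarith
  refine ⟨hle, ?_⟩
  have hfin : ∫⁻ s in Ioo 0 r, φ s ≠ ⊤ := (hle.trans_lt ENNReal.ofReal_lt_top).ne
  have hreal : Tendsto (fun n => w (d n)) atTop (𝓝 (∫⁻ s in Ioo 0 r, φ s).toReal) := by
    have := (ENNReal.tendsto_toReal hfin).comp hlim
    simpa only [Function.comp_def, ENNReal.toReal_ofReal (hw0 _)] using this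
  have hγlim : Tendsto (fun n => γ (d n)) atTop (𝓝 0) :=
    hGlim.comp (tendsto_nhdsWithin_iff.2 ⟨hdlim, Eventually.of_forall hd0⟩)
  -- Only the two-sided estimate needs `γ δ → 0`.
  have := le_of_tendsto' ((hreal.add hγlim).sub_const (γ r)).abs
    fun n => hbound (d n) (hd0 n) (hdr n)
  rwa [add_zero, abs_sub_comm] at this

/-! ### Interaction at small distances and the final bounds -/

section bounds

variable {Ω : Set Space} {T : ℝ} {ϱ p P : SpaceTime → ℝ} {u f : SpaceTime → Space}
  {S : SpaceTime → Matrix (Fin 3) (Fin 3) ℝ} {V E A c L : ℝ} {l : SpaceTime → ℝ}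

/-- The interaction of the majorant with the density at distances less than `r`. -/
noncomputable def ballInteraction (Ω : Set Space) (T : ℝ) (ϱ p : SpaceTime → ℝ)
    (u : SpaceTime → Space) (S : SpaceTime → Matrix (Fin 3) (Fin 3) ℝ) (r : ℝ) : ℝ :=
  ∫ q : SpaceTime × Space,
    majorant Ω T ϱ p u S q.1 * (dens Ω T ϱ (q.2, q.1.2) * ballInd r (q.1.1 - q.2))

lemma Controlled.ballInteraction_nonneg (h : Controlled Ω T ϱ p u f S V E A c) (r : ℝ) :
    0 ≤ ballInteraction Ω T ϱ p u S r :=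
  integral_nonneg fun _ => mul_nonneg (h.majorant_nonneg _)
    (mul_nonneg (h.dens_nonneg _) (ballInd_nonneg _ _))

lemma Controlled.ballInteraction_le (h : Controlled Ω T ϱ p u f S V E A c) {r : ℝ} (hr : 0 < r) :
    1 / r * ballInteraction Ω T ϱ p u S r ≤ A * (E + unitBallVolume) := by
  have h1 := (h.pair_dens_ball hr h.integrable_majorant h.majorant_nonneg).2
  have h2 := h.integral_majorant_le
  have hE := h.E_nonneg
  have hV := unitBallVolume_nonneg
  calc _ ≤ 1 / r * (A * ((E + unitBallVolume) * r)) := by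
        gcongr
        exact h1.trans (by gcongr)
    _ = _ := by field_simp

lemma ae_fst_ne : ∀ᵐ q : SpaceTime × Space, q.1.1 ≠ q.2 := by
  have hm : MeasurableSet {q : SpaceTime × Space | ¬q.1.1 ≠ q.2} := by
    simp only [not_not]
    exact measurableSet_eq_fun (by fun_prop) (by fun_prop)
  rw [ae_iff, Measure.volume_eq_prod, Measure.measure_prod_null hm]
  refine ae_of_all _ fun z => ?_
  have : Prod.mk z ⁻¹' {q : SpaceTime × Space | ¬q.1.1 ≠ q.2} = {z.1} := by
    ext y; simp [eq_comm]
  change volume (Prod.mk z ⁻¹' _) = 0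
  rw [this]
  simp

/-- Dominated convergence: the balls shrink to the diagonal, which is a null set. -/
lemma tendsto_integral_mul_ballInd {F : SpaceTime × Space → ℝ} (hF : Integrable F) :
    Tendsto (fun δ : ℝ => ∫ q, F q * ballInd δ (q.1.1 - q.2)) (𝓝[>] 0) (𝓝 0) := by
  suffices h : Tendsto (fun δ : ℝ => ∫ q, F q * ballInd δ (q.1.1 - q.2)) (𝓝[>] 0)
      (𝓝 (∫ _ : SpaceTime × Space, (0 : ℝ))) by simpa only [integral_zero] using h
  refine tendsto_integral_filter_of_dominated_convergence (fun q => |F q|)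
    (Eventually.of_forall fun δ => ?_) (Eventually.of_forall fun δ => ae_of_all _ fun q => ?_)
    hF.abs ?_
  · have := measurable_ballInd δ
    exact hF.1.mul (Measurable.aestronglyMeasurable (by fun_prop))
  · rw [norm_mul, Real.norm_of_nonneg (ballInd_nonneg _ _)]
    exact mul_le_of_le_one_right (abs_nonneg _) (ballInd_le_one _ _)
  · filter_upwards [ae_fst_ne] with q hq
    refine tendsto_const_nhds.congr' ?_
    have hpos : 0 < ‖q.1.1 - q.2‖ := norm_pos_iff.2 (sub_ne_zero.2 hq)
    filter_upwards [nhdsWithin_le_nhds (eventually_lt_nhds hpos)] with δ hδ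
    rw [ballInd_of_le hδ.le, mul_zero]

/-- The bound of `ballInteraction_le` is only `O(1)`. With `a = δM` in `density_le` the quotient is
at most `M J(δ) + A |B_1| / M²`, where `J(δ)` integrates a fixed integrable function over pairs at
distance less than `δ`. Let `δ → 0` for fixed `M`, with `M` large. -/
lemma Controlled.tendsto_ballInteraction (h : Controlled Ω T ϱ p u f S V E A c) :
    Tendsto (fun δ : ℝ => 1 / δ * ballInteraction Ω T ϱ p u S δ) (𝓝[>] 0) (𝓝 0) := by
  have hQ := measurableSet_cylinder h.isOpen T
  have hA := h.A_nonneg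
  have hV := unitBallVolume_nonneg
  have hp0 : ∀ z, 0 ≤ (cylinder Ω T).indicator p z := fun z => indicator_nonneg h.pressure_nonneg z
  have hpp : Integrable fun q : SpaceTime × Space =>
      majorant Ω T ϱ p u S q.1 * (cylinder Ω T).indicator p (q.2, q.1.2) := by
    have := (pair_bound (κ := fun _ => 1) h.integrable_majorant h.majorant_nonneg
      (h.measurable_pressure.indicator hQ) measurable_const
      (fun z x => by simpa using hp0 z) h.E_nonneg
      (by filter_upwards [h.slice_pressure] with t ht x; simpa using ht)).1
    simpa using this
  set J : ℝ → ℝ := fun δ => ∫ q : SpaceTime × Space,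
    majorant Ω T ϱ p u S q.1 * (cylinder Ω T).indicator p (q.2, q.1.2) * ballInd δ (q.1.1 - q.2)
  have hJ : Tendsto J (𝓝[>] 0) (𝓝 0) := tendsto_integral_mul_ballInd hpp
  have key : ∀ M : ℝ, 0 < M → ∀ δ : ℝ, 0 < δ → 1 / δ * ballInteraction Ω T ϱ p u S δ
      ≤ M * J δ + A * unitBallVolume / M ^ 2 := by
    intro M hM δ hδ
    have hbm := measurable_ballInd δ
    obtain ⟨i1, b1⟩ := pair_bound (Y := fun _ => 1) (κ := ballInd δ) (B := δ ^ 3 * unitBallVolume)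
      h.integrable_majorant h.majorant_nonneg
      measurable_const hbm (fun z x => by simpa using ballInd_nonneg δ x) (by positivity)
      (ae_of_all _ fun t x => by simpa using (lintegral_ballInd x hδ.le).le)
    have i2 : Integrable fun q : SpaceTime × Space => majorant Ω T ϱ p u S q.1
        * (cylinder Ω T).indicator p (q.2, q.1.2) * ballInd δ (q.1.1 - q.2) :=
      hpp.mul_bdd (c := 1) (Measurable.aestronglyMeasurable (by fun_prop))
        (ae_of_all _ fun q => by
          rw [Real.norm_of_nonneg (ballInd_nonneg _ _)]
          exact ballInd_le_one _ _)
    have h1 : ballInteraction Ω T ϱ p u S δ ≤ δ * M * J δ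
        + ((δ * M) ^ 2)⁻¹ * (A * (δ ^ 3 * unitBallVolume)) := by
      calc _ ≤ ∫ q : SpaceTime × Space, (δ * M * (majorant Ω T ϱ p u S q.1
              * (cylinder Ω T).indicator p (q.2, q.1.2) * ballInd δ (q.1.1 - q.2))
            + ((δ * M) ^ 2)⁻¹ * (majorant Ω T ϱ p u S q.1 * (1 * ballInd δ (q.1.1 - q.2)))) := by
            refine integral_mono (h.pair_dens_ball hδ h.integrable_majorant h.majorant_nonneg).1
              ((i2.const_mul _).add (i1.const_mul _)) fun q => ?_
            have e1 : dens Ω T ϱ (q.2, q.1.2)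
                ≤ δ * M * (cylinder Ω T).indicator p (q.2, q.1.2) + ((δ * M) ^ 2)⁻¹ := by
              by_cases hz : (q.2, q.1.2) ∈ cylinder Ω T
              · rw [dens, indicator_of_mem hz, indicator_of_mem hz]
                exact h.density_le _ hz _ (by positivity)
              · rw [dens, indicator_of_notMem hz, indicator_of_notMem hz, mul_zero, zero_add]
                positivity
            have e2 := mul_le_mul_of_nonneg_left (mul_le_mul_of_nonneg_right e1
              (ballInd_nonneg δ (q.1.1 - q.2))) (h.majorant_nonneg q.1)
            refine e2.trans (le_of_eq ?_)
            ring
        _ = δ * M * J δ + ((δ * M) ^ 2)⁻¹ * ∫ q : SpaceTime × Space,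
              majorant Ω T ϱ p u S q.1 * (1 * ballInd δ (q.1.1 - q.2)) := by
            rw [integral_add (i2.const_mul _) (i1.const_mul _), integral_const_mul,
              integral_const_mul]
        _ ≤ _ := by
            gcongr
            exact b1.trans (by gcongr; exact h.integral_majorant_le)
    calc _ ≤ 1 / δ * (δ * M * J δ + ((δ * M) ^ 2)⁻¹ * (A * (δ ^ 3 * unitBallVolume))) := by gcongr
      _ = _ := by field_simp
  refine tendsto_order.2 ⟨fun a ha => ?_, fun a ha => ?_⟩
  · filter_upwards [self_mem_nhdsWithin] with δ hδ
    have := h.ballInteraction_nonneg δ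
    have : 0 < δ := hδ
    exact ha.trans_le (by positivity)
  -- This choice gives `(a/2) M = a/2 + A |B_1|`, and `M ≥ 1` then makes the second term less than
  -- `a/2`.
  · set M := 1 + 2 * (A * unitBallVolume) / a with hM
    have hM1 : 1 ≤ M := le_add_of_nonneg_right (by positivity)
    have hM0 : 0 < M := by linarith
    have hsmall : A * unitBallVolume / M ^ 2 < a / 2 := by
      rw [div_lt_iff₀ (by positivity)]
      have e : a / 2 * M = a / 2 + A * unitBallVolume := by rw [hM]; field_simp
      have e' : a / 2 * M ^ 2 = (a / 2 + A * unitBallVolume) * M := by rw [← e]; ring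
      rw [e']
      have := le_mul_of_one_le_right (by positivity : 0 ≤ a / 2 + A * unitBallVolume) hM1
      linarith
    have hJM : Tendsto (fun δ => M * J δ) (𝓝[>] 0) (𝓝 0) := by simpa using hJ.const_mul M
    filter_upwards [self_mem_nhdsWithin, hJM.eventually_lt_const (half_pos ha)] with δ hδ h1
    have := key M hM0 δ hδ
    linarith

/-- The bound for pair densities used below. -/
noncomputable def pairMajorant (Ω : Set Space) (T : ℝ) (ϱ p : SpaceTime → ℝ)
    (u : SpaceTime → Space) (S : SpaceTime → Matrix (Fin 3) (Fin 3) ℝ)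
    (q : SpaceTime × Space) : ℝ :=
  2 * (majorant Ω T ϱ p u S q.1 * dens Ω T ϱ (q.2, q.1.2))
    + kin Ω T ϱ u (q.2, q.1.2) * dens Ω T ϱ q.1

lemma Controlled.integrable_pairMajorant (h : Controlled Ω T ϱ p u f S V E A c) :
    Integrable (pairMajorant Ω T ϱ p u S) :=
  ((h.pair_dens h.integrable_majorant h.majorant_nonneg).1.const_mul 2).add
    (integrable_swapPoints (h.pair_dens h.integrable_kin h.kin_nonneg).1)

/-- The factor 3 is 2 + 1: after the exchange of points the kinetic term is bounded by one more copy
of the interaction. -/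
lemma Controlled.integral_pairMajorant_ball_le (h : Controlled Ω T ϱ p u f S V E A c) {r : ℝ}
    (hr : 0 < r) :
    Integrable (fun q => pairMajorant Ω T ϱ p u S q * ballInd r (q.1.1 - q.2)) ∧
    ∫ q, pairMajorant Ω T ϱ p u S q * ballInd r (q.1.1 - q.2)
      ≤ 3 * ballInteraction Ω T ϱ p u S r := by
  obtain ⟨i1, -⟩ := h.pair_dens_ball hr h.integrable_majorant h.majorant_nonneg
  obtain ⟨i2, -⟩ := h.pair_dens_ball hr h.integrable_kin h.kin_nonneg
  have i3 := integrable_swapPoints i2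
  have e3 := integral_swapPoints fun q : SpaceTime × Space =>
    kin Ω T ϱ u q.1 * (dens Ω T ϱ (q.2, q.1.2) * ballInd r (q.1.1 - q.2))
  have e : (fun q => pairMajorant Ω T ϱ p u S q * ballInd r (q.1.1 - q.2))
      = fun q : SpaceTime × Space => 2 * (majorant Ω T ϱ p u S q.1
          * (dens Ω T ϱ (q.2, q.1.2) * ballInd r (q.1.1 - q.2)))
        + kin Ω T ϱ u (q.2, q.1.2) * (dens Ω T ϱ q.1 * ballInd r (q.2 - q.1.1)) := by
    ext q
    rw [pairMajorant, ← neg_sub q.1.1 q.2, ballInd_neg]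
    ring
  rw [e]
  refine ⟨(i1.const_mul 2).add i3, ?_⟩
  rw [integral_add (i1.const_mul 2) i3, integral_const_mul, e3]
  have : ∫ q : SpaceTime × Space,
      kin Ω T ϱ u q.1 * (dens Ω T ϱ (q.2, q.1.2) * ballInd r (q.1.1 - q.2))
        ≤ ballInteraction Ω T ϱ p u S r := by
    refine integral_mono i2 i1 fun q => mul_le_mul_of_nonneg_right ?_
      (mul_nonneg (h.dens_nonneg _) (ballInd_nonneg _ _))
    have := h.dens_add_kin_le q.1
    have := h.dens_nonneg q.1
    linarith
  rw [ballInteraction] at this ⊢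
  linarith

lemma Controlled.measurable_pairDensity_perp (h : Controlled Ω T ϱ p u f S V E A c)
    (hl : CutoffBounds Ω T l L) (hPm : Measurable P) :
    Measurable (pairDensity (locDensity l ϱ)
      (energyPerp (locDensity l ϱ) (locVelocity l u) P)) := by
  have m1 := h.measurable_locDensity hl
  have m2 := measurable_locVelocity hl.measurable h.measurable_velocity
  unfold pairDensity energyPerp projPerp projPar
  fun_prop

lemma Controlled.measurable_pairDensity_par (h : Controlled Ω T ϱ p u f S V E A c)
    (hl : CutoffBounds Ω T l L) (hPm : Measurable P) :
    Measurable (pairDensity (locDensity l ϱ)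
      (energyPar (locDensity l ϱ) (locVelocity l u) P)) := by
  have m1 := h.measurable_locDensity hl
  have m2 := measurable_locVelocity hl.measurable h.measurable_velocity
  unfold pairDensity energyPar projPar
  fun_prop

lemma Controlled.pairDensity_perp_bounds (h : Controlled Ω T ϱ p u f S V E A c)
    (hl : CutoffBounds Ω T l L) (hP : ∀ z, p z = ϱ z ^ (3 / 2 : ℝ) * P z)
    (hP0 : ∀ z ∈ cylinder Ω T, 0 ≤ P z) (q : SpaceTime × Space) :
    0 ≤ pairDensity (locDensity l ϱ) (energyPerp (locDensity l ϱ) (locVelocity l u) P) q ∧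
    pairDensity (locDensity l ϱ) (energyPerp (locDensity l ϱ) (locVelocity l u) P) q
      ≤ L ^ 10 * pairMajorant Ω T ϱ p u S q :=
  h.pairDensity_bounds hl hP hP0 norm_projPerp_sq_le zero_le_two le_rfl q

lemma Controlled.pairDensity_par_bounds (h : Controlled Ω T ϱ p u f S V E A c)
    (hl : CutoffBounds Ω T l L) (hP : ∀ z, p z = ϱ z ^ (3 / 2 : ℝ) * P z)
    (hP0 : ∀ z ∈ cylinder Ω T, 0 ≤ P z) (q : SpaceTime × Space) :
    0 ≤ pairDensity (locDensity l ϱ) (energyPar (locDensity l ϱ) (locVelocity l u) P) q ∧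
    pairDensity (locDensity l ϱ) (energyPar (locDensity l ϱ) (locVelocity l u) P) q
      ≤ L ^ 10 * pairMajorant Ω T ϱ p u S q := by
  have := h.pairDensity_bounds hl hP hP0 norm_projPar_sq_le zero_le_one one_le_two q
  simp only [one_mul] at this
  exact this

/-- The bounds for `W`, `Γ` and `Γ - W` of controlled fields that satisfy the balance laws. -/
theorem Controlled.energy_bounds (h : Controlled Ω T ϱ p u f S V E A c)
    (hl : CutoffBounds Ω T l L) (hP : ∀ z, p z = ϱ z ^ (3 / 2 : ℝ) * P z) (hPm : Measurable P)
    (hP0 : ∀ z ∈ cylinder Ω T, 0 ≤ P z)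
    (hmass : IsBalance (locDensity l ϱ) (locSource l ϱ u) (locCurrent l ϱ u))
    (hmom : ∀ i, IsBalance (locMomentum l ϱ u i) (locForce l ϱ p u f S i)
      (locFlux l ϱ p u S i)) {r G K : ℝ} (hr : 0 < r) (hr1 : r ≤ 1)
    (hG : G = L ^ 10 * (3 * (A * (E + unitBallVolume))))
    (hK : K = L ^ 10 * (A * ((147 + 3 * c) * (E + unitBallVolume)
      + 108 * unitBallVolume + 48 * E))) :
    Wen (locDensity l ϱ) (locVelocity l u) P r + Gam (locDensity l ϱ) (locVelocity l u) P r
      ≤ ENNReal.ofReal (2 * G + K) ∧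
    |Phi (locDensity l ϱ) (locVelocity l u) P r| ≤ (2 * G + K) * √r := by
  have hL := zero_le_one.trans hl.one_le
  have hE := h.E_nonneg
  have hA := h.A_nonneg
  have hc := h.c_nonneg
  have hV := unitBallVolume_nonneg
  have hG0 : 0 ≤ G := by rw [hG]; positivity
  have hK0 : 0 ≤ K := by rw [hK]; positivity
  have hs0 := Real.sqrt_nonneg r
  have hs1 : √r ≤ 1 := Real.sqrt_le_one.2 hr1
  have mF := h.measurable_pairDensity_perp hl hPm
  have mG := h.measurable_pairDensity_par hl hPm
  have bF := h.pairDensity_perp_bounds hl hP hP0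
  have bG := h.pairDensity_par_bounds hl hP hP0
  have hρ := h.locDensity_nonneg hl
  set F₁ := pairDensity (locDensity l ϱ) (energyPerp (locDensity l ϱ) (locVelocity l u) P)
  set F₂ := pairDensity (locDensity l ϱ) (energyPar (locDensity l ϱ) (locVelocity l u) P)
  have iM := h.integrable_pairMajorant.const_mul (L ^ 10)
  have iF : Integrable F₁ := iM.mono' mF.aestronglyMeasurable
    (ae_of_all _ fun q => by rw [Real.norm_of_nonneg (bF q).1]; exact (bF q).2)
  have iG : Integrable F₂ := iM.mono' mG.aestronglyMeasurable
    (ae_of_all _ fun q => by rw [Real.norm_of_nonneg (bG q).1]; exact (bG q).2)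
  have iGb : ∀ s : ℝ, Integrable fun q : SpaceTime × Space => F₂ q * ballInd s (q.1.1 - q.2) := by
    intro s
    have hb := measurable_ballInd s
    exact iG.mul_bdd (c := 1) (Measurable.aestronglyMeasurable (by fun_prop))
      (ae_of_all _ fun q => by
        rw [Real.norm_of_nonneg (ballInd_nonneg _ _)]
        exact ballInd_le_one _ _)
  have g0 : ∀ s : ℝ, 0 ≤ ∫ q, F₂ q * ballInd s (q.1.1 - q.2) := fun s =>
    integral_nonneg fun q => mul_nonneg (bG q).1 (ballInd_nonneg _ _)
  -- A single comparison serves twice: at `s = r` it bounds `Γ(r)`, and as `s → 0` it makes `Γ(s)`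
  -- vanish.
  have hint : ∀ s : ℝ, 0 < s → 1 / s * (∫ q, F₂ q * ballInd s (q.1.1 - q.2))
      ≤ L ^ 10 * (3 * (1 / s * ballInteraction Ω T ϱ p u S s)) := by
    intro s hs
    obtain ⟨i1, b1⟩ := h.integral_pairMajorant_ball_le hs
    have h1 : ∫ q, F₂ q * ballInd s (q.1.1 - q.2)
        ≤ L ^ 10 * ∫ q, pairMajorant Ω T ϱ p u S q * ballInd s (q.1.1 - q.2) := by
      rw [← integral_const_mul]
      refine integral_mono (iGb s) (i1.const_mul _) fun q => ?_
      have := mul_le_mul_of_nonneg_right (bG q).2 (ballInd_nonneg s (q.1.1 - q.2))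
      rwa [mul_assoc] at this
    calc _ ≤ 1 / s * (L ^ 10 * (3 * ballInteraction Ω T ϱ p u S s)) := by
          gcongr
          exact h1.trans (by gcongr)
      _ = _ := by ring
  have hγ : 1 / r * (∫ q, F₂ q * ballInd r (q.1.1 - q.2)) ≤ G := by
    rw [hG]
    refine (hint r hr).trans ?_
    have := h.ballInteraction_le hr
    gcongr
  have hlim : Tendsto (fun δ : ℝ => 1 / δ * ∫ q, F₂ q * ballInd δ (q.1.1 - q.2))
      (𝓝[>] 0) (𝓝 0) := by
    have h1 := (h.tendsto_ballInteraction.const_mul 3).const_mul (L ^ 10)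
    rw [mul_zero, mul_zero] at h1
    refine squeeze_zero' ?_ ?_ h1
    · filter_upwards [self_mem_nhdsWithin] with δ hδ
      exact mul_nonneg (one_div_nonneg.2 (le_of_lt hδ)) (g0 δ)
    · filter_upwards [self_mem_nhdsWithin] with δ hδ using hint δ hδ
  obtain ⟨hW, hΦ⟩ := layers_limit (K := K * √r) hr mF (fun q => (bF q).1) iF
    (fun q => (bG q).1) iG hlim (fun χ δ hχ => by
      have := h.weighted_bound hl hχ hr1 hP hmass hmom
      rw [hK]
      refine this.trans (le_of_eq ?_)
      ring)
  have eW : Wen (locDensity l ϱ) (locVelocity l u) P r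
      = ∫⁻ s in Ioo 0 r, (∫⁻ q : SpaceTime × Space,
        ENNReal.ofReal (F₁ q * ballInd s (q.1.1 - q.2))) * ENNReal.ofReal (1 / s ^ 2) := by
    rw [Wen]
    exact lintegral_congr fun s => by rw [pairEnergy_eq hρ mF s]
  have eG : Gam (locDensity l ϱ) (locVelocity l u) P r
      = ENNReal.ofReal (1 / r * ∫ q, F₂ q * ballInd r (q.1.1 - q.2)) := by
    rw [Gam, pairEnergy_eq hρ mG r, ENNReal.ofReal_mul (by positivity),
      ofReal_integral_eq_lintegral_ofReal (iGb r)
        (ae_of_all _ fun q => mul_nonneg (bG q).1 (ballInd_nonneg _ _))]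
  have hγ0 : 0 ≤ 1 / r * ∫ q, F₂ q * ballInd r (q.1.1 - q.2) :=
    mul_nonneg (by positivity) (g0 r)
  rw [← eW] at hW hΦ
  have hKs : K * √r ≤ K := mul_le_of_le_one_right hK0 hs1
  constructor
  · rw [eG]
    -- `W ≤ Γ + K√r ≤ G + K` and `Γ ≤ G`, whence `2 * G + K`.
    calc _ ≤ ENNReal.ofReal (G + K) + ENNReal.ofReal G :=
          add_le_add (hW.trans (ENNReal.ofReal_le_ofReal (by linarith)))
            (ENNReal.ofReal_le_ofReal hγ)
      _ = _ := by
          rw [← ENNReal.ofReal_add (by positivity) hG0]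
          congr 1
          ring
  · rw [Phi, eG, ENNReal.toReal_ofReal hγ0]
    refine hΦ.trans ?_
    gcongr
    linarith

end bounds

end CriticalNS

theorem proposition3p1 (Ω : Set CriticalNS.Space) (hΩ : IsOpen Ω)
    (hΩb : Bornology.IsBounded Ω) (T : ℝ) (hT : 0 < T)
    (l : CriticalNS.SpaceTime → ℝ) (hl : CriticalNS.IsTest (CriticalNS.cylinder Ω T) l)
    (hl0 : ∀ z, 0 ≤ l z) (E cS cf : ℝ≥0) :
    ∃ C : ℝ, ∀ (ε m : ℝ), 0 < ε → 1 < m →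
      ∀ (ϱ : CriticalNS.SpaceTime → ℝ) (u f : CriticalNS.SpaceTime → CriticalNS.Space)
        (S D : CriticalNS.SpaceTime → Matrix (Fin 3) (Fin 3) ℝ),
      CriticalNS.IsWeakSolution Ω T ε m ϱ u f S →
      CriticalNS.EnergyEstimate Ω T ε m ϱ u D E →
      CriticalNS.normL2 (CriticalNS.cylinder Ω T) S ≤ cS →
      (∀ᵐ z ∂(volume.restrict (CriticalNS.cylinder Ω T)), ‖f z‖ ≤ cf) →
      ∀ r ∈ Ioc (0 : ℝ) (Real.exp (-1)),
        CriticalNS.Wen (CriticalNS.locDensity l ϱ) (CriticalNS.locVelocity l u)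
            (CriticalNS.pressureFactor ε m ϱ) r
          + CriticalNS.Gam (CriticalNS.locDensity l ϱ) (CriticalNS.locVelocity l u)
            (CriticalNS.pressureFactor ε m ϱ) r ≤ ENNReal.ofReal C ∧
        |CriticalNS.Phi (CriticalNS.locDensity l ϱ) (CriticalNS.locVelocity l u)
            (CriticalNS.pressureFactor ε m ϱ) r| ≤ C * Real.sqrt r := by
  obtain ⟨L, hL⟩ := CriticalNS.exists_cutoffBounds hl hl0
  set V := (volume Ω).toReal
  set A := T * (V + (V + E) + E + E) + (cS : ℝ) ^ 2
  refine ⟨2 * (L ^ 10 * (3 * (A * (E + CriticalNS.unitBallVolume))))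
    + L ^ 10 * (A * ((147 + 3 * cf) * (E + CriticalNS.unitBallVolume)
      + 108 * CriticalNS.unitBallVolume + 48 * E)), fun ε m hε _ ϱ u f S D hw he hS hf r hr => ?_⟩
  have h := CriticalNS.controlled_of_energyEstimate hΩ hΩb hT hε hw he hS hf
  exact h.energy_bounds hL (fun _ => rfl)
    (CriticalNS.measurable_pressureFactor hw.measurable_density)
    (fun z hz => zero_le_one.trans (CriticalNS.one_le_pressureFactor hε (hw.density_nonneg z hz)))
    (CriticalNS.mass_balance hl hw) (CriticalNS.momentum_balance h hl hw) hr.1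
    -- Of the upper limit for `r` only `r ≤ 1` matters, so that `r ≤ √r ≤ 1`.
    (hr.2.trans (Real.exp_le_one_iff.2 (by norm_num))) rfl rfl
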